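/- Let $M$ be a compact connected smooth manifold (Hausdorff, without boundary) with $H_1(M;\mathbb Z)\cong\mathbb Z^b$ for some $b>0$, and let $\pi:\tilde M_a\to M$ be its universal Abelian cover, i.e. the connected covering space corresponding to the commutator subgroup of $\pi_1(M)$. Fix a basis $\Gamma_1,\dots,\Gamma_b$ of $H_1(M;\mathbb Z)$, smooth closed one-forms $\omega_1,\dots,\omega_b$ on $M$ with $\int_{\Gamma_j}\omega_i=\delta_{ij}$ (for instance harmonic ones), and a point $\tilde x_0\in\tilde M_a$, and let $\tilde\iota:\tilde M_a\to\mathbb R^b$ be given by $\tilde\iota_i(\tilde x)=\int_\gamma\pi^*\omega_i$, where $\gamma$ is any smooth path in $\tilde M_a$ from $\tilde x_0$ to $\tilde x$. A metric on $\tilde M_a$ is called equivariant if it induces the topology of $\tilde M_a$ and is invariant under all deck transformations, and proper if its closed balls are compact. For an integer matrix $A$ let $\Phi_A$ be the induced endomorphism of $\mathbb T^b=\mathbb R^b/\mathbb Z^b$. **1. Expanding case.** Let $f:M\to M$ be continuous, with lift $\tilde f:\tilde M_a\to\tilde M_a$, and let $A$ be the matrix of $f_*$ on $H_1(M;\mathbb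 Z)$ in the basis $\Gamma$. Assume that $f$ is $H_1$-expanding: all complex eigenvalues $\mu$ of $A$ satisfy $|\mu|>1$. Then the limit $\tilde\beta(\tilde x)=\lim_{n\to\infty}A^{-n}\,\tilde\iota(\tilde f^n(\tilde x))$ exists for every $\tilde x\in\tilde M_a$, $\tilde\beta$ is continuous and descends to a continuous map $\beta:M\to\mathbb T^b$ with $\beta\circ f=\Phi_A\circ\beta$, and the following are equivalent: - (a) $\beta$ is injective; - (b) $f$ is $\tilde M_a$-expanding: there are an equivariant metric $\tilde d$ on $\tilde M_a$ and a constant $\lambda>1$ with $\tilde d(\tilde f(\tilde x),\tilde f(\tilde y))\ge\lambda\,\tilde d(\tilde x,\tilde y)$ for all $\tilde x,\tilde y\in\tilde M_a$; - (c) for some (equivalently, for every) proper equivariant metric $\tilde d$ on $\tilde M_a$: if $\tilde x,\tilde x'\in\tilde M_a$ and there is a $K$ with $\tilde d(\tilde f^i(\tilde x),\tilde f^i(\tilde x'))<K$ for all integers $i\ge 0$, then $\tilde x=\tilde x'$. **2. Hyperbolic case.** Let $h:M\to M$ be a homeomorphism, with lift $\tilde h:\tilde M_a\to\tilde M_a$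 (a homeomorphism), and let $A$ be the matrix of $h_*$ on $H_1(M;\mathbb Z)$ in the basis $\Gamma$. Assume that $h$ is $H_1$-hyperbolic: no complex eigenvalue $\mu$ of $A$ satisfies $|\mu|=1$. Then for every $\tilde x\in\tilde M_a$ there is exactly one $\tilde\beta(\tilde x)\in\mathbb R^b$ for which $\|\tilde\iota(\tilde h^i(\tilde x))-A^i\tilde\beta(\tilde x)\|$ is bounded over $i\in\mathbb Z$, $\tilde\beta$ is continuous and descends to a continuous map $\beta:M\to\mathbb T^b$ with $\beta\circ h=\Phi_A\circ\beta$, and the following are equivalent: - (a) $\beta$ is injective; - (b) $h$ is $\tilde M_a$-hyperbolic: there are pseudo-metrics $\tilde d_1,\tilde d_2$ on $\tilde M_a$, invariant under all deck transformations, such that $\sqrt{\tilde d_1^2+\tilde d_2^2}$ is an equivariant metric, and a constant $\lambda>1$ with $\tilde d_1(\tilde h(\tilde x),\tilde h(\tilde y))\ge\lambda\,\tilde d_1(\tilde x,\tilde y)$ and $\tilde d_2(\tilde h^{-1}(\tilde x),\tilde h^{-1}(\tilde y))\ge\lambda\,\tilde d_2(\tilde x,\tilde y)$ for all $\tilde x,\tilde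 y\in\tilde M_a$; - (c) for some (equivalently, for every) proper equivariant metric $\tilde d$ on $\tilde M_a$: if $\tilde x,\tilde x'\in\tilde M_a$ and there is a $K$ with $\tilde d(\tilde h^i(\tilde x),\tilde h^i(\tilde x'))<K$ for all $i\in\mathbb Z$, then $\tilde x=\tilde x'$. -/

import Mathlib

open CategoryTheory AlgebraicTopology
open scoped Simplicial Manifold ContDiff Topology Matrix

universe u v

noncomputable section

namespace AbelianCover

/-! ### First integral homology -/

/-- The first singular homology group of `X` with integer coefficients. -/
abbrev H1 (X : Type u) [TopologicalSpace X] : ModuleCat.{u} ℤ :=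
  ((singularHomologyFunctor (ModuleCat.{u} ℤ) 1).obj (ModuleCat.of ℤ (ULift.{u} ℤ))).obj
    (TopCat.of X)

/-- The map on first homology induced by a continuous map. -/
def H1.map {X Y : Type u} [TopologicalSpace X] [TopologicalSpace Y] (f : C(X, Y)) :
    H1 X →ₗ[ℤ] H1 Y :=
  (((singularHomologyFunctor (ModuleCat.{u} ℤ) 1).obj (ModuleCat.of ℤ (ULift.{u} ℤ))).map
    (TopCat.ofHom f)).hom

/-- A path in `X`, seen as a singular `1`-simplex of `X`. -/
def singularSimplex {X : Type u} [TopologicalSpace X] {x y : X} (γ : Path x y) :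
    (TopCat.toSSet.obj (TopCat.of X)) _⦋1⦌ :=
  TopCat.toSSetObj₁Equiv.symm ((TopCat.pathEquiv (X := TopCat.of X) (x := x) (y := y)).symm γ).hom

/-- The singular `1`-chain of a closed path is a cycle. -/
theorem singularSimplex_d {X : Type u} [TopologicalSpace X] {x : X} (γ : Path x x) :
    (TopCat.toSSet.obj (TopCat.of X)).ιChainComplex
        (R := ModuleCat.of ℤ (ULift.{u} ℤ)) (singularSimplex γ) ≫
      ((TopCat.toSSet.obj (TopCat.of X)).chainComplex (ModuleCat.of ℤ (ULift.{u} ℤ))).d 1 0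
      = 0 := by
  have h := SSet.ιChainComplex_d (TopCat.toSSet.obj (TopCat.of X))
    (ModuleCat.of ℤ (ULift.{u} ℤ)) (singularSimplex γ)
  refine h.trans ?_
  rw [Fin.sum_univ_two]
  have e : (TopCat.toSSet.obj (TopCat.of X)).δ 0 (singularSimplex γ) =
      (TopCat.toSSet.obj (TopCat.of X)).δ 1 (singularSimplex γ) := by
    simp only [singularSimplex, TopCat.δ_zero_toSSetObj₁Equiv.symm,
      TopCat.δ_one_toSSetObj₁Equiv.symm]
    rw [TopCat.Path.hom₀, TopCat.Path.hom₁]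
  rw [e]
  simp

/-- The homology class of a closed path. -/
def loopClass {X : Type u} [TopologicalSpace X] {x : X} (γ : Path x x) : H1 X :=
  (((TopCat.toSSet.obj (TopCat.of X)).chainComplex (ModuleCat.of ℤ (ULift.{u} ℤ))).liftCycles
      ((TopCat.toSSet.obj (TopCat.of X)).ιChainComplex (singularSimplex γ)) 0 (by simp)
      (singularSimplex_d γ) ≫
    ((TopCat.toSSet.obj (TopCat.of X)).chainComplex
      (ModuleCat.of ℤ (ULift.{u} ℤ))).homologyπ 1).hom (ULift.up 1)

/-- The integer matrix of `f_*` on first homology in the basis `Γ`: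
`f_* (Γ j) = ∑ i, A i j • Γ i`. -/
def homologyMatrix {X : Type u} [TopologicalSpace X] {b : ℕ}
    (Γ : Module.Basis (Fin b) ℤ (H1 X)) (f : C(X, X)) : Matrix (Fin b) (Fin b) ℤ :=
  LinearMap.toMatrix Γ Γ (H1.map f)

/-- All complex eigenvalues lie outside the closed unit disc. -/
def IsExpandingMatrix {b : ℕ} (A : Matrix (Fin b) (Fin b) ℤ) : Prop :=
  ∀ μ : ℂ, Module.End.HasEigenvalue (Matrix.toLin' (A.map (fun k : ℤ => (k : ℂ)))) μ → 1 < ‖μ‖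

/-- No complex eigenvalue lies on the unit circle. -/
def IsHyperbolicMatrix {b : ℕ} (A : Matrix (Fin b) (Fin b) ℤ) : Prop :=
  ∀ μ : ℂ, Module.End.HasEigenvalue (Matrix.toLin' (A.map (fun k : ℤ => (k : ℂ)))) μ → ‖μ‖ ≠ 1

/-- The real matrix with the same entries. -/
def toRealMatrix {b : ℕ} (A : Matrix (Fin b) (Fin b) ℤ) : Matrix (Fin b) (Fin b) ℝ :=
  A.map (fun k : ℤ => (k : ℝ))

/-! ### The universal Abelian cover -/

/-- `p : N → M` is the universal Abelian cover of `M`: the connected covering space corresponding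
to the commutator subgroup of the fundamental group. -/
structure IsUniversalAbelianCover {N : Type v} {M : Type u} [TopologicalSpace N]
    [TopologicalSpace M] (p : C(N, M)) : Prop where
  connected : ConnectedSpace N
  covering : IsCoveringMap p
  surjective : Function.Surjective p
  range_map : ∀ y : N, (FundamentalGroup.map p y).range = commutator (FundamentalGroup M (p y))

/-- `d` is an equivariant metric on the total space of `p`: a metric which induces the given
topology and is invariant under all deck transformations. -/
structure IsEquivariantMetric {N : Type v} {M : Type u} [TopologicalSpace N]
    [TopologicalSpace M] (p : C(N, M)) (d : N → N → ℝ) : Prop where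
  eq_zero_iff : ∀ x y, d x y = 0 ↔ x = y
  symm : ∀ x y, d x y = d y x
  triangle : ∀ x y z, d x z ≤ d x y + d y z
  isOpen_iff : ∀ U : Set N, IsOpen U ↔ ∀ x ∈ U, ∃ ε > 0, {y | d x y < ε} ⊆ U
  equivariant : ∀ δ : N ≃ₜ N, (∀ x, p (δ x) = p x) → ∀ x y, d (δ x) (δ y) = d x y

/-- `d` is a pseudo-metric which is invariant under all deck transformations. -/
structure IsEquivariantPseudoMetric {N : Type v} {M : Type u} [TopologicalSpace N]
    [TopologicalSpace M] (p : C(N, M)) (d : N → N → ℝ) : Prop where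
  self : ∀ x, d x x = 0
  symm : ∀ x y, d x y = d y x
  triangle : ∀ x y z, d x z ≤ d x y + d y z
  equivariant : ∀ δ : N ≃ₜ N, (∀ x, p (δ x) = p x) → ∀ x y, d (δ x) (δ y) = d x y

/-- All closed balls are compact. -/
def IsProperMetric {N : Type v} [TopologicalSpace N] (d : N → N → ℝ) : Prop :=
  ∀ (x : N) (r : ℝ), IsCompact {y | d x y ≤ r}

/-- The lift `F` uniformly expands some equivariant metric on the cover. -/
def IsCoverExpanding {N : Type v} {M : Type u} [TopologicalSpace N]
    [TopologicalSpace M] (p : C(N, M)) (F : N → N) : Prop :=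
  ∃ d : N → N → ℝ, IsEquivariantMetric p d ∧
    ∃ lam : ℝ, 1 < lam ∧ ∀ x y, lam * d x y ≤ d (F x) (F y)

/-- The lift `H` is uniformly expanding for one, and `H⁻¹` for the other, of two equivariant
pseudo-metrics which together form an equivariant metric. -/
def IsCoverHyperbolic {N : Type v} {M : Type u} [TopologicalSpace N]
    [TopologicalSpace M] (p : C(N, M)) (H : N ≃ₜ N) : Prop :=
  ∃ d₁ d₂ : N → N → ℝ, IsEquivariantPseudoMetric p d₁ ∧ IsEquivariantPseudoMetric p d₂ ∧
    IsEquivariantMetric p (fun x y => Real.sqrt (d₁ x y ^ 2 + d₂ x y ^ 2)) ∧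
    ∃ lam : ℝ, 1 < lam ∧ (∀ x y, lam * d₁ x y ≤ d₁ (H x) (H y)) ∧
      ∀ x y, lam * d₂ x y ≤ d₂ (H.symm x) (H.symm y)

/-- Distinct points have `F`-orbits which do not stay a bounded `d`-distance apart. -/
def NoShadowing {N : Type v} (d : N → N → ℝ) (F : N → N) : Prop :=
  ∀ x x' : N, (∃ K : ℝ, ∀ i : ℕ, d (F^[i] x) (F^[i] x') < K) → x = x'

/-- Distinct points have two-sided `H`-orbits which do not stay a bounded `d`-distance apart. -/
def NoTwoSidedShadowing {N : Type v} [TopologicalSpace N] (d : N → N → ℝ) (H : N ≃ₜ N) : Prop :=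
  ∀ x x' : N, (∃ K : ℝ, ∀ i : ℤ, d ((H ^ i) x) ((H ^ i) x') < K) → x = x'

/-! ### Closed one-forms and the Abel-Jacobi map -/

section Forms

variable {n : ℕ} {M : Type u} [TopologicalSpace M] [ChartedSpace (EuclideanSpace ℝ (Fin n)) M]

/-- A field of covectors on `M`. -/
abbrev CovectorField (n : ℕ) (M : Type u) [TopologicalSpace M]
    [ChartedSpace (EuclideanSpace ℝ (Fin n)) M] : Type u :=
  (x : M) → TangentSpace (𝓡 n) x →L[ℝ] ℝ

/-- The pull-back of `η` under the inverse of the chart at `x`. -/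
def localForm (η : CovectorField n M) (x : M) (y : EuclideanSpace ℝ (Fin n)) :
    EuclideanSpace ℝ (Fin n) →L[ℝ] ℝ :=
  (η ((extChartAt (𝓡 n) x).symm y)).comp
    (mfderiv 𝓘(ℝ, EuclideanSpace ℝ (Fin n)) (𝓡 n) (extChartAt (𝓡 n) x).symm y)

/-- `η` is a smooth one-form with `dη = 0`; in a chart, `dη (v, w) = Dη v w - Dη w v`. -/
structure IsClosedOneForm (η : CovectorField n M) : Prop where
  smooth : ∀ x : M, ContDiffOn ℝ ∞ (localForm η x) (extChartAt (𝓡 n) x).target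
  closed : ∀ x : M, ∀ y ∈ (extChartAt (𝓡 n) x).target, ∀ v w : EuclideanSpace ℝ (Fin n),
    fderiv ℝ (localForm η x) y v w = fderiv ℝ (localForm η x) y w v

/-- The path is `C^∞` on `[0, 1]`. -/
def IsSmoothPath {x y : M} (γ : Path x y) : Prop :=
  ContMDiffOn 𝓘(ℝ, ℝ) (𝓡 n) ∞ γ.extend (Set.Icc 0 1)

/-- The integral of `η` along `γ`. -/
def lineIntegral (η : CovectorField n M) {x y : M} (γ : Path x y) : ℝ :=
  ∫ t in (0 : ℝ)..1, η (γ.extend t)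
    (mfderivWithin 𝓘(ℝ, ℝ) (𝓡 n) γ.extend (Set.Icc 0 1) t (1 : ℝ))

/-- The closed one-forms `η i` are dual to the homology basis `Γ`: the integral of `η i` over
a closed curve representing `Γ j` is the Kronecker delta. -/
structure IsDualFamily {b : ℕ} (Γ : Module.Basis (Fin b) ℤ (H1 M))
    (η : Fin b → CovectorField n M) : Prop where
  closed : ∀ i, IsClosedOneForm (η i)
  dual : ∀ (i j : Fin b) (x : M) (γ : Path x x), IsSmoothPath (n := n) γ → loopClass γ = Γ j →
    lineIntegral (η i) γ = if i = j then 1 else 0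

open Classical in
/-- The map `N → ℝ^b` obtained by integrating the lifts of the forms `η i` along a smooth path
from `x₀` to `x` (a path in the cover is smooth when its projection is). -/
def abelJacobi {N : Type v} [TopologicalSpace N] {b : ℕ} (p : C(N, M))
    (η : Fin b → CovectorField n M) (x₀ x : N) : Fin b → ℝ := fun i =>
  if h : ∃ γ : Path x₀ x, IsSmoothPath (n := n) (γ.map p.continuous) then
    lineIntegral (η i) (h.choose.map p.continuous)
  else 0

end Forms

/-! ### The torus -/

/-- The torus `ℝ^b / ℤ^b`. -/
abbrev Torus (b : ℕ) : Type := Fin b → UnitAddCircle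

/-- The endomorphism of the torus induced by an integer matrix. -/
def toralEndomorphism {b : ℕ} (A : Matrix (Fin b) (Fin b) ℤ) (y : Torus b) : Torus b :=
  fun i => ∑ j, A i j • y j

end AbelianCover

end

/-! The Abel-Jacobi map `j` is a continuous primitive, along `p`, of the closed forms. Since `H1 M`
is free on `Γ`, the forms are dual to `Γ` and the cover belongs to the commutator subgroup, `j`
separates the points of each fibre of `p`, its differences on a fibre are exactly the integer
vectors, it is equivariant up to translations, and a lift `F` of `f` satisfies `j (F y) - j (F x) =
A (j y - j x)` for `x`, `y` in one fibre. These facts (`IsPeriodMap`, `exists_periodMap`) are all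
that the dynamics needs from the forms. They rest on the Hurewicz theorem in degree one
(`exists_loopClass_eq`, `mem_commutator_of_loopClass_eq_zero`), proved with classes of arbitrary
paths in the 1-chains modulo boundaries, and on integrating forms by lifting to a covering space of
germs of primitives.

The defect `j ∘ F - A j` is constant on fibres, so it descends to a continuous `g` on the compact
`M`. A continuous solution of `A φ = φ ∘ f + g` makes `βt = j + φ ∘ p` satisfy `βt ∘ F = A βt`
exactly (`exists_semiconjugacy`). Such a `φ` is a geometrically convergent series: along forward
orbits on the unstable subspace of `A`, along backward orbits on the stable one. As `βt - j` is
bounded, `βt` is the limit of the expanding case and the unique shadowing vector of the hyperbolic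
case, and modulo integers it descends to `β`.

Injectivity of `β` is injectivity of `βt` (`IsPeriodMap.injective_torus_map_iff`). If `βt` is
injective, it is a closed embedding, and norms adapted to `A` pull back to the metrics of (b).
Conversely, if `βt x = βt y`, the orbits of `x` and `y` keep equal images, hence `j`-distance at
most `2‖φ‖`, hence bounded distance in every equivariant metric, because the deck group acts
cocompactly; (b) or (c) then forces `x = y`. Finally, orbits that stay close in a proper equivariant
metric have bounded differences `A^i (βt x - βt y)`, which forces this vector to vanish; so (a)
implies (c). -/

noncomputable section

namespace AbelianCover

/-! ### Classes of paths in the singular 1-chains modulo boundaries -/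

section Hurewicz

variable {X : Type u} [TopologicalSpace X]

/-- The coefficient module of the singular chains. -/
abbrev coeffs : ModuleCat.{u} ℤ := ModuleCat.of ℤ (ULift.{u} ℤ)

variable (X) in
/-- The singular chain complex of `X`. -/
abbrev chains : ChainComplex (ModuleCat.{u} ℤ) ℕ :=
  (TopCat.toSSet.obj (TopCat.of X)).chainComplex coeffs

/-- The basis chain of a singular simplex. -/
def basisChain {k : ℕ} (s : (TopCat.toSSet.obj (TopCat.of X)) _⦋k⦌) : (chains X).X k :=
  ((TopCat.toSSet.obj (TopCat.of X)).ιChainComplex (R := coeffs) s).hom (ULift.up 1)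

/-- The class of a path in the singular `1`-chains modulo boundaries. -/
def edgeClass {x y : X} (γ : Path x y) : (chains X).opcycles 1 :=
  ((chains X).pOpcycles 1).hom (basisChain (singularSimplex γ))

variable (X) in
/-- The inclusion of the first homology into the `1`-chains modulo boundaries. -/
def toEdgeClasses : H1 X →ₗ[ℤ] (chains X).opcycles 1 :=
  ((chains X).homologyι 1).hom

/-- With the injectivity below, this reduces identities between loop classes to identities between
edge classes, which make sense for paths that are not closed. -/
theorem toEdgeClasses_loopClass {x : X} (γ : Path x x) :
    toEdgeClasses X (loopClass γ) = edgeClass γ := by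
  have h : ((chains X).liftCycles
      ((TopCat.toSSet.obj (TopCat.of X)).ιChainComplex (R := coeffs) (singularSimplex γ)) 0
        (by simp) (singularSimplex_d γ) ≫ (chains X).homologyπ 1) ≫ (chains X).homologyι 1 =
      (TopCat.toSSet.obj (TopCat.of X)).ιChainComplex (singularSimplex γ) ≫
        (chains X).pOpcycles 1 := by
    simp
  exact congr(($h).hom (ULift.up 1))

theorem toEdgeClasses_injective : Function.Injective (toEdgeClasses X) :=
  (ModuleCat.mono_iff_injective ((chains X).homologyι 1)).1 inferInstance

/-- The parametrization of the edge opposite to the vertex `i` of the standard triangle. -/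
def triangleEdge (i : Fin 3) (t : unitInterval) : stdSimplex ℝ (Fin 3) :=
  stdSimplex.map (Fin.succAbove i) (stdSimplexHomeomorphUnitInterval.symm t)

theorem toSSetObjEquiv_singularSimplex {x y : X} (γ : Path x y) (z : stdSimplex ℝ (Fin 2)) :
    (TopCat.of X).toSSetObjEquiv _ (singularSimplex γ) z =
      γ (stdSimplexHomeomorphUnitInterval z) := by
  rfl

theorem toSSetObjEquiv_singularSimplex_symm {x y : X} (γ : Path x y) (t : unitInterval) :
    (TopCat.of X).toSSetObjEquiv _ (singularSimplex γ) (stdSimplexHomeomorphUnitInterval.symm t) =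
      γ t := by
  rw [toSSetObjEquiv_singularSimplex, Homeomorph.apply_symm_apply]

theorem eq_singularSimplex {x y : X} (γ : Path x y)
    (s : (TopCat.toSSet.obj (TopCat.of X)) _⦋1⦌)
    (h : ∀ t, (TopCat.of X).toSSetObjEquiv _ s (stdSimplexHomeomorphUnitInterval.symm t) = γ t) :
    s = singularSimplex γ := by
  apply ((TopCat.of X).toSSetObjEquiv _).injective
  ext z
  obtain ⟨t, rfl⟩ := stdSimplexHomeomorphUnitInterval.symm.surjective z
  rw [h]
  exact (toSSetObjEquiv_singularSimplex_symm γ t).symm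

theorem d_basisChain (s : (TopCat.toSSet.obj (TopCat.of X)) _⦋2⦌) :
    ((chains X).d 2 1).hom (basisChain s) =
      basisChain ((TopCat.toSSet.obj (TopCat.of X)).δ 0 s) -
      basisChain ((TopCat.toSSet.obj (TopCat.of X)).δ 1 s) +
      basisChain ((TopCat.toSSet.obj (TopCat.of X)).δ 2 s) := by
  have h := SSet.ιChainComplex_d (TopCat.toSSet.obj (TopCat.of X)) coeffs s
  have h3 := congr(($h).hom (ULift.up 1))
  rw [Fin.sum_univ_three] at h3
  simp only [Fin.val_zero, pow_zero, one_smul, Fin.val_one, pow_one, neg_smul, Fin.val_two,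
    even_two, Even.neg_pow, one_pow,
    ModuleCat.hom_add, ModuleCat.hom_neg, ModuleCat.hom_comp,
    LinearMap.add_apply, LinearMap.neg_apply, LinearMap.comp_apply] at h3
  exact h3.trans (by rw [sub_eq_add_neg]; rfl)

theorem pOpcycles_d (s : (TopCat.toSSet.obj (TopCat.of X)) _⦋2⦌) :
    ((chains X).pOpcycles 1).hom (basisChain ((TopCat.toSSet.obj (TopCat.of X)).δ 1 s)) =
    ((chains X).pOpcycles 1).hom (basisChain ((TopCat.toSSet.obj (TopCat.of X)).δ 2 s)) +
    ((chains X).pOpcycles 1).hom (basisChain ((TopCat.toSSet.obj (TopCat.of X)).δ 0 s)) := by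
  have h := congr(($((chains X).d_pOpcycles 2 1)).hom (basisChain s))
  rw [ModuleCat.hom_comp, LinearMap.comp_apply, d_basisChain, map_add, map_sub] at h
  rw [eq_comm, ← sub_eq_zero]
  refine Eq.trans ?_ h
  abel

/-- The boundary of `τ` dies modulo boundaries. Each relation between edge classes below comes from
exhibiting a suitable singular triangle. -/
theorem edgeClass_triangle {x y z : X} (τ : C(stdSimplex ℝ (Fin 3), X))
    (p₀₁ : Path x y) (p₁₂ : Path y z) (p₀₂ : Path x z)
    (h₀₁ : ∀ t, τ (triangleEdge 2 t) = p₀₁ t) (h₁₂ : ∀ t, τ (triangleEdge 0 t) = p₁₂ t)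
    (h₀₂ : ∀ t, τ (triangleEdge 1 t) = p₀₂ t) :
    edgeClass p₀₂ = edgeClass p₀₁ + edgeClass p₁₂ := by
  have h := pOpcycles_d (((TopCat.of X).toSSetObjEquiv _).symm τ)
  rw [eq_singularSimplex p₁₂ ((TopCat.toSSet.obj (TopCat.of X)).δ 0 _) fun t => ?_,
    eq_singularSimplex p₀₂ ((TopCat.toSSet.obj (TopCat.of X)).δ 1 _) fun t => ?_,
    eq_singularSimplex p₀₁ ((TopCat.toSSet.obj (TopCat.of X)).δ 2 _) fun t => ?_] at h
  · exact h
  · exact h₀₁ t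
  · exact h₀₂ t
  · exact h₁₂ t

/-- A singular `1`-simplex, as a path. -/
def simplexPath (s : (TopCat.toSSet.obj (TopCat.of X)) _⦋1⦌) :
    Path ((TopCat.of X).toSSetObjEquiv _ s (stdSimplexHomeomorphUnitInterval.symm 0) : X)
      ((TopCat.of X).toSSetObjEquiv _ s (stdSimplexHomeomorphUnitInterval.symm 1)) where
  toFun t := (TopCat.of X).toSSetObjEquiv _ s (stdSimplexHomeomorphUnitInterval.symm t)
  continuous_toFun := ((TopCat.of X).toSSetObjEquiv _ s).continuous.comp
    stdSimplexHomeomorphUnitInterval.symm.continuous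
  source' := rfl
  target' := rfl

theorem singularSimplex_simplexPath (s : (TopCat.toSSet.obj (TopCat.of X)) _⦋1⦌) :
    singularSimplex (simplexPath s) = s :=
  (eq_singularSimplex _ _ fun _ => rfl).symm

theorem triangleEdge_zero (t : unitInterval) : triangleEdge 0 t = ![0, 1 - (t : ℝ), t] := by
  funext j
  rw [triangleEdge, stdSimplex.map_coe, FunOnFinite.linearMap_apply_apply, Finset.sum_filter,
    Fin.sum_univ_two]
  fin_cases j <;> simp [Fin.succAbove, stdSimplexHomeomorphUnitInterval, stdSimplexEquivIcc] <;>
    rfl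

theorem triangleEdge_one (t : unitInterval) : triangleEdge 1 t = ![1 - (t : ℝ), 0, t] := by
  funext j
  rw [triangleEdge, stdSimplex.map_coe, FunOnFinite.linearMap_apply_apply, Finset.sum_filter,
    Fin.sum_univ_two]
  fin_cases j <;> simp [Fin.succAbove, stdSimplexHomeomorphUnitInterval, stdSimplexEquivIcc] <;>
    rfl

theorem triangleEdge_two (t : unitInterval) : triangleEdge 2 t = ![1 - (t : ℝ), t, 0] := by
  funext j
  rw [triangleEdge, stdSimplex.map_coe, FunOnFinite.linearMap_apply_apply, Finset.sum_filter,
    Fin.sum_univ_two]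
  fin_cases j <;> simp [Fin.succAbove, stdSimplexHomeomorphUnitInterval, stdSimplexEquivIcc] <;>
    rfl

end Hurewicz

/-! ### Additivity, homotopy invariance and universality of edge classes -/

section Hurewicz

variable {X : Type u} [TopologicalSpace X]

theorem continuous_stdSimplex_apply (i : Fin 3) :
    Continuous fun z : stdSimplex ℝ (Fin 3) => z i :=
  (continuous_apply i).comp continuous_subtype_val

theorem edgeClass_trans {x y z : X} (γ : Path x y) (γ' : Path y z) :
    edgeClass (γ.trans γ') = edgeClass γ + edgeClass γ' := by
  have c1 := continuous_stdSimplex_apply 1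
  have c2 := continuous_stdSimplex_apply 2
  -- The triangle is collapsed affinely onto the unit interval, its vertices going to 0, 1/2 and 1,
  -- and then mapped by the concatenation.
  refine edgeClass_triangle ⟨fun w => (γ.trans γ').extend (w 1 / 2 + w 2), ?_⟩ γ γ' _
    (fun t => ?_) (fun t => ?_) fun t => ?_
  · exact (γ.trans γ').continuous_extend.comp ((c1.div_const 2).add c2)
  · have h0 := t.2.1
    have h1 := t.2.2
    simp only [ContinuousMap.coe_mk, triangleEdge_two]
    rw [Path.extend_apply _ (by constructor <;> simp <;> linarith), Path.trans_apply,
      dif_pos (by simp; linarith)]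
    congr 1
    ext
    simp
    ring
  · have h0 := t.2.1
    have h1 := t.2.2
    simp only [ContinuousMap.coe_mk, triangleEdge_zero]
    rw [Path.extend_apply _ (by constructor <;> simp <;> linarith)]
    simp only [Matrix.cons_val_one, Matrix.cons_val_zero, Matrix.cons_val]
    rw [Path.trans_apply]
    split_ifs with h
    -- The edge from vertex 1 to vertex 2 covers the second half, so the first branch occurs only at
    -- the midpoint `t = 0`.
    · have h' : (1 - (t : ℝ)) / 2 + t ≤ 1 / 2 := h
      have : (t : ℝ) = 0 := by linarith
      have h3 : t = 0 := Subtype.ext this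
      subst h3
      rw [γ'.source]
      convert γ.target
      simp
    · congr 1
      ext
      simp
      ring
  · simp only [ContinuousMap.coe_mk, triangleEdge_one]
    simp

theorem edgeClass_refl (x : X) : edgeClass (Path.refl x) = 0 := by
  have h := edgeClass_triangle (ContinuousMap.const _ x) (Path.refl x) (Path.refl x)
    (Path.refl x) (fun _ => rfl) (fun _ => rfl) fun _ => rfl
  simpa using h

/-- The diagonal `D` cuts the square of the homotopy into two triangles. Two sides of the square are
constant paths, of class zero, so both `γ` and `γ'` have the class of `D`. -/
theorem edgeClass_eq_of_homotopic {x y : X} {γ γ' : Path x y} (h : γ.Homotopic γ') :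
    edgeClass γ = edgeClass γ' := by
  obtain ⟨F⟩ := h
  have c1 := continuous_stdSimplex_apply 1
  have c2 := continuous_stdSimplex_apply 2
  let D : Path x y :=
    { toFun t := F (t, t)
      continuous_toFun := by fun_prop
      source' := by simp
      target' := by simp }
  let r : ℝ → unitInterval := Set.projIcc 0 1 zero_le_one
  have hr : Continuous r := continuous_projIcc
  have e1 : edgeClass D = edgeClass γ + edgeClass (Path.refl y) := by
    refine edgeClass_triangle ⟨fun w => F (r (w 2), r (w 1 + w 2)),
      F.continuous.comp ((hr.comp c2).prodMk (hr.comp (c1.add c2)))⟩ _ _ _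
      (fun t => ?_) (fun t => ?_) fun t => ?_
    · simp [triangleEdge_two, r]
    · simp [triangleEdge_zero, r]
    · simp [triangleEdge_one, r, D]
  have e2 : edgeClass D = edgeClass (Path.refl x) + edgeClass γ' := by
    refine edgeClass_triangle ⟨fun w => F (r (w 1 + w 2), r (w 2)),
      F.continuous.comp ((hr.comp (c1.add c2)).prodMk (hr.comp c2))⟩ _ _ _
      (fun t => ?_) (fun t => ?_) fun t => ?_
    · simp [triangleEdge_two, r]
    · simp [triangleEdge_zero, r]
    · simp [triangleEdge_one, r, D]
  rw [edgeClass_refl, add_zero] at e1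
  rw [edgeClass_refl, zero_add] at e2
  exact e1.symm.trans e2

theorem edgeClass_symm {x y : X} (γ : Path x y) : edgeClass γ.symm = -edgeClass γ := by
  rw [eq_neg_iff_add_eq_zero, add_comm, ← edgeClass_trans,
    edgeClass_eq_of_homotopic ⟨(Path.Homotopy.reflTransSymm γ).symm⟩, edgeClass_refl]

theorem loopClass_trans {x : X} (γ γ' : Path x x) :
    loopClass (γ.trans γ') = loopClass γ + loopClass γ' := by
  apply toEdgeClasses_injective
  rw [map_add, toEdgeClasses_loopClass, toEdgeClasses_loopClass, toEdgeClasses_loopClass]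
  exact edgeClass_trans γ γ'

theorem loopClass_eq_of_edgeClass_eq {x y : X} {γ : Path x x} {γ' : Path y y}
    (h : edgeClass γ = edgeClass γ') : loopClass γ = loopClass γ' := by
  apply toEdgeClasses_injective
  rw [toEdgeClasses_loopClass, toEdgeClasses_loopClass]
  exact h

theorem simplexPath_triangle (s : (TopCat.toSSet.obj (TopCat.of X)) _⦋2⦌) (i : Fin 3) :
    ∀ t, simplexPath ((TopCat.toSSet.obj (TopCat.of X)).δ i s) t =
      (TopCat.of X).toSSetObjEquiv _ s (triangleEdge i t) := fun _ => rfl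

instance : ContractibleSpace (stdSimplex ℝ (Fin 3)) :=
  (convex_stdSimplex ℝ (Fin 3)).contractibleSpace ⟨_, (Classical.arbitrary (stdSimplex ℝ (Fin 3))).2⟩

theorem chains_hom_ext {k : ℕ} {T : ModuleCat.{u} ℤ} {f g : (chains X).X k ⟶ T}
    (h : ∀ s, f.hom (basisChain s) = g.hom (basisChain s)) : f = g := by
  refine SSet.chainComplex_hom_ext fun s => ?_
  refine ModuleCat.hom_ext (LinearMap.ext fun n => ?_)
  obtain ⟨m, rfl⟩ : ∃ m : ℤ, n = m • (ULift.up 1 : coeffs.{u}) :=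
    ⟨n.down, ULift.ext _ _ (by simp)⟩
  rw [map_zsmul, map_zsmul]
  exact congr_arg (m • ·) (h s)

theorem exists_chains_hom {k : ℕ} {T : ModuleCat.{u} ℤ}
    (g : (TopCat.toSSet.obj (TopCat.of X)) _⦋k⦌ → T) :
    ∃ φ : (chains X).X k ⟶ T, ∀ s, φ.hom (basisChain s) = g s := by
  let c : ∀ s : (TopCat.toSSet.obj (TopCat.of X)) _⦋k⦌, coeffs ⟶ T := fun s =>
    ModuleCat.ofHom ((LinearMap.toSpanSingleton ℤ T (g s)).comp ULift.moduleEquiv.toLinearMap)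
  refine ⟨Limits.Cofan.IsColimit.desc
    ((TopCat.toSSet.obj (TopCat.of X)).isColimitChainComplexXCofan coeffs k) c, fun s => ?_⟩
  have h := Limits.Cofan.IsColimit.fac
    ((TopCat.toSSet.obj (TopCat.of X)).isColimitChainComplexXCofan coeffs k) c s
  refine congr(($h).hom (ULift.up 1)).trans ?_
  simp only [c, ModuleCat.hom_ofHom]
  exact T.isModule.one_smul (g s)

/-- A homotopy invariant path functional which is additive under concatenation extends to the
`1`-chains modulo boundaries. -/
theorem exists_hom_edgeClass {A : Type u} [AddCommGroup A]
    (I : ∀ {x y : X}, Path x y → A)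
    (hI : ∀ {x y : X} {γ γ' : Path x y}, γ.Homotopic γ' → I γ = I γ')
    (hI' : ∀ {x y z : X} (γ : Path x y) (γ' : Path y z), I (γ.trans γ') = I γ + I γ') :
    ∃ φ : (chains X).opcycles 1 →ₗ[ℤ] A, ∀ {x y : X} (γ : Path x y), φ (edgeClass γ) = I γ := by
  -- The end points of the faces of a simplex agree only propositionally, so `I` is first shown to
  -- depend on the values of a path alone.
  have cast : ∀ {x y x' y' : X} (γ : Path x y) (γ' : Path x' y'), (∀ t, γ t = γ' t) →
      I γ = I γ' := by
    intro x y x' y' γ γ' h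
    have h0 : x = x' := by simpa using h 0
    have h1 : y = y' := by simpa using h 1
    subst h0 h1
    congr 1
    ext t
    exact h t
  have key : ∀ (τ : C(stdSimplex ℝ (Fin 3), X)) {x y z x' y' z' : X}
      (p₀₁ : Path x y) (p₁₂ : Path y' z) (p₀₂ : Path x' z'),
      (∀ t, τ (triangleEdge 2 t) = p₀₁ t) → (∀ t, τ (triangleEdge 0 t) = p₁₂ t) →
      (∀ t, τ (triangleEdge 1 t) = p₀₂ t) → I p₀₂ = I p₀₁ + I p₁₂ := by
    intro τ x y z x' y' z' p₀₁ p₁₂ p₀₂ h₀₁ h₁₂ h₀₂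
    let v : Fin 3 → stdSimplex ℝ (Fin 3) := fun i => stdSimplex.vertex i
    let e : ∀ i : Fin 3, C(unitInterval, stdSimplex ℝ (Fin 3)) := fun i =>
      ⟨triangleEdge i, (stdSimplex.continuous_map _).comp
        stdSimplexHomeomorphUnitInterval.symm.continuous⟩
    let e01 : Path (v 0) (v 1) := ⟨e 2, by ext j; simp [e, v, triangleEdge_two]; fin_cases j <;> simp, by ext j; simp [e, v, triangleEdge_two]; fin_cases j <;> simp⟩
    let e12 : Path (v 1) (v 2) := ⟨e 0, by ext j; simp [e, v, triangleEdge_zero]; fin_cases j <;> simp, by ext j; simp [e, v, triangleEdge_zero]; fin_cases j <;> simp⟩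
    let e02 : Path (v 0) (v 2) := ⟨e 1, by ext j; simp [e, v, triangleEdge_one]; fin_cases j <;> simp, by ext j; simp [e, v, triangleEdge_one]; fin_cases j <;> simp⟩
    -- The standard triangle is simply connected: its long edge is homotopic to the concatenation of
    -- the other two, and `I` therefore kills boundaries.
    have h := SimplyConnectedSpace.paths_homotopic e02 (e01.trans e12)
    have h2 := hI (h.map τ)
    rw [Path.map_trans, hI'] at h2
    rw [cast p₀₂ (e02.map τ.continuous) fun t => (h₀₂ t).symm,
      cast p₀₁ (e01.map τ.continuous) fun t => (h₀₁ t).symm,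
      cast p₁₂ (e12.map τ.continuous) fun t => (h₁₂ t).symm]
    exact h2
  obtain ⟨k, hk⟩ := exists_chains_hom (X := X) (k := 1) (T := ModuleCat.of ℤ A) fun s => I (simplexPath s)
  have hd : (chains X).d 2 1 ≫ k = 0 := by
    refine chains_hom_ext fun s => ?_
    rw [ModuleCat.hom_comp, LinearMap.comp_apply, d_basisChain, map_add, map_sub, hk, hk, hk,
      key ((TopCat.of X).toSSetObjEquiv _ s) (simplexPath _) (simplexPath _) (simplexPath _)
        (fun t => (simplexPath_triangle s 2 t).symm) (fun t => (simplexPath_triangle s 0 t).symm)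
        (fun t => (simplexPath_triangle s 1 t).symm)]
    simp
  refine ⟨((chains X).descOpcycles k 2 (by simp) hd).hom, fun γ => ?_⟩
  have h := congr(($((chains X).p_descOpcycles k 2 (by simp) hd)).hom
    (basisChain (singularSimplex γ)))
  refine h.trans ((hk _).trans (cast _ _ fun t => ?_))
  exact toSSetObjEquiv_singularSimplex_symm γ t

end Hurewicz

/-! ### The Hurewicz theorem in degree one -/

section Hurewicz

variable {X : Type u} [TopologicalSpace X]

/-- The class of a path, closed up by paths to a base point, in the abelianized fundamental
group. -/
def closedUp {x₀ : X} (w : ∀ x, Path x₀ x) {x y : X} (γ : Path x y) :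
    Additive (Abelianization (FundamentalGroup X x₀)) :=
  Additive.ofMul (Abelianization.of
    (FundamentalGroup.fromPath (.mk ((w x).trans (γ.trans (w y).symm)))))

theorem closedUp_trans {x₀ : X} (w : ∀ x, Path x₀ x) {x y z : X} (γ : Path x y)
    (γ' : Path y z) : closedUp w (γ.trans γ') = closedUp w γ + closedUp w γ' := by
  unfold closedUp
  -- Multiplication in the fundamental group concatenates in the opposite order; commutativity of
  -- the target allows the swap. The inner connecting path then cancels.
  rw [add_comm, ← ofMul_mul, ← map_mul]
  congr 2
  rw [FundamentalGroup.mul_def]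
  simp only [Path.Homotopic.Quotient.mk_trans, Path.Homotopic.Quotient.mk_symm]
  let a : ∀ x, (FundamentalGroupoid.mk x₀ ⟶ FundamentalGroupoid.mk x) := fun x => .mk (w x)
  let g : FundamentalGroupoid.mk x ⟶ FundamentalGroupoid.mk y := .mk γ
  let g' : FundamentalGroupoid.mk y ⟶ FundamentalGroupoid.mk z := .mk γ'
  change a x ≫ (g ≫ g') ≫ Groupoid.inv (a z) =
    (a x ≫ g ≫ Groupoid.inv (a y)) ≫ (a y ≫ g' ≫ Groupoid.inv (a z))
  simp

theorem closedUp_homotopic {x₀ : X} (w : ∀ x, Path x₀ x) {x y : X} {γ γ' : Path x y}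
    (h : γ.Homotopic γ') : closedUp w γ = closedUp w γ' := by
  unfold closedUp
  simp only [Path.Homotopic.Quotient.mk_trans, Path.Homotopic.Quotient.eq.2 h]

/-- Closing up a loop at the base point only conjugates it, which the abelianization does not see.
-/
theorem closedUp_loop {x₀ : X} (w : ∀ x, Path x₀ x) (γ : Path x₀ x₀) :
    closedUp w γ = Additive.ofMul (Abelianization.of (FundamentalGroup.fromPath (.mk γ))) := by
  unfold closedUp
  congr 1
  let a : FundamentalGroup X x₀ := FundamentalGroup.fromPath (.mk (w x₀))
  have : FundamentalGroup.fromPath (.mk ((w x₀).trans (γ.trans (w x₀).symm))) =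
      a⁻¹ * FundamentalGroup.fromPath (.mk γ) * a := by
    rw [FundamentalGroup.mul_def, FundamentalGroup.mul_def, FundamentalGroup.inv_def]
    simp only [Path.Homotopic.Quotient.mk_trans, Path.Homotopic.Quotient.mk_symm]
    rfl
  rw [this, map_mul, map_mul, map_inv, mul_comm, mul_inv_cancel_left]

/-- The kernel of the Hurewicz map is contained in the commutator subgroup. -/
theorem mem_commutator_of_loopClass_eq_zero [PathConnectedSpace X] {x : X} (γ : Path x x)
    (h : loopClass γ = 0) :
    FundamentalGroup.fromPath (.mk γ) ∈ commutator (FundamentalGroup X x) := by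
  let w : ∀ y, Path x y := PathConnectedSpace.somePath x
  -- The class in the abelianization factors through the edge class, so it vanishes with the
  -- homology class.
  obtain ⟨φ, hφ⟩ := exists_hom_edgeClass (X := X) (fun γ => closedUp w γ)
    (fun h => closedUp_homotopic w h) (fun γ γ' => closedUp_trans w γ γ')
  have h1 := hφ γ
  rw [closedUp_loop, ← toEdgeClasses_loopClass, h, map_zero, map_zero] at h1
  exact (QuotientGroup.eq_one_iff _).1 h1.symm

variable (X) in
theorem loopClass_refl (x : X) : loopClass (Path.refl x) = 0 := by
  apply toEdgeClasses_injective
  rw [toEdgeClasses_loopClass, edgeClass_refl, map_zero]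

theorem loopClass_symm {x : X} (γ : Path x x) : loopClass γ.symm = -loopClass γ := by
  apply toEdgeClasses_injective
  rw [map_neg, toEdgeClasses_loopClass, toEdgeClasses_loopClass, edgeClass_symm]

/-- The classes of the closed paths at a base point form a subgroup of the first homology. -/
def loopClasses (x : X) : AddSubgroup (H1 X) where
  carrier := Set.range fun γ : Path x x => loopClass γ
  zero_mem' := ⟨Path.refl x, loopClass_refl X x⟩
  add_mem' := by
    rintro _ _ ⟨γ, rfl⟩ ⟨γ', rfl⟩
    exact ⟨γ.trans γ', loopClass_trans γ γ'⟩
  neg_mem' := by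
    rintro _ ⟨γ, rfl⟩
    exact ⟨γ.symm, loopClass_symm γ⟩

/-- The submodule of the classes of the closed paths at a base point. -/
def loopClassSubmodule (x : X) : Submodule ℤ (H1 X) where
  toAddSubmonoid := (loopClasses x).toAddSubmonoid
  smul_mem' c z hz := (congrArg (· ∈ loopClasses x)
    (int_smul_eq_zsmul (H1 X).isModule c z)).mpr (zsmul_mem (show z ∈ loopClasses x from hz) c)

theorem d_basisChain_one (s : (TopCat.toSSet.obj (TopCat.of X)) _⦋1⦌) :
    ((chains X).d 1 0).hom (basisChain s) =
      basisChain ((TopCat.toSSet.obj (TopCat.of X)).δ 0 s) -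
      basisChain ((TopCat.toSSet.obj (TopCat.of X)).δ 1 s) := by
  have h := SSet.ιChainComplex_d (TopCat.toSSet.obj (TopCat.of X)) coeffs s
  have h3 := congr(($h).hom (ULift.up 1))
  rw [Fin.sum_univ_two] at h3
  simp only [Fin.val_zero, pow_zero, one_smul, Fin.val_one, pow_one, neg_smul,
    ModuleCat.hom_add, ModuleCat.hom_neg, ModuleCat.hom_comp,
    LinearMap.add_apply, LinearMap.neg_apply, LinearMap.comp_apply] at h3
  exact h3.trans (by rw [sub_eq_add_neg]; rfl)

theorem chains_linearMap_ext {k : ℕ} {V : Type u} [AddCommGroup V] [Module ℤ V]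
    {f g : (chains X).X k →ₗ[ℤ] V} (h : ∀ s, f (basisChain s) = g (basisChain s)) : f = g :=
  congr(($(chains_hom_ext (f := ModuleCat.ofHom (Y := V) f) (g := ModuleCat.ofHom (Y := V) g) h)).hom)

theorem exists_chains_linearMap {k : ℕ} {V : Type u} [AddCommGroup V] [Module ℤ V]
    (g : (TopCat.toSSet.obj (TopCat.of X)) _⦋k⦌ → V) :
    ∃ φ : (chains X).X k →ₗ[ℤ] V, ∀ s, φ (basisChain s) = g s := by
  obtain ⟨φ, hφ⟩ := exists_chains_hom (X := X) (T := ModuleCat.of ℤ V) g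
  exact ⟨φ.hom, hφ⟩

/-- Every first homology class is the class of a closed path at the given base point. -/
theorem exists_loopClass_eq [PathConnectedSpace X] (x : X) (z : H1 X) :
    ∃ γ : Path x x, loopClass γ = z := by
  let w : ∀ y, Path x y := PathConnectedSpace.somePath x
  -- `Φ` closes each simplex up to a loop at `x` by the connecting paths; `Θ` sends a point to the
  -- class of its connecting path. The two connecting paths of a simplex contribute `-Θ ∘ d`, hence
  -- nothing on cycles.
  obtain ⟨Φ, hΦ⟩ := exists_chains_linearMap (X := X) (k := 1) (V := H1 X) fun s =>
    loopClass ((w _).trans ((simplexPath s).trans (w _).symm))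
  obtain ⟨Θ, hΘ⟩ := exists_chains_linearMap (X := X) (k := 0) (V := (chains X).opcycles 1)
    fun s => edgeClass (w (TopCat.toSSetObj₀Equiv s))
  have h1 : (toEdgeClasses X).comp Φ =
      ((chains X).pOpcycles 1).hom - Θ.comp ((chains X).d 1 0).hom := by
    refine chains_linearMap_ext fun s => ?_
    rw [LinearMap.comp_apply, hΦ, LinearMap.sub_apply, LinearMap.comp_apply, d_basisChain_one,
      map_sub, hΘ, hΘ, toEdgeClasses_loopClass, edgeClass_trans, edgeClass_trans, edgeClass_symm]
    have e : edgeClass (simplexPath s) = ((chains X).pOpcycles 1).hom (basisChain s) := by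
      rw [edgeClass, singularSimplex_simplexPath]
    rw [e]
    have e0 : TopCat.toSSetObj₀Equiv ((TopCat.toSSet.obj (TopCat.of X)).δ 1 s) =
      ((TopCat.of X).toSSetObjEquiv _ s (stdSimplexHomeomorphUnitInterval.symm 0) : X) :=
      (TopCat.toSSetObj₁Equiv_apply_zero s).symm
    have e1 : TopCat.toSSetObj₀Equiv ((TopCat.toSSet.obj (TopCat.of X)).δ 0 s) =
      ((TopCat.of X).toSSetObjEquiv _ s (stdSimplexHomeomorphUnitInterval.symm 1) : X) :=
      (TopCat.toSSetObj₁Equiv_apply_one s).symm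
    rw [e0, e1]
    abel
  obtain ⟨c, rfl⟩ : ∃ c, ((chains X).homologyπ 1).hom c = z :=
    (ModuleCat.epi_iff_surjective ((chains X).homologyπ 1)).1 inferInstance z
  have h2 : Φ (((chains X).iCycles 1).hom c) = ((chains X).homologyπ 1).hom c := by
    apply toEdgeClasses_injective
    have h3 := congr($h1 (((chains X).iCycles 1).hom c))
    have h4 := congr(($((chains X).homology_π_ι 1)).hom c)
    have h5 := congr(($((chains X).iCycles_d 1 0)).hom c)
    rw [ModuleCat.hom_comp, LinearMap.comp_apply] at h4 h5
    rw [LinearMap.sub_apply, LinearMap.comp_apply, LinearMap.comp_apply, h5] at h3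
    refine h3.trans ?_
    simp only [ModuleCat.hom_zero, LinearMap.zero_apply, map_zero, sub_zero]
    exact h4.symm
  rw [← h2]
  -- Loop classes form a submodule, so the values of `Φ` are loop classes on all chains as soon as
  -- they are on simplices.
  have h6 : (loopClassSubmodule x).mkQ.comp Φ = 0 := by
    refine @chains_linearMap_ext X _ 1 _ _ (Submodule.Quotient.module (loopClassSubmodule x)) _ _
      fun s => ?_
    rw [LinearMap.comp_apply, hΦ]
    exact (Submodule.Quotient.mk_eq_zero (loopClassSubmodule x)).2 ⟨_, rfl⟩
  exact (Submodule.Quotient.mk_eq_zero (loopClassSubmodule x)).1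
    congr($h6 (((chains X).iCycles 1).hom c))

theorem toEdgeClasses_map {Y : Type u} [TopologicalSpace Y] (f : C(X, Y)) (z : H1 X) :
    toEdgeClasses Y (H1.map f z) = (HomologicalComplex.opcyclesMap
      (SSet.chainComplexMap (TopCat.toSSet.map (TopCat.ofHom f)) coeffs) 1).hom
        (toEdgeClasses X z) :=
  congr(($(HomologicalComplex.homologyι_naturality
    (SSet.chainComplexMap (TopCat.toSSet.map (TopCat.ofHom f)) coeffs) 1)).hom z)

theorem map_loopClass {Y : Type u} [TopologicalSpace Y] (f : C(X, Y)) {x : X} (γ : Path x x) :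
    H1.map f (loopClass γ) = loopClass (γ.map f.continuous) := by
  apply toEdgeClasses_injective
  rw [toEdgeClasses_map, toEdgeClasses_loopClass, toEdgeClasses_loopClass]
  have h := congr(($(HomologicalComplex.p_opcyclesMap
    (SSet.chainComplexMap (TopCat.toSSet.map (TopCat.ofHom f)) coeffs) 1)).hom
      (basisChain (singularSimplex γ)))
  refine h.trans ?_
  have h2 := congr(($(SSet.ι_chainComplexMap_f (f := TopCat.toSSet.map (TopCat.ofHom f))
    (R := coeffs) (x := singularSimplex γ))).hom (ULift.up 1))
  exact congr(((chains Y).pOpcycles 1).hom $h2)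

end Hurewicz

/-! ### Integration along paths by lifting to the space of germs of primitives -/

section LocalPrimitives

/-- A copy of `V` with the discrete topology. -/
def DiscreteCopy (V : Type*) : Type _ := V

/-- An element of `V`, seen in the discrete copy. -/
def DiscreteCopy.of {V : Type*} (v : V) : DiscreteCopy V := v

/-- An element of the discrete copy, seen in `V`. -/
def DiscreteCopy.get {V : Type*} (v : DiscreteCopy V) : V := v

instance {V : Type*} : TopologicalSpace (DiscreteCopy V) := ⊥

instance {V : Type*} : DiscreteTopology (DiscreteCopy V) := ⟨rfl⟩

/-- A family of continuous functions on open sets which cover `M`, any two of which differ by a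
locally constant function. -/
structure LocalPrimitives (ι M V : Type*) [TopologicalSpace M] [TopologicalSpace V]
    [AddCommGroup V] where
  /-- the domains -/
  dom : ι → Set M
  isOpen_dom : ∀ i, IsOpen (dom i)
  /-- the index of a domain containing a given point -/
  index : M → ι
  mem_dom : ∀ x, x ∈ dom (index x)
  /-- the functions -/
  fn : ι → M → V
  continuousOn_fn : ∀ i, ContinuousOn (fn i) (dom i)
  locConst : ∀ i k x, x ∈ dom i → x ∈ dom k → ∀ᶠ y in 𝓝 x, fn i y - fn k y = fn i x - fn k x

namespace LocalPrimitives

variable {ι M V : Type*} [TopologicalSpace M] [TopologicalSpace V] [AddCommGroup V]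
  (S : LocalPrimitives ι M V)

/-- The fibre bundle core with discrete fibre whose sections are the primitives. -/
def core : FiberBundleCore ι M (DiscreteCopy V) where
  baseSet := S.dom
  isOpen_baseSet := S.isOpen_dom
  indexAt := S.index
  mem_baseSet_at := S.mem_dom
  coordChange i k x v := DiscreteCopy.of (v.get + (S.fn i x - S.fn k x))
  coordChange_self i x _ v := by
    rw [sub_self]
    exact add_zero v.get
  continuousOn_coordChange i k := by
    rintro ⟨x, v⟩ ⟨⟨hi, hk⟩, -⟩
    refine ContinuousAt.continuousWithinAt ?_
    refine (continuousAt_const (y := DiscreteCopy.of (v.get + (S.fn i x - S.fn k x)))).congr ?_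
    have h1 : ∀ᶠ q : M × DiscreteCopy V in 𝓝 (x, v), S.fn i q.1 - S.fn k q.1 =
      S.fn i x - S.fn k x := continuousAt_fst.eventually
      (p := fun y => S.fn i y - S.fn k y = S.fn i x - S.fn k x) (S.locConst i k x hi hk)
    have h2 : ∀ᶠ q : M × DiscreteCopy V in 𝓝 (x, v), q.2 = v :=
      continuousAt_snd.eventually (p := fun w => w = v) (by simp [nhds_discrete])
    filter_upwards [h1, h2] with q h1 h2
    rw [h1, h2]
  coordChange_comp i k l x _ v := by
    change v.get + (S.fn i x - S.fn k x) + (S.fn k x - S.fn l x) = v.get + (S.fn i x - S.fn l x)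
    rw [add_assoc, sub_add_sub_cancel]

/-- The covering space of germs of primitives. -/
abbrev Germs : Type _ := S.core.TotalSpace

theorem isCoveringMap_proj : IsCoveringMap S.core.proj :=
  FiberBundle.isCoveringMap

/-- The value of a germ of a primitive. -/
def val (e : S.Germs) : V := DiscreteCopy.get e.2 + S.fn (S.index e.1) e.1

theorem exists_val_eq (x : M) (v : V) : ∃ e : S.Germs, S.core.proj e = x ∧ S.val e = v :=
  ⟨⟨x, DiscreteCopy.of (v - S.fn (S.index x) x)⟩, rfl, sub_add_cancel v (S.fn (S.index x) x)⟩

theorem ext_val {e e' : S.Germs} (h : S.core.proj e = S.core.proj e') (hv : S.val e = S.val e') :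
    e = e' := by
  obtain ⟨x, v⟩ := e
  obtain ⟨x', v'⟩ := e'
  obtain rfl : x = x' := h
  have : DiscreteCopy.get v = DiscreteCopy.get v' := add_right_cancel (b := S.fn (S.index x) x) hv
  change v = v' at this
  rw [this]

/-- A function which differs from each local primitive along `f` by a locally constant function. -/
def IsPrimitiveAlong {A : Type*} [TopologicalSpace A] (f : A → M) (g : A → V) : Prop :=
  ∀ a i, f a ∈ S.dom i → ∀ᶠ c in 𝓝 a, g c - S.fn i (f c) = g a - S.fn i (f a)

theorem isPrimitiveAlong_val : S.IsPrimitiveAlong S.core.proj S.val := by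
  intro e i he
  have hc : ContinuousAt (S.core.localTriv i) e :=
    (S.core.localTriv i).continuousAt ((S.core.mem_localTriv_source i e).2 he)
  have h1 : ∀ᶠ c in 𝓝 e, (S.core.localTriv i c).2 = (S.core.localTriv i e).2 :=
    (continuousAt_snd.comp hc).eventually (p := fun w => w = (S.core.localTriv i e).2)
      (by rw [nhds_discrete]; exact rfl)
  filter_upwards [h1] with c hc
  have h2 : ∀ c : S.Germs, (S.core.localTriv i c).2 =
      DiscreteCopy.of (S.val c - S.fn i (S.core.proj c)) := by
    intro c
    exact (add_sub_assoc (DiscreteCopy.get c.2) (S.fn (S.index c.1) c.1) (S.fn i c.1)).symm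
  rw [h2, h2] at hc
  exact hc

variable {S} in
theorem IsPrimitiveAlong.comp {A B : Type*} [TopologicalSpace A] [TopologicalSpace B]
    {f : A → M} {g : A → V} (h : S.IsPrimitiveAlong f g) {k : B → A} (hk : Continuous k) :
    S.IsPrimitiveAlong (f ∘ k) (g ∘ k) :=
  fun a i ha => hk.continuousAt.eventually (h (k a) i ha)

variable {S} in
theorem IsPrimitiveAlong.continuous [IsTopologicalAddGroup V] {A : Type*} [TopologicalSpace A]
    {f : A → M} {g : A → V} (h : S.IsPrimitiveAlong f g) (hf : Continuous f) : Continuous g := by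
  rw [continuous_iff_continuousAt]
  intro a
  have ha := S.mem_dom (f a)
  have h1 : ContinuousAt (fun c => S.fn (S.index (f a)) (f c)) a :=
    ContinuousAt.comp (f := f) ((S.continuousOn_fn _).continuousAt
      ((S.isOpen_dom _).mem_nhds ha)) hf.continuousAt
  refine ((continuousAt_const (y := g a - S.fn (S.index (f a)) (f a))).add h1).congr ?_
  filter_upwards [h a _ ha] with c hc
  rw [← hc]
  simp

-- The difference of two primitives along one map is locally constant. Every independence of choices
-- of the integral goes back to this.
variable {S} in
theorem IsPrimitiveAlong.sub_eq_sub {A : Type*} [TopologicalSpace A] [PreconnectedSpace A]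
    {f : A → M} {g g' : A → V} (h : S.IsPrimitiveAlong f g) (h' : S.IsPrimitiveAlong f g')
    (a c : A) : g' a - g a = g' c - g c := by
  have hl : IsLocallyConstant fun a => g' a - g a := by
    rw [IsLocallyConstant.iff_eventually_eq]
    intro a
    filter_upwards [h a _ (S.mem_dom (f a)), h' a _ (S.mem_dom (f a))] with c h1 h2
    have := congr_arg₂ (· - ·) h2 h1
    simpa using this
  exact hl.apply_eq_of_preconnectedSpace a c

/-- The germ of the primitive vanishing at `x`. -/
def zeroGerm (x : M) : S.core.proj ⁻¹' {x} :=
  ⟨(S.exists_val_eq x 0).choose, (S.exists_val_eq x 0).choose_spec.1⟩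

/-- The integral along a homotopy class of paths. -/
def integral {x y : M} (γ : Path.Homotopic.Quotient x y) : V :=
  S.val (S.isCoveringMap_proj.monodromy γ (S.zeroGerm x)) - S.val (S.zeroGerm x)

/-- The lift of `γ` to the germs provides one primitive along `γ`; any other one has the same
increment. -/
theorem integral_eq {x y : M} (γ : Path x y) {g : unitInterval → V}
    (hg : S.IsPrimitiveAlong γ g) : S.integral (.mk γ) = g 1 - g 0 := by
  have h0 : γ 0 = S.core.proj (S.zeroGerm x) := γ.source.trans (S.zeroGerm x).2.symm
  have h1 := S.isPrimitiveAlong_val.comp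
    (S.isCoveringMap_proj.liftPath γ (S.zeroGerm x) h0).continuous
  rw [S.isCoveringMap_proj.liftPath_lifts] at h1
  have h2 := hg.sub_eq_sub h1 0 1
  simp only [Function.comp_apply, S.isCoveringMap_proj.liftPath_zero] at h2
  rw [sub_eq_sub_iff_sub_eq_sub] at h2
  have h3 := congr_arg Neg.neg h2
  rw [neg_sub, neg_sub] at h3
  exact h3

theorem integral_eq_of_germ {x y : M} (γ : Path.Homotopic.Quotient x y) (e : S.core.proj ⁻¹' {x}) :
    S.val (S.isCoveringMap_proj.monodromy γ e) = S.val e + S.integral γ := by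
  obtain ⟨γ⟩ := γ
  have h0 : γ 0 = S.core.proj e := γ.source.trans e.2.symm
  have h1 := S.isPrimitiveAlong_val.comp
    (S.isCoveringMap_proj.liftPath γ e h0).continuous
  rw [S.isCoveringMap_proj.liftPath_lifts] at h1
  have h2 := S.integral_eq γ h1
  simp only [Function.comp_apply, S.isCoveringMap_proj.liftPath_zero] at h2
  rw [← sub_eq_iff_eq_add']
  exact h2.symm

theorem integral_trans {x y z : M} (γ : Path.Homotopic.Quotient x y)
    (γ' : Path.Homotopic.Quotient y z) :
    S.integral (γ.trans γ') = S.integral γ + S.integral γ' := by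
  have h := S.integral_eq_of_germ (γ.trans γ') (S.zeroGerm x)
  rw [IsCoveringMap.monodromy_trans_apply, integral_eq_of_germ, integral_eq_of_germ, add_assoc] at h
  exact (add_left_cancel h).symm

/-- The integral, as a homomorphism on the fundamental group. -/
def integralHom (x : M) : FundamentalGroup M x →* Multiplicative V where
  toFun γ := Multiplicative.ofAdd (S.integral γ)
  map_one' := by
    have h := S.integral_trans (Path.Homotopic.Quotient.refl x) (Path.Homotopic.Quotient.refl x)
    have h2 : (Path.Homotopic.Quotient.refl x).trans (Path.Homotopic.Quotient.refl x) =
      Path.Homotopic.Quotient.refl x := mul_one (1 : FundamentalGroup M x)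
    rw [h2, left_eq_add] at h
    exact congr_arg Multiplicative.ofAdd h
  map_mul' γ γ' := by
    rw [← ofAdd_add, add_comm, ← integral_trans]
    rfl

/-- The integral is a homomorphism to an abelian group. -/
theorem integral_eq_zero_of_mem_commutator {x : M} {γ : FundamentalGroup M x}
    (h : γ ∈ commutator (FundamentalGroup M x)) : S.integral γ = 0 :=
  Multiplicative.ofAdd.injective
    (MonoidHom.mem_ker.1 (Abelianization.commutator_subset_ker (S.integralHom x) h))

/-- Loops of `N` project into the commutator subgroup, where integrals vanish; their monodromy thus
fixes every germ over the base point. By the lifting criterion `p` lifts to the germs, and the value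
of the lifted germ is the primitive. -/
theorem exists_primitiveAlong {N : Type*} [TopologicalSpace N] [PathConnectedSpace N]
    [LocallyPathConnectedSpace N] (p : C(N, M)) (x₀ : N)
    (hp : (FundamentalGroup.map p x₀).range ≤ commutator (FundamentalGroup M (p x₀))) :
    ∃ g : N → V, g x₀ = 0 ∧ S.IsPrimitiveAlong p g := by
  obtain ⟨e, he, hv⟩ := S.exists_val_eq (p x₀) 0
  obtain ⟨F, ⟨hF0, hF⟩, -⟩ := S.isCoveringMap_proj.existsUnique_continuousMap_lifts_of_range_le
    (f := p) (a₀ := x₀) (e₀ := e) he (by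
      refine hp.trans fun γ hγ => ?_
      have h1 := S.integral_eq_of_germ γ ⟨e, he⟩
      rw [S.integral_eq_zero_of_mem_commutator hγ, add_zero] at h1
      have h2 : S.isCoveringMap_proj.monodromy γ ⟨e, he⟩ = ⟨e, he⟩ :=
        Subtype.ext (S.ext_val ((S.isCoveringMap_proj.monodromy γ ⟨e, he⟩).2.trans he.symm) h1)
      -- The end point of the lifted path is kept as a variable, so that its equality with the
      -- starting point can be substituted, turning the path into a loop that projects to `γ`.
      have key : ∀ (e' : S.core.proj ⁻¹' {p x₀}) (Γ : Path.Homotopic.Quotient e e'.1),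
          Γ.map ⟨S.core.proj, S.isCoveringMap_proj.continuous⟩ = Path.Homotopic.Quotient.cast γ he e'.2 →
          e' = ⟨e, he⟩ → γ ∈ (FundamentalGroup.mapOfEq
            ⟨S.core.proj, S.isCoveringMap_proj.continuous⟩ he).range := by
        rintro _ Γ hΓ rfl
        refine ⟨FundamentalGroup.fromPath Γ, ?_⟩
        rw [FundamentalGroup.mapOfEq_apply]
        refine (congrArg (fun c => Path.Homotopic.Quotient.cast c he.symm he.symm) hΓ).trans ?_
        exact (Path.Homotopic.Quotient.cast_cast _ _ _ _ _).trans
          (Path.Homotopic.Quotient.cast_rfl_rfl _)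
      exact key _ _ (S.isCoveringMap_proj.map_liftPathQuotient γ ⟨e, he⟩) h2)
  refine ⟨S.val ∘ F, by simp [hF0, hv], ?_⟩
  have := S.isPrimitiveAlong_val.comp F.continuous
  rwa [hF] at this

end LocalPrimitives

end LocalPrimitives

/-! ### Local primitives of closed one-forms and line integrals -/

section Forms

variable {n : ℕ} {M : Type u} [TopologicalSpace M] [ChartedSpace (EuclideanSpace ℝ (Fin n)) M]

/-- `Q` is a `C^1` primitive of `η` on `U`. -/
structure IsPrimitiveOn (η : CovectorField n M) (Q : M → ℝ) (U : Set M) : Prop where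
  contMDiffOn : ContMDiffOn (𝓡 n) 𝓘(ℝ, ℝ) 1 Q U
  hasMFDerivAt : ∀ y ∈ U, HasMFDerivAt (𝓡 n) 𝓘(ℝ, ℝ) Q y (η y)

theorem localForm_comp_mfderiv [IsManifold (𝓡 n) ∞ M] (η : CovectorField n M) (x : M) {y : M}
    (hy : y ∈ (extChartAt (𝓡 n) x).source) :
    (localForm η x (extChartAt (𝓡 n) x y)).comp
      (mfderiv (𝓡 n) 𝓘(ℝ, EuclideanSpace ℝ (Fin n)) (extChartAt (𝓡 n) x) y) = η y := by
  have : IsManifold (𝓡 n) 1 M := IsManifold.of_le (n := ∞) (by norm_num)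
  have h := mfderivWithin_extChartAt_symm_comp_mfderiv_extChartAt' (I := 𝓡 n) hy
  rw [ModelWithCorners.range_eq_univ, mfderivWithin_univ] at h
  -- `η` is evaluated at the image of `y` under the chart and back, which equals `y` only
  -- propositionally; all tangent spaces are the same model space.
  have h2 : ∀ y', y' = y → ∀ v : EuclideanSpace ℝ (Fin n), η y' v = η y v := by
    rintro _ rfl v
    rfl
  ext v
  refine Eq.trans ?_ (h2 _ ((extChartAt (𝓡 n) x).left_inv hy) v)
  exact congr_arg (η ((extChartAt (𝓡 n) x).symm (extChartAt (𝓡 n) x y))) congr($h v)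

/-- This is the Poincaré lemma on a ball inside a chart, composed with the chart. -/
theorem IsClosedOneForm.exists_isPrimitiveOn [IsManifold (𝓡 n) ∞ M] {η : CovectorField n M}
    (hη : IsClosedOneForm η) (x : M) :
    ∃ (U : Set M) (Q : M → ℝ), IsOpen U ∧ x ∈ U ∧ IsPrimitiveOn η Q U := by
  have : IsManifold (𝓡 n) 1 M := IsManifold.of_le (n := ∞) (by norm_num)
  let e := extChartAt (𝓡 n) x
  have ht : IsOpen e.target := isOpen_extChartAt_target x
  obtain ⟨r, hr, hB⟩ := Metric.isOpen_iff.1 ht (e x) (mem_extChartAt_target x)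
  obtain ⟨P, hP⟩ := (convex_ball (e x) r).exists_forall_hasFDerivAt_of_fderiv_symmetric
    Metric.isOpen_ball (((hη.smooth x).differentiableOn (by simp)).mono hB)
    fun a ha v w => hη.closed x a (hB ha) v w
  have hU : IsOpen (e.source ∩ e ⁻¹' Metric.ball (e x) r) :=
    isOpen_extChartAt_preimage' x Metric.isOpen_ball
  have hP1 : ContDiffOn ℝ 1 P (Metric.ball (e x) r) := by
    rw [show (1 : WithTop ℕ∞) = 0 + 1 from rfl,
      contDiffOn_succ_iff_hasFDerivWithinAt_of_uniqueDiffOn Metric.isOpen_ball.uniqueDiffOn]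
    exact ⟨by simp, localForm η x, ((hη.smooth x).mono hB).of_le (by simp),
      fun z hz => (hP z hz).hasFDerivWithinAt⟩
  refine ⟨e.source ∩ e ⁻¹' Metric.ball (e x) r, P ∘ e, hU,
    ⟨mem_extChartAt_source x, Metric.mem_ball_self hr⟩, ?_, fun y hy => ?_⟩
  · exact hP1.contMDiffOn.comp ((contMDiffOn_extChartAt (n := 1)).mono fun y hy => by
      simpa [e] using hy.1) fun y hy => hy.2
  · have h1 : HasMFDerivAt (𝓡 n) 𝓘(ℝ, EuclideanSpace ℝ (Fin n)) e y
        (mfderiv (𝓡 n) 𝓘(ℝ, EuclideanSpace ℝ (Fin n)) e y) :=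
      (mdifferentiableAt_extChartAt (by simpa [e] using hy.1)).hasMFDerivAt
    have h2 := (hP (e y) hy.2).hasMFDerivAt.comp y h1
    have h3 := localForm_comp_mfderiv η x hy.1
    exact h2.congr_mfderiv h3

theorem eventually_const_of_hasMFDerivAt_zero [IsManifold (𝓡 n) ∞ M] {D : M → ℝ} {W : Set M}
    (hW : IsOpen W) (hD : ∀ y ∈ W, HasMFDerivAt (𝓡 n) 𝓘(ℝ, ℝ) D y 0) {x : M} (hx : x ∈ W) :
    ∀ᶠ y in 𝓝 x, D y = D x := by
  have : IsManifold (𝓡 n) 1 M := IsManifold.of_le (n := ∞) (by norm_num)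
  let e := extChartAt (𝓡 n) x
  have ht : IsOpen e.target := isOpen_extChartAt_target x
  have ho : IsOpen (e.target ∩ e.symm ⁻¹' W) :=
    (continuousOn_extChartAt_symm x).isOpen_inter_preimage ht hW
  obtain ⟨r, hr, hB⟩ := Metric.isOpen_iff.1 ho (e x) ⟨mem_extChartAt_target x, by simpa [e] using hx⟩
  have hd : ∀ z ∈ Metric.ball (e x) r, HasFDerivAt (𝕜 := ℝ) (D ∘ e.symm)
      (0 : EuclideanSpace ℝ (Fin n) →L[ℝ] ℝ) z := by
    intro z hz
    have hz' := hB hz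
    have h1 := (mdifferentiableWithinAt_extChartAt_symm (I := 𝓡 n) hz'.1)
    rw [ModelWithCorners.range_eq_univ, mdifferentiableWithinAt_univ] at h1
    have h2 := HasMFDerivAt.comp (I' := 𝓡 n) (g := D) (I'' := 𝓘(ℝ, ℝ)) z (hD _ hz'.2)
      h1.hasMFDerivAt
    rw [ContinuousLinearMap.zero_comp] at h2
    exact h2.hasFDerivAt
  have hc : ∀ z ∈ Metric.ball (e x) r, D (e.symm z) = D x := by
    intro z hz
    have := Metric.isOpen_ball.is_const_of_fderiv_eq_zero (𝕜 := ℝ)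
      (convex_ball (e x) r).isPreconnected
      (fun z hz => (hd z hz).differentiableAt.differentiableWithinAt)
      (fun z hz => (hd z hz).fderiv) hz (Metric.mem_ball_self hr)
    simpa [e] using this
  filter_upwards [(isOpen_extChartAt_preimage' x Metric.isOpen_ball).mem_nhds
    ⟨mem_extChartAt_source (I := 𝓡 n) x, Metric.mem_ball_self hr⟩] with y hy
  have := hc _ hy.2
  rwa [e.left_inv hy.1] at this

theorem IsPrimitiveOn.eventually_sub_eq [IsManifold (𝓡 n) ∞ M] {η : CovectorField n M}
    {Q Q' : M → ℝ} {U U' : Set M} (h : IsPrimitiveOn η Q U) (h' : IsPrimitiveOn η Q' U')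
    (hU : IsOpen U) (hU' : IsOpen U') {x : M} (hx : x ∈ U) (hx' : x ∈ U') :
    ∀ᶠ y in 𝓝 x, Q y - Q' y = Q x - Q' x := by
  refine eventually_const_of_hasMFDerivAt_zero (n := n) (D := Q - Q') (hU.inter hU') (fun y hy => ?_)
    ⟨hx, hx'⟩
  have := (h.hasMFDerivAt y hy.1).sub (h'.hasMFDerivAt y hy.2)
  exact this.congr_mfderiv (sub_self _)

/-- The local primitives of a family of closed one-forms. -/
theorem exists_localPrimitives [IsManifold (𝓡 n) ∞ M] {b : ℕ} {η : Fin b → CovectorField n M}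
    (hη : ∀ i, IsClosedOneForm (η i)) :
    ∃ S : LocalPrimitives M M (Fin b → ℝ),
      ∀ x i, IsPrimitiveOn (η i) (fun y => S.fn x y i) (S.dom x) := by
  choose U Q hU hx hQ using fun x i => (hη i).exists_isPrimitiveOn x
  have hP : ∀ x i, IsPrimitiveOn (η i) (Q x i) (⋂ k, U x k) := fun x i =>
    ⟨(hQ x i).contMDiffOn.mono (Set.iInter_subset _ i),
      fun y hy => (hQ x i).hasMFDerivAt y (Set.iInter_subset _ i hy)⟩
  have ho : ∀ x, IsOpen (⋂ k, U x k) := fun x => isOpen_iInter_of_finite (hU x)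
  refine ⟨⟨fun x => ⋂ k, U x k, ho, id, fun x => Set.mem_iInter.2 (hx x),
    fun x y i => Q x i y, fun x => continuousOn_pi.2 fun i => (hP x i).contMDiffOn.continuousOn,
    fun x z y hy hz => ?_⟩, hP⟩
  filter_upwards [Filter.eventually_all.2 fun i =>
    (hP x i).eventually_sub_eq (hP z i) (ho x) (ho z) hy hz] with w hw
  ext i
  exact hw i

/-- Near each parameter, `g` is a local primitive composed with `γ` plus a constant. It is therefore
`C^1` with the integrand as derivative, and the fundamental theorem of calculus applies. -/
theorem lineIntegral_eq_sub {b : ℕ} {η : Fin b → CovectorField n M}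
    {S : LocalPrimitives M M (Fin b → ℝ)}
    (hS : ∀ x i, IsPrimitiveOn (η i) (fun y => S.fn x y i) (S.dom x)) {x y : M} (γ : Path x y)
    (hγ : IsSmoothPath (n := n) γ) {g : unitInterval → Fin b → ℝ} (hg : S.IsPrimitiveAlong γ g)
    (i : Fin b) : lineIntegral (η i) γ = g 1 i - g 0 i := by
  let G : ℝ → ℝ := fun t => g (Set.projIcc 0 1 zero_le_one t) i
  have key : ∀ t ∈ Set.Icc (0 : ℝ) 1, ContDiffWithinAt ℝ 1 G (Set.Icc 0 1) t ∧
      HasDerivWithinAt G (η i (γ.extend t)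
        (mfderivWithin 𝓘(ℝ, ℝ) (𝓡 n) γ.extend (Set.Icc 0 1) t (1 : ℝ))) (Set.Icc 0 1) t := by
    intro t ht
    have hm := S.mem_dom (γ.extend t)
    generalize S.index (γ.extend t) = k at hm
    have h1 : (fun s => S.fn k (γ.extend s) i + (G t - S.fn k (γ.extend t) i))
        =ᶠ[𝓝 t] G := by
      have h2 := (continuous_projIcc (h := zero_le_one (α := ℝ))).continuousAt.eventually
        (hg (Set.projIcc 0 1 zero_le_one t) k hm)
      filter_upwards [h2] with s hs
      have h3 := congr_fun hs i
      simp only [Pi.sub_apply] at h3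
      change S.fn k (γ (Set.projIcc 0 1 zero_le_one s)) i +
        (G t - S.fn k (γ (Set.projIcc 0 1 zero_le_one t)) i) = G s
      simp only [G]
      linarith
    have h4 := ((hS k i).contMDiffOn.contMDiffAt ((S.isOpen_dom k).mem_nhds hm)).comp_contMDiffWithinAt t
      ((hγ t ht).of_le (by simp))
    have h5 : HasMFDerivWithinAt 𝓘(ℝ, ℝ) (𝓡 n) γ.extend (Set.Icc 0 1) t
        (mfderivWithin 𝓘(ℝ, ℝ) (𝓡 n) γ.extend (Set.Icc 0 1) t) :=
      ((hγ t ht).mdifferentiableWithinAt (by simp)).hasMFDerivWithinAt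
    have h6 := HasMFDerivAt.comp_hasMFDerivWithinAt t ((hS k i).hasMFDerivAt _ hm) h5
    refine ⟨?_, ?_⟩
    · exact ((contMDiffWithinAt_iff_contDiffWithinAt.1 h4).add contDiffWithinAt_const).congr_of_eventuallyEq
        (h1.symm.filter_mono nhdsWithin_le_nhds) h1.symm.self_of_nhds
    · have h7 : HasFDerivWithinAt (fun s => S.fn k (γ.extend s) i)
          ((η i (γ.extend t)).comp (mfderivWithin 𝓘(ℝ, ℝ) (𝓡 n) γ.extend (Set.Icc 0 1) t) :
            ℝ →L[ℝ] ℝ) (Set.Icc 0 1) t := h6.hasFDerivWithinAt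
      exact (h7.hasDerivWithinAt.add_const (G t - S.fn k (γ.extend t) i)).congr_of_eventuallyEq
        (h1.symm.filter_mono nhdsWithin_le_nhds) h1.symm.self_of_nhds
  have h := intervalIntegral.integral_derivWithin_Icc_of_contDiffOn_Icc
    (fun t ht => (key t ht).1) (zero_le_one (α := ℝ))
  have hG : G 1 - G 0 = g 1 i - g 0 i := by simp [G]
  rw [← hG, ← h, lineIntegral]
  refine intervalIntegral.integral_congr fun t ht => ?_
  rw [Set.uIcc_of_le zero_le_one] at ht
  exact ((key t ht).2.derivWithin (uniqueDiffOn_Icc_zero_one t ht)).symm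

end Forms

/-! ### Joining points of the cover by paths with smooth projection -/

section SmoothPaths

variable {n : ℕ} {M : Type u} [TopologicalSpace M] [ChartedSpace (EuclideanSpace ℝ (Fin n)) M]

/-- The path is the restriction of a smooth curve which is constant near the end points. -/
structure IsFlatPath (n : ℕ) {M : Type u} [TopologicalSpace M]
    [ChartedSpace (EuclideanSpace ℝ (Fin n)) M] {x y : M} (γ : Path x y) : Prop where
  smooth : ContMDiff 𝓘(ℝ, ℝ) (𝓡 n) ∞ γ.extend
  left : ∀ᶠ t in 𝓝 (0 : ℝ), γ.extend t = x
  right : ∀ᶠ t in 𝓝 (1 : ℝ), γ.extend t = y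

theorem IsFlatPath.isSmoothPath {x y : M} {γ : Path x y} (h : IsFlatPath n γ) :
    IsSmoothPath (n := n) γ :=
  h.smooth.contMDiffOn

theorem IsFlatPath.refl (x : M) : IsFlatPath n (Path.refl x) := by
  have h : ⇑(Path.refl x).extend = fun _ => x := by ext; simp
  refine ⟨?_, ?_, ?_⟩
  · rw [h]; exact contMDiff_const
  all_goals simp

/-- Concatenation can create a corner only at 1/2, and there flatness makes the curve locally
constant. -/
theorem IsFlatPath.trans {x y z : M} {γ : Path x y} {γ' : Path y z} (h : IsFlatPath n γ)
    (h' : IsFlatPath n γ') : IsFlatPath n (γ.trans γ') := by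
  have e1 : ∀ t : ℝ, t ≤ 1 / 2 → (γ.trans γ').extend t = γ.extend (2 * t) := fun t ht =>
    Path.extend_trans_of_le_half γ γ' ht
  have e2 : ∀ t : ℝ, 1 / 2 ≤ t → (γ.trans γ').extend t = γ'.extend (2 * t - 1) := fun t ht =>
    Path.extend_trans_of_half_le γ γ' ht
  have c1 : Continuous fun t : ℝ => 2 * t := by fun_prop
  have c2 : Continuous fun t : ℝ => 2 * t - 1 := by fun_prop
  have s1 : ContMDiff 𝓘(ℝ, ℝ) 𝓘(ℝ, ℝ) ∞ fun t : ℝ => 2 * t :=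
    (contDiff_const.mul contDiff_id).contMDiff
  have s2 : ContMDiff 𝓘(ℝ, ℝ) 𝓘(ℝ, ℝ) ∞ fun t : ℝ => 2 * t - 1 :=
    ((contDiff_const.mul contDiff_id).sub contDiff_const).contMDiff
  refine ⟨fun t => ?_, ?_, ?_⟩
  · rcases lt_trichotomy t (1 / 2) with ht | ht | ht
    · refine ((h.smooth.comp s1) t).congr_of_eventuallyEq ?_
      filter_upwards [Iio_mem_nhds ht] with s hs
      exact e1 s (le_of_lt hs)
    · refine (contMDiffAt_const (c := y)).congr_of_eventuallyEq ?_
      have h1 := c1.continuousAt (x := t)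
      have h2 := c2.continuousAt (x := t)
      rw [ContinuousAt, ht] at h1 h2
      norm_num at h1 h2
      rw [ht]
      filter_upwards [h1.eventually h.right, h2.eventually h'.left] with s hs1 hs2
      rcases le_total s (1 / 2) with hs | hs
      · rw [e1 s hs, hs1]
      · rw [e2 s hs, hs2]
    · refine ((h'.smooth.comp s2) t).congr_of_eventuallyEq ?_
      filter_upwards [Ioi_mem_nhds ht] with s hs
      exact e2 s (le_of_lt hs)
  · have h1 := c1.continuousAt (x := 0)
    rw [ContinuousAt, mul_zero] at h1
    filter_upwards [h1.eventually h.left, Iio_mem_nhds (show (0 : ℝ) < 1 / 2 by norm_num)]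
      with s hs hs2
    rw [e1 s (le_of_lt hs2), hs]
  · have h1 := c2.continuousAt (x := 1)
    rw [ContinuousAt] at h1
    norm_num at h1
    filter_upwards [h1.eventually h'.right, Ioi_mem_nhds (show (1 / 2 : ℝ) < 1 by norm_num)]
      with s hs hs2
    rw [e2 s (le_of_lt hs2), hs]

theorem exists_nhds_isFlatPath [IsManifold (𝓡 n) ∞ M] {N : Type v} [TopologicalSpace N]
    {p : C(N, M)} (hp : IsLocalHomeomorph p) (x : N) :
    ∃ V ∈ 𝓝 x, ∀ a ∈ V, ∀ b ∈ V, ∃ γ : Path a b, IsFlatPath n (γ.map p.continuous) := by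
  obtain ⟨e, hxe, he⟩ := hp x
  have hsrc : (extChartAt (𝓡 n) (p x)).source ∈ 𝓝 (p x) := extChartAt_source_mem_nhds (p x)
  obtain ⟨r, hr, hball⟩ : ∃ r > 0, Metric.ball (extChartAt (𝓡 n) (p x) (p x)) r ⊆
      (extChartAt (𝓡 n) (p x)).target ∩ (extChartAt (𝓡 n) (p x)).symm ⁻¹' e.target := by
    rw [← Metric.mem_nhds_iff]
    refine Filter.inter_mem (extChartAt_target_mem_nhds (p x)) ?_
    refine (continuousAt_extChartAt_symm (I := 𝓡 n) (p x)).preimage_mem_nhds ?_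
    rw [extChartAt_to_inv]
    refine e.open_target.mem_nhds ?_
    rw [he]
    exact e.map_source hxe
  set φ := extChartAt (𝓡 n) (p x) with hφ
  refine ⟨e.source ∩ (p ⁻¹' φ.source ∩ (fun z => φ (p z)) ⁻¹' Metric.ball (φ (p x)) r), ?_, ?_⟩
  · refine Filter.inter_mem (e.open_source.mem_nhds hxe) (Filter.inter_mem
      (p.continuous.continuousAt.preimage_mem_nhds hsrc) ?_)
    have : ContinuousAt (fun z => φ (p z)) x :=
      ContinuousAt.comp (f := p) (continuousAt_extChartAt (I := 𝓡 n) (p x)) p.continuous.continuousAt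
    exact this.preimage_mem_nhds (Metric.ball_mem_nhds _ hr)
  · rintro a ⟨ha, ha', haB⟩ b ⟨hb, hb', hbB⟩
    -- This parameter is 0 for `t ≤ 1/3` and 1 for `t ≥ 2/3`, so the straight segment in the chart
    -- becomes a flat path; the local inverse `e.symm` of `p` lifts it.
    set s : ℝ → ℝ := fun t => Real.smoothTransition (3 * t - 1) with hs
    set l : ℝ → EuclideanSpace ℝ (Fin n) :=
      fun t => AffineMap.lineMap (φ (p a)) (φ (p b)) (s t) with hl
    have hsm : ContDiff ℝ ∞ s := Real.smoothTransition.contDiff.comp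
      ((contDiff_const.mul contDiff_id).sub contDiff_const)
    have hlm : ContDiff ℝ ∞ l := by
      simp only [hl, AffineMap.lineMap_apply_module]
      exact ((contDiff_const.sub hsm).smul contDiff_const).add (hsm.smul contDiff_const)
    have hlB : ∀ t, l t ∈ Metric.ball (φ (p x)) r := fun t =>
      (convex_ball _ _).lineMap_mem haB hbB
        ⟨Real.smoothTransition.nonneg _, Real.smoothTransition.le_one _⟩
    have hc : ContMDiff 𝓘(ℝ, ℝ) (𝓡 n) ∞ fun t => φ.symm (l t) :=
      (contMDiffOn_extChartAt_symm (p x)).comp_contMDiff hlm.contMDiff fun t => (hball (hlB t)).1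
    have hl0 : ∀ t : ℝ, t ≤ 1 / 3 → l t = φ (p a) := fun t ht => by
      simp only [hl, hs]
      rw [Real.smoothTransition.zero_of_nonpos (by linarith), AffineMap.lineMap_apply_zero]
    have hl1 : ∀ t : ℝ, 2 / 3 ≤ t → l t = φ (p b) := fun t ht => by
      simp only [hl, hs]
      rw [Real.smoothTransition.one_of_one_le (by linarith), AffineMap.lineMap_apply_one]
    have h0 : ∀ t : ℝ, t ≤ 1 / 3 → φ.symm (l t) = p a := fun t ht => by
      rw [hl0 t ht, φ.left_inv ha']
    have h1 : ∀ t : ℝ, 2 / 3 ≤ t → φ.symm (l t) = p b := fun t ht => by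
      rw [hl1 t ht, φ.left_inv hb']
    let γ : Path a b :=
      { toFun := fun t => e.symm (φ.symm (l t))
        continuous_toFun := e.continuousOn_symm.comp_continuous
          (hc.continuous.comp continuous_subtype_val) fun t => (hball (hlB t)).2
        source' := by
          rw [h0 _ (by norm_num), he]
          exact e.left_inv ha
        target' := by
          rw [h1 _ (by norm_num), he]
          exact e.left_inv hb }
    have hγ : ⇑(γ.map p.continuous).extend = fun t => φ.symm (l t) := by
      ext t
      have e1 : (γ.map p.continuous).extend t =
          p (e.symm (φ.symm (l (Set.projIcc (0 : ℝ) 1 zero_le_one t)))) := rfl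
      rw [e1, he, e.right_inv (hball (hlB _)).2]
      rcases le_total t 0 with ht | ht
      · rw [Set.projIcc_of_le_left _ ht, h0 _ (by norm_num), h0 _ (by linarith)]
      · rcases le_total t 1 with ht' | ht'
        · rw [Set.projIcc_of_mem zero_le_one ⟨ht, ht'⟩]
        · rw [Set.projIcc_of_right_le _ ht', h1 _ (by norm_num), h1 _ (by linarith)]
    refine ⟨γ, ⟨?_, ?_, ?_⟩⟩
    · rw [hγ]; exact hc
    · rw [hγ]
      filter_upwards [Iio_mem_nhds (show (0 : ℝ) < 1 / 3 by norm_num)] with t ht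
      exact h0 t (le_of_lt ht)
    · rw [hγ]
      filter_upwards [Ioi_mem_nhds (show (2 / 3 : ℝ) < 1 by norm_num)] with t ht
      exact h1 t (le_of_lt ht)

/-- Any two points are joined by a path whose projection is smooth. -/
theorem exists_isFlatPath [IsManifold (𝓡 n) ∞ M] {N : Type v} [TopologicalSpace N]
    [ConnectedSpace N] {p : C(N, M)} (hp : IsLocalHomeomorph p) (x y : N) :
    ∃ γ : Path x y, IsFlatPath n (γ.map p.continuous) := by
  have htr : ∀ {a b c : N}, (∃ γ : Path a b, IsFlatPath n (γ.map p.continuous)) →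
      (∃ γ : Path b c, IsFlatPath n (γ.map p.continuous)) →
      ∃ γ : Path a c, IsFlatPath n (γ.map p.continuous) := by
    rintro a b c ⟨γ, hγ⟩ ⟨γ', hγ'⟩
    refine ⟨γ.trans γ', ?_⟩
    rw [Path.map_trans]
    exact hγ.trans hγ'
  -- The points reachable from `x` form a nonempty clopen set, and `N` is connected.
  have hcl : IsClopen {y | ∃ γ : Path x y, IsFlatPath n (γ.map p.continuous)} := by
    constructor
    · rw [← isOpen_compl_iff, isOpen_iff_mem_nhds]
      intro b hb
      obtain ⟨V, hV, h⟩ := exists_nhds_isFlatPath (n := n) hp b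
      filter_upwards [hV] with c hc hxc
      exact hb (htr hxc (h c hc b (mem_of_mem_nhds hV)))
    · rw [isOpen_iff_mem_nhds]
      intro b hb
      obtain ⟨V, hV, h⟩ := exists_nhds_isFlatPath (n := n) hp b
      filter_upwards [hV] with c hc
      exact htr hb (h b (mem_of_mem_nhds hV) c hc)
  have := hcl.eq_univ ⟨x, Path.refl x, by
    have : (Path.refl x).map p.continuous = Path.refl (p x) := by ext; rfl
    rw [this]; exact IsFlatPath.refl _⟩
  exact Set.eq_univ_iff_forall.1 this y

end SmoothPaths

/-! ### Homology classes of projected paths -/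

section CoverClasses

theorem edgeClass_cast {X : Type u} [TopologicalSpace X] {x y x' y' : X} (γ : Path x y)
    (hx : x' = x) (hy : y' = y) : edgeClass (γ.cast hx hy) = edgeClass γ := by
  subst hx hy
  rfl

/-- The class of a path, as a homomorphism on the fundamental group. -/
def edgeClassHom {X : Type u} [TopologicalSpace X] (x : X) :
    FundamentalGroup X x →* Multiplicative ((chains X).opcycles 1) where
  toFun γ := Multiplicative.ofAdd
    (Quotient.lift (fun γ : Path x x => edgeClass γ) (fun _ _ h => edgeClass_eq_of_homotopic h) γ)
  map_one' := congr_arg Multiplicative.ofAdd (edgeClass_refl x)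
  map_mul' := by
    rintro ⟨γ⟩ ⟨γ'⟩
    rw [mul_comm]
    exact congr_arg Multiplicative.ofAdd (edgeClass_trans γ' γ)

theorem edgeClass_eq_zero_of_mem_commutator {X : Type u} [TopologicalSpace X] {x : X}
    {γ : Path x x}
    (h : FundamentalGroup.fromPath (.mk γ) ∈ commutator (FundamentalGroup X x)) :
    edgeClass γ = 0 :=
  Multiplicative.ofAdd.injective
    (MonoidHom.mem_ker.1 (Abelianization.commutator_subset_ker (edgeClassHom x) h))

variable {N : Type v} {M : Type u} [TopologicalSpace N] [TopologicalSpace M] {p : C(N, M)}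

theorem IsUniversalAbelianCover.edgeClass_map_loop (hp : IsUniversalAbelianCover p) {x : N}
    (γ : Path x x) : edgeClass (γ.map p.continuous) = 0 := by
  refine edgeClass_eq_zero_of_mem_commutator ?_
  rw [← hp.range_map x]
  exact ⟨FundamentalGroup.fromPath (.mk γ), rfl⟩

/-- Two paths with common end points form a loop of the cover, whose projection lies in the
commutator subgroup and so has class zero. -/
theorem IsUniversalAbelianCover.edgeClass_map_eq (hp : IsUniversalAbelianCover p) {x y : N}
    (γ γ' : Path x y) : edgeClass (γ.map p.continuous) = edgeClass (γ'.map p.continuous) := by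
  have h := hp.edgeClass_map_loop (γ.trans γ'.symm)
  rw [Path.map_trans, edgeClass_trans, ← Path.map_symm, edgeClass_symm] at h
  exact add_neg_eq_zero.1 h

/-- By Hurewicz the projected loop lies in the commutator subgroup, which is the image of the
fundamental group of `N`. Its monodromy fixes `x`, but lifting it along `γ` leads to `y`. -/
theorem IsUniversalAbelianCover.eq_of_edgeClass_map (hp : IsUniversalAbelianCover p)
    [PathConnectedSpace M] {x y : N} (h : p x = p y) (γ : Path x y)
    (hγ : edgeClass (γ.map p.continuous) = 0) : x = y := by
  let σ : Path (p x) (p x) := (γ.map p.continuous).cast rfl h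
  have h0 : loopClass σ = 0 := toEdgeClasses_injective (by
    rw [toEdgeClasses_loopClass, edgeClass_cast, hγ, map_zero])
  have h1 := mem_commutator_of_loopClass_eq_zero σ h0
  rw [← hp.range_map x] at h1
  obtain ⟨⟨τ⟩, hτ⟩ := h1
  have e1 : hp.covering.monodromy (.mk σ) ⟨x, rfl⟩ = ⟨x, rfl⟩ :=
    hp.covering.monodromy_eq_of_map_eq (Γ := .mk τ) hτ
  have e2 : hp.covering.monodromy (.mk σ) ⟨x, rfl⟩ = ⟨y, h.symm⟩ :=
    hp.covering.monodromy_eq_of_map_eq (Γ := .mk γ) rfl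
  exact congr_arg Subtype.val (e1.symm.trans e2)

theorem exists_path_lift (hp : IsCoveringMap p) (x : N) {m : M} (γ : Path (p x) m) :
    ∃ (y : N) (σ : Path x y), ∀ t, p (σ t) = γ t :=
  ⟨_, ⟨hp.liftPath γ x γ.source, hp.liftPath_zero γ x γ.source, rfl⟩,
    fun t => congr_fun (hp.liftPath_lifts γ x γ.source) t⟩

end CoverClasses

/-! ### Periods of closed forms as coordinates in homology -/

section Periods

variable {M : Type u} [TopologicalSpace M] {b : ℕ} {ι : Type*}

theorem LocalPrimitives.integral_eq_of_homotopic (S : LocalPrimitives ι M (Fin b → ℝ)) {x y : M}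
    {γ γ' : Path x y} (h : γ.Homotopic γ') : S.integral (.mk γ) = S.integral (.mk γ') :=
  congr_arg S.integral (Quotient.sound h)

/-- The integral factors through edge classes, so both sides are additive functions on `H1 M`. They
agree on `Γ` because each basis element is the class of a loop at `x₀`. -/
theorem LocalPrimitives.integral_apply_eq_repr (S : LocalPrimitives ι M (Fin b → ℝ))
    [PathConnectedSpace M] (Γ : Module.Basis (Fin b) ℤ (H1 M)) (x₀ : M)
    (h : ∀ (i j : Fin b) (γ : Path x₀ x₀), loopClass γ = Γ j →
      S.integral (.mk γ) i = if i = j then 1 else 0)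
    {x : M} (γ : Path x x) (i : Fin b) :
    S.integral (.mk γ) i = (Γ.repr (loopClass γ) i : ℝ) := by
  -- The target of the extension must live in the universe of `M`, hence the `ULift`.
  obtain ⟨φ, hφ⟩ := exists_hom_edgeClass (X := M) (A := ULift.{u} (Fin b → ℝ))
    (fun γ => ULift.up (S.integral (.mk γ)))
    (fun h => congr_arg ULift.up (S.integral_eq_of_homotopic h))
    (fun γ γ' => congr_arg ULift.up (S.integral_trans (.mk γ) (.mk γ')))
  have h1 : ∀ {x : M} (γ : Path x x), φ (toEdgeClasses M (loopClass γ)) =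
      ULift.up (S.integral (.mk γ)) := fun γ => by rw [toEdgeClasses_loopClass, hφ]
  let ψ : H1 M →+ ℝ :=
    { toFun := fun z => (φ (toEdgeClasses M z)).down i
      map_zero' := by rw [map_zero, map_zero]; rfl
      map_add' := fun z w => by rw [map_add, map_add]; rfl }
  let χ : H1 M →+ ℝ :=
    { toFun := fun z => (Γ.repr z i : ℝ)
      map_zero' := by simp
      map_add' := fun z w => by simp }
  have h2 : ψ = χ := by
    have h3 : ∀ j, ψ (Γ j) = χ (Γ j) := by
      intro j
      obtain ⟨γ, hγ⟩ := exists_loopClass_eq x₀ (Γ j)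
      have h4 : ψ (Γ j) = S.integral (.mk γ) i := by
        rw [← hγ]
        exact congr_arg (fun v : ULift.{u} (Fin b → ℝ) => v.down i) (h1 γ)
      rw [h4, h i j γ hγ]
      change _ = ((Γ.repr (Γ j) i : ℤ) : ℝ)
      rw [Γ.repr_self, Finsupp.single_apply]
      simp [eq_comm]
    have hs : ∀ (θ : H1 M →+ ℝ) (c : ℤ) (w : H1 M),
        θ ((H1 M).isModule.smul c w) = c • θ w := by
      intro θ c w
      rw [int_smul_eq_zsmul (H1 M).isModule c w]
      exact map_zsmul θ c w
    ext z
    rw [← Γ.sum_repr z, map_sum, map_sum]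
    exact Finset.sum_congr rfl fun j _ =>
      (hs ψ _ _).trans ((congr_arg _ (h3 j)).trans (hs χ _ _).symm)
  exact (congr_arg (fun v : ULift.{u} (Fin b → ℝ) => v.down i) (h1 γ)).symm.trans (DFunLike.congr_fun h2 (loopClass γ))

end Periods

/-! ### The Abel-Jacobi map as a period map -/

/-- The properties of the Abel-Jacobi map: it separates the points of a fibre, its differences on
a fibre are exactly the integer vectors, and it commutes with deck transformations up to
translations. -/
structure IsPeriodMap {N : Type v} {M : Type u} [TopologicalSpace N] [TopologicalSpace M] {b : ℕ}
    (p : C(N, M)) (j : C(N, Fin b → ℝ)) : Prop where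
  exists_int : ∀ x y, p x = p y → ∃ c : Fin b → ℤ, j y = j x + fun i => (c i : ℝ)
  exists_lift : ∀ x (c : Fin b → ℤ), ∃ y, p y = p x ∧ j y = j x + fun i => (c i : ℝ)
  inj : ∀ x y, p x = p y → j x = j y → x = y
  deck : ∀ δ : N ≃ₜ N, (∀ x, p (δ x) = p x) → ∀ x y, j (δ y) - j (δ x) = j y - j x

theorem repr_map_eq_mulVec {M : Type u} [TopologicalSpace M] {b : ℕ}
    (Γ : Module.Basis (Fin b) ℤ (H1 M)) (f : C(M, M)) (z : H1 M) :
    (fun i => (Γ.repr (H1.map f z) i : ℝ)) =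
      toRealMatrix (homologyMatrix Γ f) *ᵥ fun i => (Γ.repr z i : ℝ) := by
  have h := LinearMap.toMatrix_mulVec_repr Γ Γ (H1.map f) z
  ext i
  rw [← h]
  simp [homologyMatrix, toRealMatrix, Matrix.mulVec, dotProduct]

section

variable {n b : ℕ} {M : Type u} [TopologicalSpace M] [ChartedSpace (EuclideanSpace ℝ (Fin n)) M]
  {N : Type v} [TopologicalSpace N] {p : C(N, M)}

theorem locallyPathConnectedSpace_of_isLocalHomeomorph [LocallyPathConnectedSpace M]
    (hp : IsLocalHomeomorph p) : LocallyPathConnectedSpace N := by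
  let : ChartedSpace M N :=
    { atlas := Set.univ
      chartAt := fun x => (hp x).choose
      mem_chart_source := fun x => (hp x).choose_spec.1
      chart_mem_atlas := fun x => Set.mem_univ _ }
  exact ChartedSpace.locallyPathConnectedSpace M N

variable [IsManifold (𝓡 n) ∞ M] [ConnectedSpace M]

/-- The map `j` is the primitive of the forms along `p` vanishing at `x₀`. Its difference between
two points of a fibre is the coordinate vector of the loop class below a connecting path, and each
property of `j` is read off from this. -/
theorem exists_periodMap (hp : IsUniversalAbelianCover p)
    (Γ : Module.Basis (Fin b) ℤ (H1 M)) {η : Fin b → CovectorField n M}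
    (hη : IsDualFamily Γ η) (x₀ : N) :
    ∃ j : C(N, Fin b → ℝ), (∀ x, abelJacobi p η x₀ x = j x) ∧ IsPeriodMap p j ∧
      ∀ (f : C(M, M)) (F : C(N, N)), (∀ x, p (F x) = f (p x)) → ∀ x y, p x = p y →
        j (F y) - j (F x) = toRealMatrix (homologyMatrix Γ f) *ᵥ (j y - j x) := by
  have hloc := hp.covering.isLocalHomeomorph
  have := hp.connected
  have : LocallyPathConnectedSpace M :=
    ChartedSpace.locallyPathConnectedSpace (EuclideanSpace ℝ (Fin n)) M
  have : LocallyPathConnectedSpace N := locallyPathConnectedSpace_of_isLocalHomeomorph hloc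
  have : PathConnectedSpace N := ⟨inferInstance, fun x y =>
    let ⟨γ, _⟩ := exists_isFlatPath (n := n) hloc x y; ⟨γ⟩⟩
  have : PathConnectedSpace M := pathConnectedSpace_iff_connectedSpace.2 inferInstance
  obtain ⟨S, hS⟩ := exists_localPrimitives hη.closed
  obtain ⟨j, hj0, hj⟩ := S.exists_primitiveAlong p x₀ (hp.range_map x₀).le
  have hjc : Continuous j := hj.continuous p.continuous
  have hline : ∀ {x y : N} (γ : Path x y), IsSmoothPath (n := n) (γ.map p.continuous) →
      ∀ i, lineIntegral (η i) (γ.map p.continuous) = j y i - j x i := by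
    intro x y γ hγ i
    rw [lineIntegral_eq_sub hS _ hγ (g := j ∘ γ) (hj.comp γ.continuous)]
    simp
  have hint : ∀ {x y : N} (γ : Path x y) {m : M} (σ : Path m m), (∀ t, p (γ t) = σ t) →
      S.integral (.mk σ) = j y - j x := by
    intro x y γ m σ h
    have h1 : S.IsPrimitiveAlong σ (j ∘ γ) := by
      have := hj.comp γ.continuous
      rwa [show p ∘ γ = σ from funext h] at this
    rw [S.integral_eq σ h1]
    simp
  have hrepr : ∀ {x : M} (γ : Path x x) (i : Fin b),
      S.integral (.mk γ) i = (Γ.repr (loopClass γ) i : ℝ) := by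
    refine fun {x} γ i => S.integral_apply_eq_repr Γ (p x₀) ?_ γ i
    intro i k γ hγ
    -- Duality is given for smooth loops only. The loop is lifted and replaced by a flat path with
    -- the same end points, whose projection has the same class and the same integral.
    obtain ⟨y, τ, hτ⟩ := exists_path_lift hp.covering x₀ γ
    obtain ⟨σ, hσ⟩ := exists_isFlatPath (n := n) hloc x₀ y
    have hy : p x₀ = p y := by
      rw [← τ.target, hτ, γ.target]
    let σ' : Path (p x₀) (p x₀) := (σ.map p.continuous).cast rfl hy
    have hγτ : γ = (τ.map p.continuous).cast rfl hy := by
      ext t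
      exact (hτ t).symm
    have hcl : loopClass σ' = Γ k := by
      rw [← hγ]
      refine loopClass_eq_of_edgeClass_eq ?_
      rw [hγτ, edgeClass_cast, edgeClass_cast]
      exact hp.edgeClass_map_eq σ τ
    rw [← hη.dual i k _ σ' hσ.isSmoothPath hcl, hint τ γ hτ]
    exact (hline σ hσ.isSmoothPath i).symm
  have hcast : ∀ {x y : N} (γ : Path x y) (h : p x = p y), j y - j x =
      fun i => (Γ.repr (loopClass ((γ.map p.continuous).cast rfl h)) i : ℝ) := by
    intro x y γ h
    rw [← hint γ ((γ.map p.continuous).cast rfl h) fun t => rfl]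
    ext i
    exact hrepr _ i
  refine ⟨⟨j, hjc⟩, fun x => ?_, ⟨fun x y h => ?_, fun x c => ?_, fun x y h hxy => ?_,
    fun δ hδ x y => ?_⟩, fun f F hF x y h => ?_⟩
  · obtain ⟨γ, hγ⟩ := exists_isFlatPath (n := n) hloc x₀ x
    have hex : ∃ γ : Path x₀ x, IsSmoothPath (n := n) (γ.map p.continuous) :=
      ⟨γ, hγ.isSmoothPath⟩
    ext i
    -- By `hline` the chosen path is immaterial.
    rw [abelJacobi, dif_pos hex, hline _ hex.choose_spec, hj0]
    exact sub_zero _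
  · exact ⟨fun i => Γ.repr (loopClass (((PathConnectedSpace.somePath x y).map
      p.continuous).cast rfl h)) i, sub_eq_iff_eq_add'.1 (hcast _ h)⟩
  · obtain ⟨γ, hγ⟩ := exists_loopClass_eq (p x) (Γ.equivFun.symm c)
    obtain ⟨y, τ, hτ⟩ := exists_path_lift hp.covering x γ
    refine ⟨y, by rw [← τ.target, hτ, γ.target], ?_⟩
    refine sub_eq_iff_eq_add'.1 ((hint τ γ hτ).symm.trans ?_)
    ext i
    rw [hrepr, hγ]
    exact congr_arg (Int.cast (R := ℝ)) (congr_fun (Γ.equivFun.apply_symm_apply c) i)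
  · let γ := PathConnectedSpace.somePath x y
    refine hp.eq_of_edgeClass_map h γ ?_
    have h1 := hcast γ h
    rw [show j x = j y from hxy, sub_self] at h1
    rw [← edgeClass_cast (γ.map p.continuous) rfl h, ← toEdgeClasses_loopClass]
    have h2 : loopClass ((γ.map p.continuous).cast rfl h) = 0 := by
      refine Γ.ext_elem fun i => ?_
      have h3 : (0 : ℝ) = _ := congr_fun h1 i
      rw [map_zero]
      exact_mod_cast h3.symm
    rw [h2, map_zero]
  -- Since `p ∘ δ = p`, the function `j ∘ δ` is a second primitive along `p`.
  · have h1 := hj.comp δ.continuous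
    rw [show p ∘ δ = p from funext hδ] at h1
    have h2 := hj.sub_eq_sub h1 x y
    exact sub_eq_sub_iff_sub_eq_sub.1 h2.symm
  · let γ := PathConnectedSpace.somePath x y
    let σ : Path (p x) (p x) := (γ.map p.continuous).cast rfl h
    change j (F y) - j (F x) = _ *ᵥ (j y - j x)
    rw [← hint (γ.map F.continuous) (σ.map f.continuous) fun t => hF (γ t), hcast γ h,
      ← repr_map_eq_mulVec]
    ext i
    rw [hrepr, map_loopClass]

end

/-! ### Spectral splitting of a hyperbolic linear map -/

section Splitting

open Polynomial

variable {E : Type*} [NormedAddCommGroup E] [NormedSpace ℂ E] [FiniteDimensional ℂ E]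

/-- By Gelfand's formula the powers are eventually below `r ^ k` for any `r` between the spectral
radius and 1; the constant `C` absorbs the finitely many other exponents. -/
theorem exists_norm_pow_le_of_spectralRadius_lt_one [Nontrivial E] (T : E →L[ℂ] E)
    (h : ∀ μ : ℂ, ∀ v : E, v ≠ 0 → T v = μ • v → ‖μ‖ < 1) :
    ∃ r : ℝ, 0 < r ∧ r < 1 ∧ ∃ C : ℝ, ∀ k : ℕ, ‖T ^ k‖ ≤ C * r ^ k := by
  have := FiniteDimensional.complete ℂ E
  have hs : spectralRadius ℂ T < (1 : NNReal) := by
    refine spectrum.spectralRadius_lt_of_forall_lt_of_nonempty (spectrum.nonempty T) ?_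
    intro μ hμ
    have h1 : μ ∈ spectrum ℂ (T : Module.End ℂ E) := by
      have := AlgEquiv.spectrum_eq (Module.End.toContinuousLinearMap E) (T : Module.End ℂ E)
      rw [← this]
      exact hμ
    obtain ⟨v, hv⟩ := (Module.End.hasEigenvalue_iff_mem_spectrum.2 h1).exists_hasEigenvector
    exact h μ v hv.2 (Module.End.mem_eigenspace_iff.1 hv.1)
  obtain ⟨r, hr, hr1⟩ := ENNReal.lt_iff_exists_nnreal_btwn.1 hs
  have hr0 : 0 < r := by
    have := lt_of_le_of_lt (zero_le (a := spectralRadius ℂ T)) hr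
    exact_mod_cast this
  refine ⟨r, hr0, by exact_mod_cast hr1, ?_⟩
  have h1 : (fun k : ℕ => T ^ k) =O[Filter.atTop] fun k : ℕ => (r : ℝ) ^ k := by
    refine Asymptotics.IsBigO.of_bound 1 ?_
    filter_upwards [(spectrum.pow_norm_pow_one_div_tendsto_nhds_spectralRadius T).eventually_lt_const hr,
      Filter.eventually_gt_atTop 0] with k hk hk0
    rw [one_mul, Real.norm_of_nonneg (pow_nonneg r.coe_nonneg k)]
    have h2 : ‖T ^ k‖ ^ (1 / k : ℝ) < r := by
      rw [← ENNReal.ofReal_coe_nnreal] at hk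
      exact (ENNReal.ofReal_lt_ofReal_iff (by exact_mod_cast hr0)).1 hk
    have h3 : (‖T ^ k‖ ^ (1 / k : ℝ)) ^ k ≤ (r : ℝ) ^ k :=
      pow_le_pow_left₀ (Real.rpow_nonneg (norm_nonneg _) _) h2.le k
    rwa [← Real.rpow_natCast, ← Real.rpow_mul (norm_nonneg _), one_div,
      inv_mul_cancel₀ (by exact_mod_cast hk0.ne'), Real.rpow_one] at h3
  obtain ⟨C, -, hC⟩ := Asymptotics.bound_of_isBigO_nat_atTop h1
  refine ⟨C, fun k => ?_⟩
  have h2 := @hC k (pow_ne_zero _ (by exact_mod_cast hr0.ne'))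
  rwa [Real.norm_of_nonneg (pow_nonneg r.coe_nonneg k)] at h2

/-- The splitting of an invertible linear map without eigenvalues on the unit circle: `P` and `Q`
are the projections onto the unstable and the stable subspace, `B` is the inverse on the former
and `D` the map itself on the latter. -/
theorem exists_splitting [Nontrivial E] (T T' : E →L[ℂ] E) (hT : T * T' = 1) (hT' : T' * T = 1)
    (h : ∀ μ : ℂ, Module.End.HasEigenvalue (T : Module.End ℂ E) μ → ‖μ‖ ≠ 1) :
    ∃ P Q B D : E →L[ℂ] E, P + Q = 1 ∧ B * P * T = P ∧ T * B = P ∧ P * B = B ∧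
      D * Q = Q * T ∧ Q * D = D ∧ T * Q = D ∧ Q * Q = Q ∧
      (∃ r : ℝ, 0 < r ∧ r < 1 ∧ ∃ C : ℝ, ∀ k : ℕ, ‖B ^ k‖ ≤ C * r ^ k) ∧
      (∃ r : ℝ, 0 < r ∧ r < 1 ∧ ∃ C : ℝ, ∀ k : ℕ, ‖D ^ k‖ ≤ C * r ^ k) ∧
      ((∀ μ : ℂ, Module.End.HasEigenvalue (T : Module.End ℂ E) μ → 1 < ‖μ‖) → Q = 0) := by
  classical
  let Φ : Module.End ℂ E ≃ₐ[ℂ] (E →L[ℂ] E) := Module.End.toContinuousLinearMap E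
  let f : Module.End ℂ E := T
  have hΦ : Φ f = T := rfl
  have hint : IsIntegral ℂ f := Algebra.IsIntegral.isIntegral f
  have hroot : ∀ μ, μ ∈ (minpoly ℂ f).roots → Module.End.HasEigenvalue f μ := fun μ hμ =>
    Module.End.hasEigenvalue_iff_isRoot.2 (isRoot_of_mem_roots hμ)
  -- The minimal polynomial is the product of its unstable part `qu` and its stable part `qs`. They
  -- share no root, and a Bézout identity between them yields the spectral projections as
  -- polynomials in `T`.
  let qu : ℂ[X] := (((minpoly ℂ f).roots.filter fun μ => 1 < ‖μ‖).map fun a => X - C a).prod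
  let qs : ℂ[X] := (((minpoly ℂ f).roots.filter fun μ => ¬ 1 < ‖μ‖).map fun a => X - C a).prod
  have hq : qu * qs = minpoly ℂ f := by
    rw [(IsAlgClosed.splits (minpoly ℂ f)).eq_prod_roots_of_monic (minpoly.monic hint)]
    simp only [qu, qs]
    rw [← Multiset.prod_add, ← Multiset.map_add, Multiset.filter_add_not]
  have hqu : ∀ μ : ℂ, aeval μ qu = 0 → 1 < ‖μ‖ := by
    intro μ hμ
    simp only [qu, map_multiset_prod, Multiset.prod_eq_zero_iff, Multiset.map_map,
      Multiset.mem_map, Function.comp_apply, map_sub, aeval_X, aeval_C] at hμ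
    obtain ⟨a, ha, ha'⟩ := hμ
    have : μ = a := sub_eq_zero.1 ha'
    rw [this]
    exact (Multiset.mem_filter.1 ha).2
  have hqs : ∀ μ : ℂ, aeval μ qs = 0 → ‖μ‖ < 1 := by
    intro μ hμ
    simp only [qs, map_multiset_prod, Multiset.prod_eq_zero_iff, Multiset.map_map,
      Multiset.mem_map, Function.comp_apply, map_sub, aeval_X, aeval_C] at hμ
    obtain ⟨a, ha, ha'⟩ := hμ
    have : μ = a := sub_eq_zero.1 ha'
    rw [this]
    have h1 := Multiset.mem_filter.1 ha
    exact lt_of_le_of_ne (not_lt.1 h1.2) (h a (hroot a h1.1))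
  have hcop : IsCoprime qu qs := by
    rw [isCoprime_iff_aeval_ne_zero_of_isAlgClosed ℂ ℂ]
    intro μ
    by_contra hc
    push Not at hc
    exact lt_asymm (hqu μ hc.1) (hqs μ hc.2)
  obtain ⟨a, c, hac⟩ := hcop
  have hzero : aeval T qu * aeval T qs = 0 := by
    rw [← map_mul, hq, ← hΦ, aeval_algHom_apply, minpoly.aeval, map_zero]
  have hcomm : ∀ q q' : ℂ[X], aeval T q * aeval T q' = aeval T q' * aeval T q := fun q q' => by
    rw [← map_mul, mul_comm, map_mul]
  have hcommT : ∀ q : ℂ[X], T * aeval T q = aeval T q * T := fun q => by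
    have := hcomm X q
    rwa [aeval_X] at this
  have hcommT' : ∀ q : ℂ[X], T' * aeval T q = aeval T q * T' := fun q => by
    have := congr_arg (fun S => T' * S * T') (hcommT q)
    simp only [← mul_assoc] at this
    rw [hT', one_mul, mul_assoc (T' * _), hT, mul_one] at this
    exact this.symm
  have heig : ∀ (q : ℂ[X]) (μ : ℂ) (v : E), T v = μ • v → v ≠ 0 → aeval T q v = 0 →
      aeval μ q = 0 := by
    intro q μ v hv hv0 hq0
    have h1 := Module.End.aeval_apply_of_hasEigenvector (f := f) (p := q) (μ := μ) (x := v)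
      ⟨Module.End.mem_eigenspace_iff.2 hv, hv0⟩
    have h2 : aeval T q = Φ (aeval f q) := by rw [← hΦ, aeval_algHom_apply]
    rw [h2] at hq0
    have h3 : q.eval μ • v = 0 := h1.symm.trans hq0
    simpa using (smul_eq_zero.1 h3).resolve_right hv0
  set P : E →L[ℂ] E := aeval T (c * qs) with hP
  set Q : E →L[ℂ] E := aeval T (a * qu) with hQ
  have hPQ : P + Q = 1 := by
    rw [hP, hQ, ← map_add, add_comm, hac, map_one]
  have hPQ0 : P * Q = 0 := by
    rw [hP, hQ, ← map_mul, show c * qs * (a * qu) = c * a * (qu * qs) by ring, map_mul, map_mul _ qu,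
      hzero, mul_zero]
  have hQP0 : Q * P = 0 := by rw [hQ, hcomm, ← hP, ← hQ, hPQ0]
  have hPP : P * P = P := by
    have := congr_arg (P * ·) hPQ
    simpa [mul_add, hPQ0] using this
  have hQQ : Q * Q = Q := by
    have := congr_arg (Q * ·) hPQ
    simpa [mul_add, hQP0] using this
  have hPT : T * P = P * T := hcommT _
  have hPT' : T' * P = P * T' := hcommT' _
  have hQT : T * Q = Q * T := hcommT _
  have huP : aeval T qu * P = 0 := by
    rw [hP, ← map_mul, show qu * (c * qs) = c * (qu * qs) by ring, map_mul, map_mul _ qu, hzero,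
      mul_zero]
  have hsQ : aeval T qs * Q = 0 := by
    rw [hQ, ← map_mul, show qs * (a * qu) = a * (qu * qs) by ring, map_mul, map_mul _ qu, hzero,
      mul_zero]
  refine ⟨P, Q, T' * P, T * Q, hPQ, ?_, ?_, ?_, ?_, ?_, rfl, hQQ, ?_, ?_, ?_⟩
  · rw [mul_assoc T', hPP, mul_assoc, ← hPT, ← mul_assoc, hT', one_mul]
  · rw [← mul_assoc, hT, one_mul]
  · rw [← mul_assoc, ← hPT', mul_assoc, hPP]
  · rw [mul_assoc, hQQ, hQT]
  · rw [← mul_assoc, ← hQT, mul_assoc, hQQ]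
  -- An eigenvector of `B = T' * P` with eigenvalue `ν ≠ 0` lies in the range of `P` and is one of
  -- `T` for `ν⁻¹`; since `qu` kills that range, `ν⁻¹` is a root of `qu`.
  · refine exists_norm_pow_le_of_spectralRadius_lt_one _ fun ν v hv0 hv => ?_
    rcases eq_or_ne ν 0 with rfl | hν
    · simp
    have hPv : P v = v := by
      have h1 : P (ν • v) = ν • v := by
        rw [← hv, ← mul_apply_eq_comp, ← mul_assoc, ← hPT', mul_assoc, hPP]
      rw [map_smul] at h1
      exact smul_right_injective E hν h1
    have hTv : T v = ν⁻¹ • v := by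
      have h1 := congr_arg T hv
      rw [← mul_apply_eq_comp, ← mul_assoc, hT, one_mul, hPv, map_smul] at h1
      calc T v = ν⁻¹ • (ν • T v) := by rw [smul_smul, inv_mul_cancel₀ hν, one_smul]
        _ = ν⁻¹ • v := by rw [← h1]
    have h1 : aeval T qu v = 0 := by
      conv_lhs => rw [← hPv]
      rw [← mul_apply_eq_comp, huP]
      rfl
    have h2 := hqu _ (heig qu ν⁻¹ v hTv hv0 h1)
    rw [norm_inv] at h2
    exact (one_lt_inv₀ (norm_pos_iff.2 hν)).1 h2
  · refine exists_norm_pow_le_of_spectralRadius_lt_one _ fun ν v hv0 hv => ?_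
    rcases eq_or_ne ν 0 with rfl | hν
    · simp
    have hQv : Q v = v := by
      have h1 : Q (ν • v) = ν • v := by
        rw [← hv, ← mul_apply_eq_comp, ← mul_assoc, ← hQT, mul_assoc, hQQ]
      rw [map_smul] at h1
      exact smul_right_injective E hν h1
    have hTv : T v = ν • v := by
      rw [← hv, mul_apply_eq_comp, hQv]
    have h1 : aeval T qs v = 0 := by
      conv_lhs => rw [← hQv]
      rw [← mul_apply_eq_comp, hsQ]
      rfl
    exact hqs _ (heig qs ν v hTv hv0 h1)
  · intro hexp
    have h1 : qs = 1 := by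
      have : (minpoly ℂ f).roots.filter (fun μ => ¬ 1 < ‖μ‖) = 0 :=
        Multiset.filter_eq_nil.2 fun μ hμ hc => hc (hexp μ (hroot μ hμ))
      simp only [qs, this, Multiset.map_zero, Multiset.prod_zero]
    rw [h1, map_one, one_mul] at hsQ
    exact hsQ

end Splitting

/-! ### Adapted norms and cohomological equations -/

section Adapted

variable {E : Type*} [NormedAddCommGroup E] [NormedSpace ℂ E]

/-- A linear map whose powers decay exponentially contracts an equivalent norm. -/
theorem exists_contracted_seminorm (S : E →L[ℂ] E) {r : ℝ} (hr0 : 0 < r) (hr : r < 1) {C : ℝ}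
    (hC : ∀ k : ℕ, ‖S ^ k‖ ≤ C * r ^ k) :
    ∃ (L : AddGroupSeminorm E) (lam : ℝ), 1 < lam ∧ (∀ w, ‖w‖ ≤ L w) ∧ (∀ w, L w ≤ C * ‖w‖) ∧
      ∀ w, lam * L (S w) ≤ L w := by
  have hb : ∀ w, ∀ k : ℕ, (r⁻¹) ^ k * ‖(S ^ k) w‖ ≤ C * ‖w‖ := by
    intro w k
    have h1 : ‖(S ^ k) w‖ ≤ C * r ^ k * ‖w‖ :=
      ((S ^ k).le_opNorm w).trans (mul_le_mul_of_nonneg_right (hC k) (norm_nonneg w))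
    calc (r⁻¹) ^ k * ‖(S ^ k) w‖ ≤ (r⁻¹) ^ k * (C * r ^ k * ‖w‖) := by gcongr
      _ = ((r⁻¹) ^ k * r ^ k) * (C * ‖w‖) := by ring
      _ = C * ‖w‖ := by rw [← mul_pow, inv_mul_cancel₀ hr0.ne', one_pow, one_mul]
  have hbdd : ∀ w, BddAbove (Set.range fun k : ℕ => (r⁻¹) ^ k * ‖(S ^ k) w‖) := fun w =>
    ⟨C * ‖w‖, by rintro _ ⟨k, rfl⟩; exact hb w k⟩
  -- Replacing `w` by `S w` shifts the weighted supremum by one index, which gains the factor `r⁻¹`;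
  -- the term `k = 0` is `‖w‖`.
  let L : AddGroupSeminorm E :=
    { toFun := fun w => ⨆ k : ℕ, (r⁻¹) ^ k * ‖(S ^ k) w‖
      map_zero' := by simp
      add_le' := fun w w' => by
        refine ciSup_le fun k => ?_
        calc (r⁻¹) ^ k * ‖(S ^ k) (w + w')‖
            ≤ (r⁻¹) ^ k * (‖(S ^ k) w‖ + ‖(S ^ k) w'‖) := by
              rw [map_add]; gcongr; exact norm_add_le _ _
          _ = (r⁻¹) ^ k * ‖(S ^ k) w‖ + (r⁻¹) ^ k * ‖(S ^ k) w'‖ := mul_add _ _ _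
          _ ≤ _ := add_le_add (le_ciSup (hbdd w) k) (le_ciSup (hbdd w') k)
      neg' := fun w => by simp }
  refine ⟨L, r⁻¹, (one_lt_inv₀ hr0).2 hr, fun w => ?_, fun w => ciSup_le (hb w), fun w => ?_⟩
  · refine Eq.trans_le ?_ (le_ciSup (hbdd w) 0)
    simp
  · change r⁻¹ * (⨆ k : ℕ, (r⁻¹) ^ k * ‖(S ^ k) (S w)‖) ≤ ⨆ k : ℕ, (r⁻¹) ^ k * ‖(S ^ k) w‖
    rw [Real.mul_iSup_of_nonneg (inv_nonneg.2 hr0.le)]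
    refine ciSup_le fun k => ?_
    refine Eq.trans_le ?_ (le_ciSup (hbdd w) (k + 1))
    simp only [pow_succ, mul_apply_eq_comp]
    ring

/-- Solution of a cohomological equation by an exponentially convergent series. -/
theorem exists_eq_add_comp {M : Type*} [TopologicalSpace M] [CompactSpace M] [CompleteSpace E]
    (S : E →L[ℂ] E) {r : ℝ} (hr0 : 0 < r) (hr : r < 1) {C : ℝ}
    (hC : ∀ k : ℕ, ‖S ^ k‖ ≤ C * r ^ k) (f : C(M, M)) (g : C(M, E)) :
    ∃ φ : C(M, E), ∀ m, φ m = g m + S (φ (f m)) := by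
  -- The solution is the sum of `S^k ∘ g ∘ f^k`, dominated uniformly by a geometric series since `g`
  -- is bounded on the compact `M`.
  let u : ℕ → M → E := fun k m => (S ^ k) (g (f^[k] m))
  have hu : ∀ k, Continuous (u k) := fun k =>
    (S ^ k).continuous.comp (g.continuous.comp (f.continuous.iterate k))
  have hb : ∀ k m, ‖u k m‖ ≤ C * r ^ k * ‖g‖ := by
    intro k m
    refine ((S ^ k).le_opNorm _).trans ?_
    exact mul_le_mul (hC k) (g.norm_coe_le_norm _) (norm_nonneg _)
      ((norm_nonneg _).trans (hC k))
  have hs : Summable fun k : ℕ => C * r ^ k * ‖g‖ :=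
    ((summable_geometric_of_lt_one hr0.le hr).mul_left C).mul_right _
  have hsm : ∀ m, Summable fun k => u k m := fun m =>
    Summable.of_norm_bounded hs fun k => hb k m
  refine ⟨⟨fun m => ∑' k, u k m, continuous_tsum hu hs hb⟩, fun m => ?_⟩
  change ∑' k, u k m = g m + S (∑' k, u k (f m))
  rw [(hsm m).tsum_eq_zero_add, S.map_tsum (hsm (f m))]
  congr 1
  refine tsum_congr fun k => ?_
  simp only [u, pow_succ', mul_apply_eq_comp, Function.iterate_succ_apply]

end Adapted

/-! ### Adapted seminorms and cohomological equations for an integer matrix -/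

section RealMatrix

variable {b : ℕ} (A : Matrix (Fin b) (Fin b) ℤ)

/-- The complexification of a real vector. -/
def complexify (v : Fin b → ℝ) : Fin b → ℂ := fun i => v i

theorem norm_complexify (v : Fin b → ℝ) : ‖complexify v‖ = ‖v‖ := by
  simp only [complexify, Pi.norm_def, Complex.nnnorm_real]

theorem continuous_complexify : Continuous (complexify (b := b)) :=
  continuous_pi fun i => Complex.continuous_ofReal.comp (continuous_apply i)

/-- An integer matrix as a complex linear map. -/
def complexMap : (Fin b → ℂ) →L[ℂ] (Fin b → ℂ) :=
  LinearMap.toContinuousLinearMap (Matrix.toLin' (A.map (fun k : ℤ => (k : ℂ))))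

theorem complexMap_apply (w : Fin b → ℂ) :
    complexMap A w = A.map (fun k : ℤ => (k : ℂ)) *ᵥ w := rfl

theorem complexMap_complexify (v : Fin b → ℝ) :
    complexMap A (complexify v) = complexify (toRealMatrix A *ᵥ v) := by
  ext i
  simp [complexMap_apply, complexify, toRealMatrix, Matrix.mulVec, dotProduct]

theorem re_complexMap (w : Fin b → ℂ) :
    (fun i => (complexMap A w i).re) = toRealMatrix A *ᵥ fun i => (w i).re := by
  ext i
  simp [complexMap_apply, toRealMatrix, Matrix.mulVec, dotProduct]

theorem exists_complexMap_inverse (hdet : A.det ≠ 0) :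
    ∃ T' : (Fin b → ℂ) →L[ℂ] (Fin b → ℂ), complexMap A * T' = 1 ∧ T' * complexMap A = 1 := by
  have h : IsUnit (A.map (fun k : ℤ => (k : ℂ))).det := by
    have h1 : (A.map (fun k : ℤ => (k : ℂ))).det = (A.det : ℂ) :=
      (RingHom.map_det (Int.castRingHom ℂ) A).symm
    rw [h1]
    exact isUnit_iff_ne_zero.2 (by exact_mod_cast hdet)
  refine ⟨LinearMap.toContinuousLinearMap
    (Matrix.toLin' (A.map (fun k : ℤ => (k : ℂ)))⁻¹), ?_, ?_⟩
  · ext1 w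
    change (A.map (fun k : ℤ => (k : ℂ))) *ᵥ ((A.map (fun k : ℤ => (k : ℂ)))⁻¹ *ᵥ w) = w
    rw [Matrix.mulVec_mulVec, Matrix.mul_nonsing_inv _ h, Matrix.one_mulVec]
  · ext1 w
    change (A.map (fun k : ℤ => (k : ℂ)))⁻¹ *ᵥ ((A.map (fun k : ℤ => (k : ℂ))) *ᵥ w) = w
    rw [Matrix.mulVec_mulVec, Matrix.nonsing_inv_mul _ h, Matrix.one_mulVec]

/-- The pull-back of a seminorm on complex vectors. -/
def realSeminorm (L : AddGroupSeminorm (Fin b → ℂ)) (P : (Fin b → ℂ) →L[ℂ] (Fin b → ℂ)) :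
    AddGroupSeminorm (Fin b → ℝ) where
  toFun v := L (P (complexify v))
  map_zero' := by
    rw [show complexify (0 : Fin b → ℝ) = 0 by ext; simp [complexify], map_zero, map_zero]
  add_le' v w := by
    rw [show complexify (v + w) = complexify v + complexify w by ext; simp [complexify], map_add]
    exact map_add_le_add L _ _
  neg' v := by
    rw [show complexify (-v) = -complexify v by ext; simp [complexify], map_neg, map_neg_eq_map]

/-- `L₁` measures the unstable component in a norm contracted by `B`, and `L₂` the stable one in a
norm contracted by `D`. Expansion and contraction under `A` are the relations `B P T = P` and `D Q =
Q T`. -/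
theorem exists_adapted_seminorms (hb : 0 < b) (hdet : A.det ≠ 0) (hA : IsHyperbolicMatrix A) :
    ∃ (L₁ L₂ : AddGroupSeminorm (Fin b → ℝ)) (lam C : ℝ), 1 < lam ∧
      (∀ v, ‖v‖ ≤ L₁ v + L₂ v) ∧ (∀ v, L₁ v ≤ C * ‖v‖) ∧ (∀ v, L₂ v ≤ C * ‖v‖) ∧
      (∀ v, lam * L₁ v ≤ L₁ (toRealMatrix A *ᵥ v)) ∧
      (∀ v, lam * L₂ (toRealMatrix A *ᵥ v) ≤ L₂ v) ∧ (IsExpandingMatrix A → L₂ = 0) := by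
  have : NeZero b := ⟨hb.ne'⟩
  obtain ⟨T', hT, hT'⟩ := exists_complexMap_inverse A hdet
  obtain ⟨P, Q, B, D, hPQ, hBPT, hTB, hPB, hDQ, hQD, hTQ, hQQ, ⟨r, hr0, hr, C, hC⟩,
    ⟨r', hr0', hr', C', hC'⟩, hexp⟩ := exists_splitting (complexMap A) T' hT hT' hA
  obtain ⟨L, lam, hlam, hL, hLC, hLS⟩ := exists_contracted_seminorm B hr0 hr hC
  obtain ⟨L', lam', hlam', hL', hLC', hLS'⟩ := exists_contracted_seminorm D hr0' hr' hC'
  have hC0 : 0 ≤ C := by simpa using (norm_nonneg _).trans (hC 0)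
  have hC0' : 0 ≤ C' := by simpa using (norm_nonneg _).trans (hC' 0)
  refine ⟨realSeminorm L P, realSeminorm L' Q, min lam lam', max (C * ‖P‖) (C' * ‖Q‖),
    lt_min hlam hlam', fun v => ?_, fun v => ?_, fun v => ?_, fun v => ?_, fun v => ?_,
    fun hA => ?_⟩
  · calc ‖v‖ = ‖(P + Q) (complexify v)‖ := by rw [hPQ, ← norm_complexify]; rfl
      _ ≤ ‖P (complexify v)‖ + ‖Q (complexify v)‖ := norm_add_le _ _
      _ ≤ _ := add_le_add (hL _) (hL' _)
  · calc L (P (complexify v)) ≤ C * ‖P (complexify v)‖ := hLC _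
      _ ≤ C * (‖P‖ * ‖complexify v‖) := by gcongr; exact P.le_opNorm _
      _ = C * ‖P‖ * ‖v‖ := by rw [norm_complexify, mul_assoc]
      _ ≤ _ := by gcongr; exact le_max_left _ _
  · calc L' (Q (complexify v)) ≤ C' * ‖Q (complexify v)‖ := hLC' _
      _ ≤ C' * (‖Q‖ * ‖complexify v‖) := by gcongr; exact Q.le_opNorm _
      _ = C' * ‖Q‖ * ‖v‖ := by rw [norm_complexify, mul_assoc]
      _ ≤ _ := by gcongr; exact le_max_right _ _
  · change min lam lam' * L (P (complexify v)) ≤ L (P (complexify (toRealMatrix A *ᵥ v)))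
    have h1 := hLS (P (complexMap A (complexify v)))
    rw [show B (P (complexMap A (complexify v))) = (B * P * complexMap A) (complexify v) from rfl,
      hBPT, complexMap_complexify] at h1
    exact (mul_le_mul_of_nonneg_right (min_le_left _ _) (apply_nonneg L _)).trans h1
  · change min lam lam' * L' (Q (complexify (toRealMatrix A *ᵥ v))) ≤ L' (Q (complexify v))
    have h1 := hLS' (Q (complexify v))
    rw [show D (Q (complexify v)) = (D * Q) (complexify v) from rfl, hDQ, mul_apply_eq_comp,
      complexMap_complexify] at h1
    exact (mul_le_mul_of_nonneg_right (min_le_right _ _) (apply_nonneg L' _)).trans h1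
  · ext v
    change L' (Q (complexify v)) = 0
    rw [hexp hA]
    exact map_zero L'

theorem IsExpandingMatrix.isHyperbolicMatrix {A : Matrix (Fin b) (Fin b) ℤ}
    (hA : IsExpandingMatrix A) : IsHyperbolicMatrix A := fun μ hμ => (hA μ hμ).ne'

theorem IsExpandingMatrix.det_ne_zero {A : Matrix (Fin b) (Fin b) ℤ}
    (hA : IsExpandingMatrix A) : A.det ≠ 0 := by
  intro h
  have h1 : (A.map (fun k : ℤ => (k : ℂ))).det = 0 := by
    have h1 : (A.map (fun k : ℤ => (k : ℂ))).det = (A.det : ℂ) :=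
      (RingHom.map_det (Int.castRingHom ℂ) A).symm
    rw [h1, h, Int.cast_zero]
  obtain ⟨v, hv, hv0⟩ := Matrix.exists_mulVec_eq_zero_iff.2 h1
  have h2 : Module.End.HasEigenvalue (Matrix.toLin' (A.map (fun k : ℤ => (k : ℂ)))) 0 := by
    refine Module.End.hasEigenvalue_of_hasEigenvector (x := v)
      ⟨Module.End.mem_eigenspace_iff.2 ?_, hv⟩
    rw [Matrix.toLin'_apply, hv0, zero_smul]
  have := hA 0 h2
  rw [norm_zero] at this
  exact absurd this (by norm_num)

/-- The matrix is real, so the real part of a complex solution is a solution. -/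
theorem exists_mulVec_eq_of_complex {M : Type*} [TopologicalSpace M]
    {A : Matrix (Fin b) (Fin b) ℤ} (f : M → M)
    (g : M → Fin b → ℝ) (φ : C(M, Fin b → ℂ))
    (h : ∀ m, complexMap A (φ m) = φ (f m) + complexify (g m)) :
    ∃ φ : C(M, Fin b → ℝ), ∀ m, toRealMatrix A *ᵥ φ m = φ (f m) + g m := by
  refine ⟨⟨fun m i => (φ m i).re, continuous_pi fun i => Complex.continuous_re.comp
    ((continuous_apply i).comp φ.continuous)⟩, fun m => ?_⟩
  change toRealMatrix A *ᵥ (fun i => (φ m i).re) = _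
  rw [← re_complexMap, h]
  rfl

variable {M : Type*} [TopologicalSpace M] [CompactSpace M]

/-- The cohomological equation over a homeomorphism for a hyperbolic matrix. -/
theorem IsHyperbolicMatrix.exists_mulVec_eq {A : Matrix (Fin b) (Fin b) ℤ}
    (hA : IsHyperbolicMatrix A) (hb : 0 < b) (hdet : A.det ≠ 0) (h : M ≃ₜ M)
    (g : C(M, Fin b → ℝ)) :
    ∃ φ : C(M, Fin b → ℝ), ∀ m, toRealMatrix A *ᵥ φ m = φ (h m) + g m := by
  have : NeZero b := ⟨hb.ne'⟩
  obtain ⟨T', hT, hT'⟩ := exists_complexMap_inverse A hdet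
  obtain ⟨P, Q, B, D, hPQ, hBPT, hTB, hPB, hDQ, hQD, hTQ, hQQ, ⟨r, hr0, hr, C, hC⟩,
    ⟨r', hr0', hr', C', hC'⟩, -⟩ := exists_splitting (complexMap A) T' hT hT' hA
  let g' : C(M, Fin b → ℂ) := ⟨fun m => complexify (g m), continuous_complexify.comp g.continuous⟩
  -- The unstable component is solved forward, as `φ = B (g + φ ∘ h)`. The stable one is solved
  -- backward, as `χ = -Q (g ∘ h⁻¹) + D (χ ∘ h⁻¹)`, which is where invertibility of `h` enters.
  obtain ⟨φ, hφ⟩ := exists_eq_add_comp B hr0 hr hC (h : C(M, M))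
    ⟨fun m => B (g' m), B.continuous.comp g'.continuous⟩
  obtain ⟨χ, hχ⟩ := exists_eq_add_comp D hr0' hr' hC' (h.symm : C(M, M))
    ⟨fun m => -Q (g' (h.symm m)),
      (Q.continuous.comp (g'.continuous.comp h.symm.continuous)).neg⟩
  refine exists_mulVec_eq_of_complex h g (φ + χ) fun m => ?_
  have e1 : complexMap A (φ m) = P (g' m) + φ (h m) := by
    have h1 : ∀ m, φ m = B (g' m + φ (h m)) := fun m => (hφ m).trans (map_add B _ _).symm
    have h2 : P (φ (h m)) = φ (h m) := by
      rw [h1, ← mul_apply_eq_comp, hPB]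
    rw [h1, ← mul_apply_eq_comp, hTB, map_add, h2]
  have e2 : complexMap A (χ m) = Q (g' m) + χ (h m) := by
    have h1 : ∀ m, χ m = -Q (g' (h.symm m)) + D (χ (h.symm m)) := hχ
    have h2 : Q (χ m) = χ m := by
      rw [h1, map_add, map_neg, ← mul_apply_eq_comp, ← mul_apply_eq_comp, hQQ, hQD]
    have h3 : D (χ m) = complexMap A (χ m) := by
      rw [← hTQ, mul_apply_eq_comp, h2]
    rw [h1 (h m), h.symm_apply_apply, h3, add_neg_cancel_left]
  change complexMap A (φ m + χ m) = φ (h m) + χ (h m) + g' m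
  have e3 : P (g' m) + Q (g' m) = g' m := by
    rw [← add_apply, hPQ]
    rfl
  rw [map_add, e1, e2]
  nth_rw 3 [← e3]
  abel

/-- The cohomological equation over a continuous map for an expanding matrix. -/
theorem IsExpandingMatrix.exists_mulVec_eq {A : Matrix (Fin b) (Fin b) ℤ}
    (hA : IsExpandingMatrix A) (hb : 0 < b) (f : C(M, M)) (g : C(M, Fin b → ℝ)) :
    ∃ φ : C(M, Fin b → ℝ), ∀ m, toRealMatrix A *ᵥ φ m = φ (f m) + g m := by
  have : NeZero b := ⟨hb.ne'⟩
  obtain ⟨T', hT, hT'⟩ := exists_complexMap_inverse A hA.det_ne_zero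
  obtain ⟨P, Q, B, D, hPQ, hBPT, hTB, hPB, hDQ, hQD, hTQ, hQQ, ⟨r, hr0, hr, C, hC⟩,
    -, hexp⟩ := exists_splitting (complexMap A) T' hT hT' hA.isHyperbolicMatrix
  -- Without stable part the forward series suffices, so `f` need not be invertible.
  rw [hexp hA, add_zero] at hPQ
  let g' : C(M, Fin b → ℂ) := ⟨fun m => complexify (g m), continuous_complexify.comp g.continuous⟩
  obtain ⟨φ, hφ⟩ := exists_eq_add_comp B hr0 hr hC f
    ⟨fun m => B (g' m), B.continuous.comp g'.continuous⟩
  refine exists_mulVec_eq_of_complex f g φ fun m => ?_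
  have h1 : φ m = B (g' m + φ (f m)) := (hφ m).trans (map_add B _ _).symm
  rw [h1, ← mul_apply_eq_comp, hTB, hPQ, add_comm]
  rfl

end RealMatrix

/-! ### Deck transformations and compactness in the cover -/

section CoverTopology

variable {N : Type v} {M : Type u} [TopologicalSpace N] [TopologicalSpace M] {b : ℕ}
  {p : C(N, M)} {j : C(N, Fin b → ℝ)}

/-- The translate of each point by `c` in its fibre is unique, so only continuity is at stake. Near
`x`, the local section of `p` through the translate of `x` changes `j` by an integer vector at
distance less than 1 from `c`, hence by `c`, and so coincides with the translation. -/
theorem IsPeriodMap.exists_deck (hj : IsPeriodMap p j) (hp : IsLocalHomeomorph p)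
    (c : Fin b → ℤ) : ∃ δ : N ≃ₜ N, (∀ x, p (δ x) = p x) ∧
      ∀ x, j (δ x) = j x + fun i => (c i : ℝ) := by
  choose τ hτp hτj using hj.exists_lift
  have hcont : ∀ c : Fin b → ℤ, Continuous fun x => τ x c := by
    intro c
    rw [continuous_iff_continuousAt]
    intro x
    obtain ⟨e, hye, he⟩ := hp (τ x c)
    have hpe : p x ∈ e.target := by
      rw [← hτp x c, he]
      exact e.map_source hye
    have hsx : e.symm (p x) = τ x c := by
      rw [← hτp x c, he]
      exact e.left_inv hye
    have hs : ContinuousAt (fun z => e.symm (p z)) x :=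
      ContinuousAt.comp (f := p) (e.continuousAt_symm hpe) p.continuous.continuousAt
    have hd : ContinuousAt (fun z => j (e.symm (p z)) - j z) x :=
      (ContinuousAt.comp (f := fun z => e.symm (p z)) j.continuous.continuousAt hs).sub
        j.continuous.continuousAt
    have hball := hd.preimage_mem_nhds (Metric.ball_mem_nhds _ one_pos)
    refine hs.congr ?_
    filter_upwards [hball, p.continuous.continuousAt.preimage_mem_nhds
      (e.open_target.mem_nhds hpe)] with z hz hze
    have hpz : p (e.symm (p z)) = p z := by
      exact (congr_fun he _).trans (e.right_inv (x := p z) hze)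
    refine hj.inj _ _ (hpz.trans (hτp z c).symm) ?_
    obtain ⟨k, hk⟩ := hj.exists_int z (e.symm (p z)) hpz.symm
    rw [hk, hτj]
    congr 1
    have hz' : dist (j (e.symm (p z)) - j z) (j (e.symm (p x)) - j x) < 1 := hz
    rw [hk, hsx, hτj, add_sub_cancel_left, add_sub_cancel_left] at hz'
    ext i
    have h1 := (dist_le_pi_dist _ _ i).trans_lt hz'
    rw [Real.dist_eq, ← Int.cast_sub, ← Int.cast_abs] at h1
    have h2 : |k i - c i| < 1 := by exact_mod_cast h1
    rw [sub_eq_zero.1 (Int.abs_lt_one_iff.1 h2)]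
  have hinv : ∀ (c : Fin b → ℤ) x, τ (τ x c) (-c) = x := by
    intro c x
    refine hj.inj _ _ ((hτp _ _).trans (hτp _ _)) ?_
    rw [hτj, hτj]
    ext i
    simp
  exact ⟨⟨⟨fun x => τ x c, fun x => τ x (-c), hinv c, fun x => by simpa using hinv (-c) x⟩,
    hcont c, hcont (-c)⟩, fun x => hτp x c, fun x => hτj x c⟩

/-- Every point can be moved by a deck transformation into a fixed bounded set. -/
theorem IsPeriodMap.exists_deck_norm_le (hj : IsPeriodMap p j) (hp : IsLocalHomeomorph p) (x : N) :
    ∃ δ : N ≃ₜ N, (∀ x, p (δ x) = p x) ∧ ‖j (δ x)‖ ≤ 1 := by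
  obtain ⟨δ, hδ, hδj⟩ := hj.exists_deck hp fun i => -⌊j x i⌋
  refine ⟨δ, hδ, ?_⟩
  rw [hδj, pi_norm_le_iff_of_nonneg zero_le_one]
  intro i
  rw [Pi.add_apply, Real.norm_eq_abs, abs_le]
  push_cast
  constructor <;> linarith [Int.floor_le (j x i), Int.lt_floor_add_one (j x i)]

theorem IsPeriodMap.t2Space [T2Space M] (hj : IsPeriodMap p j) : T2Space N :=
  T2Space.of_injective_continuous (f := fun x => (j x, p x))
    (fun x y h => hj.inj x y (Prod.ext_iff.1 h).2 (Prod.ext_iff.1 h).1)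
    (j.continuous.prodMk p.continuous)

theorem locallyCompactSpace_of_isLocalHomeomorph [LocallyCompactSpace M]
    (hp : IsLocalHomeomorph p) : LocallyCompactSpace N := by
  let : ChartedSpace M N :=
    { atlas := Set.univ
      chartAt := fun x => (hp x).choose
      mem_chart_source := fun x => (hp x).choose_spec.1
      chart_mem_atlas := fun x => Set.mem_univ _ }
  exact ChartedSpace.locallyCompactSpace M N

theorem isOpen_iff_of_isInducing {Z : Type*} [PseudoMetricSpace Z] {J : N → Z}
    (hJ : Topology.IsInducing J) {d : N → N → ℝ} {c C : ℝ} (hc0 : 0 < c) (hC0 : 0 < C)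
    (hc : ∀ x y, dist (J x) (J y) ≤ c * d x y)
    (hC : ∀ x y, d x y ≤ C * dist (J x) (J y)) (U : Set N) :
    IsOpen U ↔ ∀ x ∈ U, ∃ ε > 0, {y | d x y < ε} ⊆ U := by
  have key : ∀ x, U ∈ 𝓝 x ↔ ∃ ε > 0, {y | d x y < ε} ⊆ U := by
    intro x
    rw [hJ.nhds_eq_comap, Metric.nhds_basis_ball.comap J |>.mem_iff]
    constructor
    · rintro ⟨ε, hε, h⟩
      refine ⟨ε / c, by positivity, fun y hy => h ?_⟩
      rw [Set.mem_preimage, Metric.mem_ball, dist_comm]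
      exact (hc x y).trans_lt ((lt_div_iff₀' hc0).1 hy)
    · rintro ⟨ε, hε, h⟩
      refine ⟨ε / C, by positivity, fun y hy => h ?_⟩
      rw [Set.mem_preimage, Metric.mem_ball, dist_comm] at hy
      exact (hC x y).trans_lt ((lt_div_iff₀' hC0).1 hy)
  simp only [isOpen_iff_mem_nhds, key]

variable [CompactSpace M] [T2Space M]

theorem exists_compact_image_eq_univ (hp : IsLocalHomeomorph p) (hs : Function.Surjective p) :
    ∃ K : Set N, IsCompact K ∧ p '' K = Set.univ := by
  have := locallyCompactSpace_of_isLocalHomeomorph hp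
  choose s hs using hs
  choose K hK hxK using fun m => exists_compact_mem_nhds (s m)
  obtain ⟨t, ht⟩ := isCompact_univ.elim_finite_subcover (fun m => p '' interior (K m))
    (fun m => hp.isOpenMap _ isOpen_interior) fun m _ =>
      Set.mem_iUnion.2 ⟨m, s m, mem_interior_iff_mem_nhds.2 (hxK m), hs m⟩
  refine ⟨⋃ m ∈ t, K m, t.isCompact_biUnion fun m _ => hK m, Set.eq_univ_of_forall fun m => ?_⟩
  obtain ⟨k, hk⟩ := Set.mem_iUnion.1 (ht (Set.mem_univ m))
  obtain ⟨hkt, x, hx, hxm⟩ := Set.mem_iUnion.1 hk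
  exact ⟨x, Set.mem_biUnion hkt (interior_subset hx), hxm⟩

/-- A compact set `K` maps onto `M`. A point with bounded `j` is the translate of a point of `K` by
a bounded integer vector, so finitely many translates of `K` suffice. -/
theorem IsPeriodMap.isCompact_norm_le (hj : IsPeriodMap p j) (hp : IsLocalHomeomorph p)
    (hs : Function.Surjective p) (r : ℝ) : IsCompact {x | ‖j x‖ ≤ r} := by
  obtain ⟨K, hK, hKM⟩ := exists_compact_image_eq_univ hp hs
  choose δ hδ hδj using hj.exists_deck hp
  obtain ⟨R, hR⟩ := (hK.image j.continuous).isBounded.exists_norm_le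
  have hfin : (Set.Icc (fun _ : Fin b => -⌈r + R⌉) fun _ => ⌈r + R⌉).Finite := Set.finite_Icc _ _
  refine (hfin.isCompact_biUnion fun c _ => hK.image (δ c).continuous).of_isClosed_subset
    (isClosed_le j.continuous.norm continuous_const) fun x hx => ?_
  obtain ⟨k, hk, hkx⟩ := hKM.ge (Set.mem_univ (p x))
  obtain ⟨c, hc⟩ := hj.exists_int k x hkx
  refine Set.mem_biUnion (x := c) ?_ ⟨k, hk, hj.inj _ _ ((hδ c k).trans hkx) ?_⟩
  · have h1 : ‖fun i => (c i : ℝ)‖ ≤ r + R := by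
      rw [← sub_eq_iff_eq_add'.2 hc]
      exact (norm_sub_le _ _).trans (add_le_add hx (hR _ ⟨k, hk, rfl⟩))
    have h2 : ∀ i, |(c i : ℝ)| ≤ (⌈r + R⌉ : ℤ) := fun i =>
      ((norm_le_pi_norm (fun i => (c i : ℝ)) i).trans h1).trans (Int.le_ceil _)
    exact ⟨fun i => (abs_le.1 (by exact_mod_cast h2 i : |c i| ≤ ⌈r + R⌉)).1,
      fun i => (abs_le.1 (by exact_mod_cast h2 i : |c i| ≤ ⌈r + R⌉)).2⟩
  · rw [hδj, hc]

/-- An injective continuous map which controls the period map is a closed embedding. -/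
theorem IsPeriodMap.isClosedEmbedding (hj : IsPeriodMap p j) (hp : IsLocalHomeomorph p)
    (hs : Function.Surjective p) {Z : Type*} [MetricSpace Z] [ProperSpace Z] {J : N → Z}
    (hJ : Continuous J) (hinj : Function.Injective J)
    (hb : ∀ (z : Z) (r : ℝ), ∃ R : ℝ, ∀ x, dist (J x) z ≤ r → ‖j x‖ ≤ R) :
    Topology.IsClosedEmbedding J := by
  have hT := hj.t2Space
  refine .of_continuous_injective_isClosedMap hJ hinj ?_
  -- Control of `j` puts preimages of bounded sets into the compact sets `‖j x‖ ≤ R`; thus `J` is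
  -- proper and therefore closed.
  refine (isProperMap_iff_isCompact_preimage.2 ⟨hJ, fun K hK => ?_⟩).isClosedMap
  rcases K.eq_empty_or_nonempty with rfl | ⟨z, hz⟩
  · simp
  obtain ⟨r, hr⟩ := hK.isBounded.subset_closedBall z
  obtain ⟨R, hR⟩ := hb z r
  exact (hj.isCompact_norm_le hp hs R).of_isClosed_subset (hK.isClosed.preimage hJ)
    fun x hx => hR x (hr hx)

end CoverTopology

/-! ### Comparison and construction of equivariant metrics -/

section EquivariantMetrics

variable {N : Type v} {M : Type u} [TopologicalSpace N] [TopologicalSpace M] {b : ℕ}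
  {p : C(N, M)} {j : C(N, Fin b → ℝ)}

theorem IsEquivariantMetric.continuous {d : N → N → ℝ} (hd : IsEquivariantMetric p d) :
    Continuous fun q : N × N => d q.1 q.2 := by
  let : MetricSpace N := MetricSpace.ofDistTopology d (fun x => (hd.eq_zero_iff x x).2 rfl) hd.symm
    hd.triangle (fun U => hd.isOpen_iff U) fun x y h => (hd.eq_zero_iff x y).1 h
  exact continuous_dist

theorem IsEquivariantPseudoMetric.nonneg {d : N → N → ℝ} (hd : IsEquivariantPseudoMetric p d)
    (x y : N) : 0 ≤ d x y := by
  have := hd.triangle x y x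
  rw [hd.self, hd.symm y x] at this
  linarith

theorem IsEquivariantMetric.nonneg {d : N → N → ℝ} (hd : IsEquivariantMetric p d)
    (x y : N) : 0 ≤ d x y := by
  have := hd.triangle x y x
  rw [(hd.eq_zero_iff x x).2 rfl, hd.symm y x] at this
  linarith

variable [CompactSpace M] [T2Space M]

/-- A deck transformation moves `x` to `‖j x‖ ≤ 1`, and then `y` to `‖j y‖ ≤ 1 + r`. On this compact
set the continuous function `d` is bounded; properness of `d` plays no role. -/
theorem IsEquivariantMetric.exists_dist_le {d : N → N → ℝ} (hd : IsEquivariantMetric p d)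
    (hj : IsPeriodMap p j) (hp : IsLocalHomeomorph p) (hs : Function.Surjective p) (r : ℝ) :
    ∃ R, ∀ x y, ‖j x - j y‖ ≤ r → d x y ≤ R := by
  have hK := hj.isCompact_norm_le hp hs (1 + r)
  obtain ⟨R, hR⟩ := ((hK.prod hK).image hd.continuous).bddAbove
  refine ⟨R, fun x y hxy => ?_⟩
  obtain ⟨δ, hδ, hδ1⟩ := hj.exists_deck_norm_le hp x
  rw [← hd.equivariant δ hδ]
  refine hR ⟨(δ x, δ y), ⟨?_, ?_⟩, rfl⟩
  · exact hδ1.trans (le_add_of_nonneg_right ((norm_nonneg _).trans hxy))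
  · change ‖j (δ y)‖ ≤ 1 + r
    have h1 : j (δ y) = j (δ x) + (j y - j x) := by
      rw [← hj.deck δ hδ, add_sub_cancel]
    rw [h1]
    refine (norm_add_le _ _).trans (add_le_add hδ1 ?_)
    rwa [norm_sub_rev]

/-- This is the converse comparison. Once `x` is moved near a base point, `y` lies in a closed ball,
which must be compact for `j` to be bounded on it. -/
theorem IsEquivariantMetric.exists_norm_sub_le {d : N → N → ℝ} (hd : IsEquivariantMetric p d)
    (hdp : IsProperMetric d) (hj : IsPeriodMap p j) (hp : IsLocalHomeomorph p)
    (hs : Function.Surjective p) (K : ℝ) :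
    ∃ R, ∀ x y, d x y ≤ K → ‖j x - j y‖ ≤ R := by
  rcases isEmpty_or_nonempty N with h | ⟨⟨z⟩⟩
  · exact ⟨0, fun x => isEmptyElim x⟩
  obtain ⟨R₁, hR₁⟩ := ((hj.isCompact_norm_le hp hs 1).image
    (hd.continuous.comp (Continuous.prodMk_right z))).bddAbove
  obtain ⟨R, hR⟩ := ((hdp z (R₁ + K)).image j.continuous).isBounded.exists_norm_le
  refine ⟨1 + R, fun x y hxy => ?_⟩
  obtain ⟨δ, hδ, hδ1⟩ := hj.exists_deck_norm_le hp x
  have h1 : d z (δ x) ≤ R₁ := hR₁ ⟨δ x, hδ1, rfl⟩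
  have h2 : d z (δ y) ≤ R₁ + K :=
    (hd.triangle z (δ x) (δ y)).trans (add_le_add h1 (by rwa [hd.equivariant δ hδ]))
  rw [← hj.deck δ hδ]
  exact (norm_sub_le _ _).trans (add_le_add hδ1 (hR _ ⟨δ y, h2, rfl⟩))

/-- The metric is pulled back from the product by the closed embedding `(j, p)`; deck
transformations translate the first component and fix the second. -/
theorem IsPeriodMap.exists_proper_metric [TopologicalSpace.MetrizableSpace M]
    (hj : IsPeriodMap p j) (hp : IsLocalHomeomorph p) (hs : Function.Surjective p) :
    ∃ d : N → N → ℝ, IsEquivariantMetric p d ∧ IsProperMetric d := by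
  let : MetricSpace M := TopologicalSpace.metrizableSpaceMetric M
  let J : N → (Fin b → ℝ) × M := fun x => (j x, p x)
  have hJ : Continuous J := j.continuous.prodMk p.continuous
  have hinj : Function.Injective J := fun x y h =>
    hj.inj x y (Prod.ext_iff.1 h).2 (Prod.ext_iff.1 h).1
  have hcl : Topology.IsClosedEmbedding J := by
    refine hj.isClosedEmbedding hp hs hJ hinj fun z r => ⟨r + ‖z.1‖, fun x hx => ?_⟩
    have h1 : dist (j x) z.1 ≤ r := (le_max_left _ _).trans hx
    rw [dist_eq_norm] at h1
    linarith [norm_sub_norm_le (j x) z.1]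
  refine ⟨fun x y => dist (J x) (J y), ⟨fun x y => ?_, fun x y => dist_comm _ _,
    fun x y z => dist_triangle _ _ _, fun U => ?_, fun δ hδ x y => ?_⟩, fun x r => ?_⟩
  · rw [dist_eq_zero]
    exact hinj.eq_iff
  · exact isOpen_iff_of_isInducing (c := 1) (C := 1) hcl.isInducing one_pos one_pos
      (fun x y => (one_mul _).ge) (fun x y => (one_mul _).ge) U
  · have h1 : dist (j (δ x)) (j (δ y)) = dist (j x) (j y) := by
      rw [dist_eq_norm, dist_eq_norm, hj.deck δ hδ]
    simp only [J, Prod.dist_eq, hδ, h1]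
  · have h1 := hcl.isCompact_preimage (isCompact_closedBall (J x) r)
    convert h1 using 1
    ext y
    simp only [Set.mem_ofPred_eq, Set.mem_preimage, Metric.mem_closedBall, dist_comm]

/-- The metric induced by an injective map at bounded distance from the period map. -/
theorem IsPeriodMap.isEquivariantMetric (hj : IsPeriodMap p j) (hp : IsLocalHomeomorph p)
    (hs : Function.Surjective p) {β : C(N, Fin b → ℝ)} (hβ : Function.Injective β) {φ : M → Fin b → ℝ}
    (hφ : ∀ x, β x = j x + φ (p x)) {K : ℝ} (hK : ∀ m, ‖φ m‖ ≤ K)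
    {L : (Fin b → ℝ) → ℝ} {c C : ℝ} (hc0 : 0 < c) (hC0 : 0 < C) (hc : ∀ v, ‖v‖ ≤ c * L v)
    (hC : ∀ v, L v ≤ C * ‖v‖) (hneg : ∀ v, L (-v) = L v) (hadd : ∀ v w, L (v + w) ≤ L v + L w) :
    IsEquivariantMetric p fun x y => L (β x - β y) := by
  -- Bounded distance to `j` turns a bound on `β` into one on `j`, so `β` is proper.
  have hcl : Topology.IsClosedEmbedding β := by
    refine hj.isClosedEmbedding hp hs β.continuous hβ fun z r => ⟨r + ‖z‖ + K, fun x hx => ?_⟩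
    have h1 : j x = β x - φ (p x) := by rw [hφ, add_sub_cancel_right]
    rw [dist_eq_norm] at hx
    have h2 := norm_sub_le (β x) (φ (p x))
    rw [← h1] at h2
    linarith [norm_sub_norm_le (β x) z, hK (p x)]
  have h0 : L 0 = 0 := by
    have h1 := hc 0
    have h2 := hC 0
    rw [norm_zero, mul_zero] at h2
    rw [norm_zero] at h1
    exact le_antisymm h2 ((mul_nonneg_iff_of_pos_left hc0).1 h1)
  refine ⟨fun x y => ⟨fun h => hβ ?_, fun h => ?_⟩, fun x y => ?_, fun x y z => ?_,
    fun U => ?_, fun δ hδ x y => ?_⟩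
  · have h1 := hc (β x - β y)
    rw [h, mul_zero] at h1
    exact sub_eq_zero.1 (norm_le_zero_iff.1 h1)
  · rw [h, sub_self, h0]
  · rw [← hneg, neg_sub]
  · rw [← sub_add_sub_cancel (β x) (β y) (β z)]
    exact hadd _ _
  · refine isOpen_iff_of_isInducing (c := c) (C := C) hcl.isInducing hc0 hC0
      (fun x y => ?_) (fun x y => ?_) U
    · rw [dist_eq_norm]; exact hc _
    · rw [dist_eq_norm]; exact hC _
  -- The correction `φ ∘ p` is deck invariant, and differences of `j` are too.
  · congr 1
    rw [hφ, hφ, hφ, hφ, hδ, hδ, add_sub_add_comm, hj.deck δ hδ, add_sub_add_comm]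

end EquivariantMetrics

/-! ### The semiconjugacy to the linear map and its descent to the torus -/

section Semiconjugacy

variable {N : Type v} {M : Type u} [TopologicalSpace N] [TopologicalSpace M] {b : ℕ}
  {p : C(N, M)} {j : C(N, Fin b → ℝ)}

/-- By `hA` the defect `j ∘ F - A j` is constant on fibres and descends to `M`; the solution of the
cohomological equation corrects it away. -/
theorem exists_semiconjugacy (hp : IsLocalHomeomorph p) (hs : Function.Surjective p)
    {A : Matrix (Fin b) (Fin b) ℝ} {f : M → M} {F : C(N, N)} (hF : ∀ x, p (F x) = f (p x))
    (hA : ∀ x y, p x = p y → j (F y) - j (F x) = A *ᵥ (j y - j x))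
    (hsol : ∀ g : C(M, Fin b → ℝ), ∃ φ : C(M, Fin b → ℝ), ∀ m, A *ᵥ φ m = φ (f m) + g m) :
    ∃ φ : C(M, Fin b → ℝ), ∀ x, j (F x) + φ (p (F x)) = A *ᵥ (j x + φ (p x)) := by
  have hq : Topology.IsQuotientMap p := hp.isOpenMap.isQuotientMap p.continuous hs
  let g' : C(N, Fin b → ℝ) := ⟨fun x => j (F x) - A *ᵥ j x,
    (j.continuous.comp F.continuous).sub (Continuous.matrix_mulVec continuous_const j.continuous)⟩
  have hg' : Function.FactorsThrough g' p := by
    intro x y h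
    have h1 := hA x y h
    rw [Matrix.mulVec_sub] at h1
    exact (sub_eq_sub_iff_sub_eq_sub.1 h1).symm
  obtain ⟨φ, hφ⟩ := hsol (hq.lift g' hg')
  refine ⟨φ, fun x => ?_⟩
  have h1 : hq.lift g' hg' (p x) = j (F x) - A *ᵥ j x :=
    DFunLike.congr_fun (hq.lift_comp g' hg') x
  rw [Matrix.mulVec_add, hφ, h1, hF]
  abel

theorem unitAddCircle_coe_eq_iff {s t : ℝ} :
    (s : UnitAddCircle) = t ↔ ∃ k : ℤ, (k : ℝ) = s - t := by
  rw [← sub_eq_zero, ← AddCircle.coe_sub, AddCircle.coe_eq_zero_iff]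
  simp

theorem IsPeriodMap.exists_torus_map (hj : IsPeriodMap p j) (hp : IsLocalHomeomorph p)
    (hs : Function.Surjective p) (φ : C(M, Fin b → ℝ)) :
    ∃ β : C(M, Torus b), ∀ x i, β (p x) i = ((j x + φ (p x)) i : UnitAddCircle) := by
  have hq : Topology.IsQuotientMap p := hp.isOpenMap.isQuotientMap p.continuous hs
  let g : C(N, Torus b) := ⟨fun x i => ((j x + φ (p x)) i : UnitAddCircle),
    continuous_pi fun i => (AddCircle.continuous_mk' 1).comp ((continuous_apply i).comp
      (j.continuous.add (φ.continuous.comp p.continuous)))⟩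
  have hg : Function.FactorsThrough g p := by
    intro x y h
    obtain ⟨c, hc⟩ := hj.exists_int y x h.symm
    ext i
    change (((j x + φ (p x)) i : ℝ) : UnitAddCircle) = ((j y + φ (p y)) i : ℝ)
    rw [unitAddCircle_coe_eq_iff]
    exact ⟨c i, by rw [hc, h]; simp⟩
  exact ⟨hq.lift g hg, fun x i => congr_fun (DFunLike.congr_fun (hq.lift_comp g hg) x) i⟩

theorem torus_map_comp (hs : Function.Surjective p) {A : Matrix (Fin b) (Fin b) ℤ} {f : M → M}
    {F : N → N} (hF : ∀ x, p (F x) = f (p x)) {βt : N → Fin b → ℝ}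
    (hβ : ∀ x, βt (F x) = toRealMatrix A *ᵥ βt x) {β : M → Torus b}
    (h : ∀ x i, β (p x) i = (βt x i : UnitAddCircle)) (y : M) :
    β (f y) = toralEndomorphism A (β y) := by
  obtain ⟨x, rfl⟩ := hs y
  ext i
  rw [← hF, h, hβ, toralEndomorphism]
  simp only [h, toRealMatrix, Matrix.mulVec, dotProduct, Matrix.map_apply]
  refine (map_sum (QuotientAddGroup.mk' (AddSubgroup.zmultiples (1 : ℝ))) _ _).trans ?_
  refine Finset.sum_congr rfl fun k _ => ?_
  rw [← zsmul_eq_mul]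
  exact map_zsmul (QuotientAddGroup.mk' (AddSubgroup.zmultiples (1 : ℝ))) _ _

/-- Equal values of `βt` give points of one fibre when `β` is injective, and there `j` separates
points. Conversely, an integer difference of values of `βt` is removed by moving one point within
its fibre. -/
theorem IsPeriodMap.injective_torus_map_iff (hj : IsPeriodMap p j) (hs : Function.Surjective p)
    {φ : M → Fin b → ℝ} {βt : N → Fin b → ℝ} (hφ : ∀ x, βt x = j x + φ (p x)) {β : M → Torus b}
    (h : ∀ x i, β (p x) i = (βt x i : UnitAddCircle)) :
    Function.Injective β ↔ Function.Injective βt := by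
  constructor
  · intro hβ x y hxy
    have h1 : p x = p y := hβ (by ext i; rw [h, h, hxy])
    refine hj.inj x y h1 ?_
    rw [hφ, hφ, h1] at hxy
    exact add_right_cancel hxy
  · intro hβ m m' hm
    obtain ⟨x, rfl⟩ := hs m
    obtain ⟨y, rfl⟩ := hs m'
    have h1 : ∀ i, ∃ c : ℤ, (c : ℝ) = βt x i - βt y i := by
      intro i
      have h2 := congr_fun hm i
      rw [h, h] at h2
      exact unitAddCircle_coe_eq_iff.1 h2
    choose c hc using h1
    obtain ⟨z, hz, hzj⟩ := hj.exists_lift y c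
    rw [← hz]
    refine congr_arg p (hβ ?_)
    rw [hφ z, hz, hzj]
    ext i
    have h2 := hc i
    rw [hφ y] at h2
    simp only [Pi.add_apply] at h2 ⊢
    linarith

variable [CompactSpace M] [T2Space M]

/-- The bound is uniform over all pairs with equal `βt`, so it holds along whole orbits of such a
pair. -/
theorem IsPeriodMap.exists_dist_lt (hj : IsPeriodMap p j) (hp : IsLocalHomeomorph p)
    (hs : Function.Surjective p) {φ : C(M, Fin b → ℝ)} {βt : N → Fin b → ℝ}
    (hφ : ∀ x, βt x = j x + φ (p x)) {d : N → N → ℝ} (hd : IsEquivariantMetric p d) :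
    ∃ R, ∀ x y, βt x = βt y → d x y < R := by
  obtain ⟨R, hR⟩ := hd.exists_dist_le hj hp hs (‖φ‖ + ‖φ‖)
  refine ⟨R + 1, fun x y h => (hR x y ?_).trans_lt (lt_add_one R)⟩
  have h1 : j x - j y = φ (p y) - φ (p x) := by
    rw [hφ, hφ] at h
    exact sub_eq_sub_iff_add_eq_add.2 (h.trans (add_comm _ _))
  rw [h1]
  exact (norm_sub_le _ _).trans (add_le_add (φ.norm_coe_le_norm _) (φ.norm_coe_le_norm _))

theorem IsPeriodMap.exists_norm_sub_le (hj : IsPeriodMap p j) (hp : IsLocalHomeomorph p)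
    (hs : Function.Surjective p) {φ : C(M, Fin b → ℝ)} {βt : N → Fin b → ℝ}
    (hφ : ∀ x, βt x = j x + φ (p x)) {d : N → N → ℝ} (hd : IsEquivariantMetric p d)
    (hdp : IsProperMetric d) (K : ℝ) :
    ∃ R, ∀ x y, d x y < K → ‖βt x - βt y‖ ≤ R := by
  obtain ⟨R, hR⟩ := hd.exists_norm_sub_le hdp hj hp hs K
  refine ⟨R + (‖φ‖ + ‖φ‖), fun x y h => ?_⟩
  rw [hφ, hφ, add_sub_add_comm]
  exact (norm_add_le _ _).trans (add_le_add (hR x y h.le) ((norm_sub_le _ _).trans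
    (add_le_add (φ.norm_coe_le_norm _) (φ.norm_coe_le_norm _))))

end Semiconjugacy

theorem eq_zero_of_pow_mul_le {lam a K : ℝ} (hlam : 1 < lam) (ha : 0 ≤ a)
    (h : ∀ k : ℕ, lam ^ k * a ≤ K) : a = 0 := by
  by_contra hne
  have ha' : 0 < a := lt_of_le_of_ne ha (Ne.symm hne)
  obtain ⟨k, hk⟩ := pow_unbounded_of_one_lt (K / a) hlam
  rw [div_lt_iff₀ ha'] at hk
  exact absurd (h k) (not_le.2 hk)

/-! ### Bounded orbits of hyperbolic and expanding matrices -/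

section MatrixOrbits

variable {b : ℕ} {A : Matrix (Fin b) (Fin b) ℤ}

theorem isUnit_det_toRealMatrix (h : A.det ≠ 0) : IsUnit (toRealMatrix A).det := by
  have h1 : (toRealMatrix A).det = (A.det : ℝ) := (RingHom.map_det (Int.castRingHom ℝ) A).symm
  rw [h1]
  exact isUnit_iff_ne_zero.2 (by exact_mod_cast h)

theorem pow_mul_le_of_mul_le {L : (Fin b → ℝ) → ℝ} {B : Matrix (Fin b) (Fin b) ℝ} {lam : ℝ}
    (hlam : 1 < lam) (h : ∀ v, lam * L v ≤ L (B *ᵥ v)) (v : Fin b → ℝ) (k : ℕ) :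
    lam ^ k * L v ≤ L (B ^ k *ᵥ v) := by
  induction k with
  | zero => simp
  | succ k ih =>
    calc lam ^ (k + 1) * L v = lam * (lam ^ k * L v) := by ring
      _ ≤ lam * L (B ^ k *ᵥ v) := by gcongr
      _ ≤ L (B *ᵥ (B ^ k *ᵥ v)) := h _
      _ = _ := by rw [Matrix.mulVec_mulVec, pow_succ']

theorem IsHyperbolicMatrix.eq_zero_of_bounded (hb : 0 < b) (hdet : A.det ≠ 0)
    (hA : IsHyperbolicMatrix A) {v : Fin b → ℝ} {R : ℝ}
    (h : ∀ i : ℤ, ‖toRealMatrix A ^ i *ᵥ v‖ ≤ R) : v = 0 := by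
  obtain ⟨L₁, L₂, lam, C, hlam, hL, hL₁, hL₂, hA₁, hA₂, -⟩ :=
    exists_adapted_seminorms A hb hdet hA
  have hu := isUnit_det_toRealMatrix hdet
  -- Contraction of `L₂` by `A` is expansion by the inverse, so one growth estimate treats forward
  -- orbits with `L₁` and backward orbits with `L₂`.
  have hA₂' : ∀ v, lam * L₂ v ≤ L₂ ((toRealMatrix A)⁻¹ *ᵥ v) := by
    intro v
    have h1 := hA₂ ((toRealMatrix A)⁻¹ *ᵥ v)
    rwa [Matrix.mulVec_mulVec, Matrix.mul_nonsing_inv _ hu, Matrix.one_mulVec] at h1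
  have hbd : ∀ {L : AddGroupSeminorm (Fin b → ℝ)}, (∀ v, L v ≤ C * ‖v‖) →
      ∀ w, ‖w‖ ≤ R → L w ≤ |C| * R := fun hL w hw =>
    (hL w).trans (mul_le_mul (le_abs_self C) hw (norm_nonneg _) (abs_nonneg _))
  have e1 : L₁ v = 0 := by
    refine eq_zero_of_pow_mul_le (K := |C| * R) hlam (apply_nonneg L₁ v) fun k =>
      (pow_mul_le_of_mul_le hlam hA₁ v k).trans (hbd hL₁ _ ?_)
    have h1 := h k
    rwa [zpow_natCast] at h1
  have e2 : L₂ v = 0 := by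
    refine eq_zero_of_pow_mul_le (K := |C| * R) hlam (apply_nonneg L₂ v) fun k =>
      (pow_mul_le_of_mul_le hlam hA₂' v k).trans (hbd hL₂ _ ?_)
    have h1 := h (-k)
    rwa [Matrix.zpow_neg_natCast, ← Matrix.inv_pow'] at h1
  have := hL v
  rw [e1, e2, add_zero] at this
  exact norm_le_zero_iff.1 this

theorem IsExpandingMatrix.eq_zero_of_bounded (hb : 0 < b) (hA : IsExpandingMatrix A)
    {v : Fin b → ℝ} {R : ℝ} (h : ∀ k : ℕ, ‖toRealMatrix A ^ k *ᵥ v‖ ≤ R) : v = 0 := by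
  obtain ⟨L₁, L₂, lam, C, hlam, hL, hL₁, -, hA₁, -, hexp⟩ :=
    exists_adapted_seminorms A hb hA.det_ne_zero hA.isHyperbolicMatrix
  have e1 : L₁ v = 0 := by
    refine eq_zero_of_pow_mul_le (K := |C| * R) hlam (apply_nonneg L₁ v) fun k =>
      (pow_mul_le_of_mul_le hlam hA₁ v k).trans ((hL₁ _).trans ?_)
    exact mul_le_mul (le_abs_self C) (h k) (norm_nonneg _) (abs_nonneg _)
  have := hL v
  rw [e1, hexp hA, zero_add] at this
  exact norm_le_zero_iff.1 this

theorem IsExpandingMatrix.tendsto_inv_pow_mulVec (hb : 0 < b) (hA : IsExpandingMatrix A)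
    {w : ℕ → Fin b → ℝ} {R : ℝ} (hw : ∀ k, ‖w k‖ ≤ R) :
    Filter.Tendsto (fun k => (toRealMatrix A)⁻¹ ^ k *ᵥ w k) Filter.atTop (𝓝 0) := by
  obtain ⟨L₁, L₂, lam, C, hlam, hL, hL₁, -, hA₁, -, hexp⟩ :=
    exists_adapted_seminorms A hb hA.det_ne_zero hA.isHyperbolicMatrix
  have hu := isUnit_det_toRealMatrix hA.det_ne_zero
  have hlam0 : 0 < lam := one_pos.trans hlam
  refine squeeze_zero_norm (a := fun k => (lam⁻¹) ^ k * (|C| * R)) (fun k => ?_) ?_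
  · have h1 := pow_mul_le_of_mul_le hlam hA₁ ((toRealMatrix A)⁻¹ ^ k *ᵥ w k) k
    have h2 : toRealMatrix A ^ k * (toRealMatrix A)⁻¹ ^ k = 1 := by
      rw [Matrix.inv_pow', Matrix.mul_nonsing_inv]
      rw [Matrix.det_pow]
      exact hu.pow k
    rw [Matrix.mulVec_mulVec, h2, Matrix.one_mulVec] at h1
    have h3 := hL ((toRealMatrix A)⁻¹ ^ k *ᵥ w k)
    rw [hexp hA] at h3
    have h4 : L₁ (w k) ≤ |C| * R :=
      (hL₁ _).trans (mul_le_mul (le_abs_self C) (hw k) (norm_nonneg _) (abs_nonneg _))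
    have h5 : ‖(toRealMatrix A)⁻¹ ^ k *ᵥ w k‖ ≤ L₁ ((toRealMatrix A)⁻¹ ^ k *ᵥ w k) := by
      simpa using h3
    rw [inv_pow, inv_mul_eq_div, le_div_iff₀' (pow_pos hlam0 k)]
    exact ((mul_le_mul_of_nonneg_left h5 (pow_pos hlam0 k).le).trans h1).trans h4
  · have h1 := (tendsto_pow_atTop_nhds_zero_of_lt_one (inv_nonneg.2 hlam0.le)
      (inv_lt_one_of_one_lt₀ hlam)).mul_const (|C| * R)
    rwa [zero_mul] at h1

end MatrixOrbits

/-! ### Functoriality of first homology -/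

section Homology

theorem H1.map_comp {X Y Z : Type u} [TopologicalSpace X] [TopologicalSpace Y] [TopologicalSpace Z]
    (g : C(Y, Z)) (f : C(X, Y)) : H1.map (g.comp f) = H1.map g ∘ₗ H1.map f := by
  have h := ((singularHomologyFunctor (ModuleCat.{u} ℤ) 1).obj
    (ModuleCat.of ℤ (ULift.{u} ℤ))).map_comp (TopCat.ofHom f) (TopCat.ofHom g)
  exact congr_arg ModuleCat.Hom.hom h

theorem H1.map_id {X : Type u} [TopologicalSpace X] :
    H1.map (ContinuousMap.id X) = LinearMap.id := by
  have h := ((singularHomologyFunctor (ModuleCat.{u} ℤ) 1).obj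
    (ModuleCat.of ℤ (ULift.{u} ℤ))).map_id (TopCat.of X)
  exact congr_arg ModuleCat.Hom.hom h

theorem det_homologyMatrix_ne_zero {X : Type u} [TopologicalSpace X] {b : ℕ}
    (Γ : Module.Basis (Fin b) ℤ (H1 X)) (h : X ≃ₜ X) :
    (homologyMatrix Γ (h : C(X, X))).det ≠ 0 := by
  have h1 : homologyMatrix Γ (h.symm : C(X, X)) * homologyMatrix Γ (h : C(X, X)) = 1 := by
    rw [homologyMatrix, homologyMatrix, ← LinearMap.toMatrix_comp, ← H1.map_comp,
      Homeomorph.symm_comp_toContinuousMap, H1.map_id, LinearMap.toMatrix_id]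
  intro h0
  have h2 := congr_arg Matrix.det h1
  rw [Matrix.det_mul, h0, mul_zero, Matrix.det_one] at h2
  exact zero_ne_one h2

end Homology

/-! ### The two equivalence theorems for an abstract period map -/

section Main

variable {N : Type v} {M : Type u} [TopologicalSpace N] [TopologicalSpace M] {b : ℕ}
  {p : C(N, M)} {j : C(N, Fin b → ℝ)} [CompactSpace M] [T2Space M]
  [TopologicalSpace.MetrizableSpace M]

theorem IsPeriodMap.expanding (hb : 0 < b) (hj : IsPeriodMap p j) (hp : IsLocalHomeomorph p)
    (hs : Function.Surjective p) {f : C(M, M)} {F : C(N, N)} {A : Matrix (Fin b) (Fin b) ℤ}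
    (hF : ∀ x, p (F x) = f (p x))
    (hA : ∀ x y, p x = p y → j (F y) - j (F x) = toRealMatrix A *ᵥ (j y - j x))
    (hexp : IsExpandingMatrix A) :
    ∃ (βt : C(N, Fin b → ℝ)) (β : C(M, Torus b)),
      (∀ x, Filter.Tendsto (fun k : ℕ => ((toRealMatrix A)⁻¹ ^ k) *ᵥ j (F^[k] x))
        Filter.atTop (𝓝 (βt x))) ∧
      (∀ x i, β (p x) i = (βt x i : UnitAddCircle)) ∧
      (∀ y, β (f y) = toralEndomorphism A (β y)) ∧
      List.TFAE [
        Function.Injective β,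
        IsCoverExpanding p F,
        ∃ d : N → N → ℝ, IsEquivariantMetric p d ∧ IsProperMetric d ∧ NoShadowing d F,
        ∀ d : N → N → ℝ, IsEquivariantMetric p d → IsProperMetric d → NoShadowing d F] := by
  obtain ⟨φ, hφ⟩ := exists_semiconjugacy hp hs hF hA fun g => hexp.exists_mulVec_eq hb f g
  obtain ⟨β, hβ⟩ := hj.exists_torus_map hp hs φ
  have hu := isUnit_det_toRealMatrix hexp.det_ne_zero
  let βt : C(N, Fin b → ℝ) :=
    ⟨fun x => j x + φ (p x), j.continuous.add (φ.continuous.comp p.continuous)⟩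
  have hβt : ∀ x, βt x = j x + φ (p x) := fun _ => rfl
  have hβF : ∀ x, βt (F x) = toRealMatrix A *ᵥ βt x := hφ
  have hiter : ∀ (k : ℕ) x, βt (F^[k] x) = toRealMatrix A ^ k *ᵥ βt x := by
    intro k
    induction k with
    | zero => simp
    | succ k ih =>
      intro x
      rw [Function.iterate_succ_apply, ih, hβF, Matrix.mulVec_mulVec, pow_succ]
  have hinj : Function.Injective β ↔ Function.Injective βt :=
    hj.injective_torus_map_iff hs hβt hβ
  refine ⟨βt, β, fun x => ?_, hβ, torus_map_comp hs hF hβF hβ, ?_⟩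
  -- `A^{-k} j (F^k x)` is `βt x` minus `A^{-k}` applied to a value of the bounded `φ`, and the last
  -- term tends to 0.
  · have h1 := (tendsto_const_nhds (x := βt x)).sub (hexp.tendsto_inv_pow_mulVec hb
      (w := fun k => φ (p (F^[k] x))) fun k => φ.norm_coe_le_norm _)
    rw [sub_zero] at h1
    refine h1.congr fun k => ?_
    have h2 : (toRealMatrix A)⁻¹ ^ k * toRealMatrix A ^ k = 1 := by
      rw [Matrix.inv_pow', Matrix.nonsing_inv_mul]
      rw [Matrix.det_pow]
      exact hu.pow k
    have h3 : j (F^[k] x) = toRealMatrix A ^ k *ᵥ βt x - φ (p (F^[k] x)) := by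
      rw [← hiter, hβt, add_sub_cancel_right]
    rw [h3, Matrix.mulVec_sub, Matrix.mulVec_mulVec, h2, Matrix.one_mulVec]
  · rw [hinj]
    have hsame : ∀ {x y}, βt x = βt y → ∀ k : ℕ, βt (F^[k] x) = βt (F^[k] y) := by
      intro x y h k
      rw [hiter, hiter, h]
    tfae_have 1 → 2 := by
      intro h
      obtain ⟨L₁, L₂, lam, C, hlam, hL, hL₁, -, hA₁, -, hL0⟩ :=
        exists_adapted_seminorms A hb hexp.det_ne_zero hexp.isHyperbolicMatrix
      refine ⟨fun x y => L₁ (βt x - βt y), hj.isEquivariantMetric hp hs h hβt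
        (fun m => φ.norm_coe_le_norm m) one_pos (C := |C| + 1) (by positivity) (fun v => ?_)
        (fun v => (hL₁ v).trans ?_) (map_neg_eq_map L₁) (map_add_le_add L₁), lam, hlam,
        fun x y => ?_⟩
      · have h1 := hL v
        rw [hL0 hexp] at h1
        simpa using h1
      · gcongr
        linarith [le_abs_self C]
      · change lam * L₁ (βt x - βt y) ≤ L₁ (βt (F x) - βt (F y))
        rw [hβF, hβF, ← Matrix.mulVec_sub]
        exact hA₁ _
    -- If `βt x = βt y`, the distance of the orbits is bounded, yet it is at least `lam ^ k * d x
    -- y`.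
    tfae_have 2 → 1 := by
      rintro ⟨d, hd, lam, hlam, hdF⟩ x y hxy
      obtain ⟨R, hR⟩ := hj.exists_dist_lt hp hs hβt hd
      have h1 : ∀ k : ℕ, lam ^ k * d x y ≤ d (F^[k] x) (F^[k] y) := by
        intro k
        induction k with
        | zero => simp
        | succ k ih =>
          rw [Function.iterate_succ_apply', Function.iterate_succ_apply', pow_succ', mul_assoc]
          exact (mul_le_mul_of_nonneg_left ih (by linarith)).trans (hdF _ _)
      exact (hd.eq_zero_iff x y).1 (eq_zero_of_pow_mul_le hlam (hd.nonneg x y) fun k =>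
        (h1 k).trans (hR _ _ (hsame hxy k)).le)
    tfae_have 1 → 4 := by
      rintro h d hd hdp x y ⟨K, hK⟩
      obtain ⟨R, hR⟩ := hj.exists_norm_sub_le hp hs hβt hd hdp K
      refine h (sub_eq_zero.1 (hexp.eq_zero_of_bounded hb (R := R) fun k => ?_))
      rw [Matrix.mulVec_sub, ← hiter, ← hiter]
      exact hR _ _ (hK k)
    tfae_have 4 → 3 := by
      intro h
      obtain ⟨d, hd, hdp⟩ := hj.exists_proper_metric hp hs
      exact ⟨d, hd, hdp, h d hd hdp⟩
    tfae_have 3 → 1 := by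
      rintro ⟨d, hd, hdp, h⟩ x y hxy
      obtain ⟨R, hR⟩ := hj.exists_dist_lt hp hs hβt hd
      exact h x y ⟨R, fun k => hR _ _ (hsame hxy k)⟩
    tfae_finish

/-- This is the triangle inequality in the complex plane, used for the combined metric. -/
theorem sqrt_add_sq_add_le (a b c d : ℝ) :
    Real.sqrt ((a + b) ^ 2 + (c + d) ^ 2) ≤
      Real.sqrt (a ^ 2 + c ^ 2) + Real.sqrt (b ^ 2 + d ^ 2) := by
  rw [← Complex.norm_add_mul_I, ← Complex.norm_add_mul_I, ← Complex.norm_add_mul_I]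
  refine Eq.trans_le ?_ (norm_add_le _ _)
  congr 1
  push_cast
  ring

theorem IsPeriodMap.hyperbolic (hb : 0 < b) (hj : IsPeriodMap p j) (hp : IsLocalHomeomorph p)
    (hs : Function.Surjective p) {h : M ≃ₜ M} {H : N ≃ₜ N} {A : Matrix (Fin b) (Fin b) ℤ}
    (hH : ∀ x, p (H x) = h (p x))
    (hA : ∀ x y, p x = p y → j (H y) - j (H x) = toRealMatrix A *ᵥ (j y - j x))
    (hdet : A.det ≠ 0) (hhyp : IsHyperbolicMatrix A) :
    ∃ (βt : C(N, Fin b → ℝ)) (β : C(M, Torus b)),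
      (∀ x y, (∃ K : ℝ, ∀ i : ℤ, ‖j ((H ^ i) x) - (toRealMatrix A ^ i) *ᵥ y‖ ≤ K) ↔ y = βt x) ∧
      (∀ x i, β (p x) i = (βt x i : UnitAddCircle)) ∧
      (∀ y, β (h y) = toralEndomorphism A (β y)) ∧
      List.TFAE [
        Function.Injective β,
        IsCoverHyperbolic p H,
        ∃ d : N → N → ℝ, IsEquivariantMetric p d ∧ IsProperMetric d ∧ NoTwoSidedShadowing d H,
        ∀ d : N → N → ℝ, IsEquivariantMetric p d → IsProperMetric d →
          NoTwoSidedShadowing d H] := by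
  obtain ⟨φ, hφ⟩ := exists_semiconjugacy (F := (H : C(N, N))) hp hs hH hA
    fun g => hhyp.exists_mulVec_eq hb hdet h g
  obtain ⟨β, hβ⟩ := hj.exists_torus_map hp hs φ
  have hu := isUnit_det_toRealMatrix hdet
  let βt : C(N, Fin b → ℝ) :=
    ⟨fun x => j x + φ (p x), j.continuous.add (φ.continuous.comp p.continuous)⟩
  have hβt : ∀ x, βt x = j x + φ (p x) := fun _ => rfl
  have hβH : ∀ x, βt (H x) = toRealMatrix A *ᵥ βt x := hφ
  have hβH' : ∀ x, βt (H⁻¹ x) = (toRealMatrix A)⁻¹ *ᵥ βt x := by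
    intro x
    have h1 := hβH (H⁻¹ x)
    rw [show H (H⁻¹ x) = x from H.apply_symm_apply x] at h1
    rw [h1, Matrix.mulVec_mulVec, Matrix.nonsing_inv_mul _ hu, Matrix.one_mulVec]
  have hiter : ∀ (i : ℤ) x, βt ((H ^ i) x) = toRealMatrix A ^ i *ᵥ βt x := by
    intro i
    induction i using Int.induction_on with
    | zero => simp
    | succ k ih =>
      intro x
      rw [zpow_add_one, Matrix.zpow_add_one hu, Homeomorph.mul_apply, ih, hβH,
        Matrix.mulVec_mulVec]
    | pred k ih =>
      intro x
      rw [zpow_sub_one, Matrix.zpow_sub_one hu, Homeomorph.mul_apply, ih, hβH',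
        Matrix.mulVec_mulVec]
  have hinj : Function.Injective β ↔ Function.Injective βt :=
    hj.injective_torus_map_iff hs hβt hβ
  refine ⟨βt, β, fun x y => ⟨?_, ?_⟩, hβ, torus_map_comp hs hH hβH hβ, ?_⟩
  -- `A^i (βt x - y)` is the sum of a value of `φ` and the given bounded quantity, so the difference
  -- has a bounded two-sided orbit and vanishes.
  · rintro ⟨K, hK⟩
    refine (sub_eq_zero.1 (hhyp.eq_zero_of_bounded hb hdet (R := ‖φ‖ + K) fun i => ?_)).symm
    have h1 : toRealMatrix A ^ i *ᵥ (βt x - y) =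
        φ (p ((H ^ i) x)) + (j ((H ^ i) x) - toRealMatrix A ^ i *ᵥ y) := by
      rw [Matrix.mulVec_sub, ← hiter, hβt]
      abel
    rw [h1]
    exact (norm_add_le _ _).trans (add_le_add (φ.norm_coe_le_norm _) (hK i))
  · rintro rfl
    refine ⟨‖φ‖, fun i => ?_⟩
    rw [← hiter, hβt, sub_add_cancel_left, norm_neg]
    exact φ.norm_coe_le_norm _
  · rw [hinj]
    have hsame : ∀ {x y}, βt x = βt y → ∀ i : ℤ, βt ((H ^ i) x) = βt ((H ^ i) y) := by
      intro x y h i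
      rw [hiter, hiter, h]
    tfae_have 1 → 2 := by
      intro hi
      obtain ⟨L₁, L₂, lam, C, hlam, hL, hL₁, hL₂, hA₁, hA₂, -⟩ :=
        exists_adapted_seminorms A hb hdet hhyp
      have hps : ∀ L : AddGroupSeminorm (Fin b → ℝ),
          IsEquivariantPseudoMetric p fun x y => L (βt x - βt y) := by
        intro L
        refine ⟨fun x => by simp, fun x y => map_sub_rev L _ _, fun x y z => ?_, fun δ hδ x y => ?_⟩
        · rw [← sub_add_sub_cancel (βt x) (βt y) (βt z)]
          exact map_add_le_add L _ _
        · congr 1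
          rw [hβt, hβt, hβt, hβt, hδ, hδ, add_sub_add_comm, hj.deck δ hδ, add_sub_add_comm]
      have hL₁' : ∀ v, L₁ v ≤ (|C| + 1) * ‖v‖ := fun v => (hL₁ v).trans (by
        gcongr
        linarith [le_abs_self C])
      have hL₂' : ∀ v, L₂ v ≤ (|C| + 1) * ‖v‖ := fun v => (hL₂ v).trans (by
        gcongr
        linarith [le_abs_self C])
      -- Each seminorm is at most the square root and the square root is at most their sum; hence
      -- the constants 2 and `2 * (|C| + 1)`.
      refine ⟨fun x y => L₁ (βt x - βt y), fun x y => L₂ (βt x - βt y), hps L₁, hps L₂,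
        hj.isEquivariantMetric hp hs (L := fun v => Real.sqrt (L₁ v ^ 2 + L₂ v ^ 2)) hi hβt
        (fun m => φ.norm_coe_le_norm m) two_pos (C := 2 * (|C| + 1)) (by positivity) (fun v => ?_)
        (fun v => ?_) (fun v => ?_) (fun v w => ?_), lam, hlam, fun x y => ?_, fun x y => ?_⟩
      · refine (hL v).trans ?_
        have h1 : L₁ v ≤ Real.sqrt (L₁ v ^ 2 + L₂ v ^ 2) :=
          Real.le_sqrt_of_sq_le (le_add_of_nonneg_right (sq_nonneg _))
        have h2 : L₂ v ≤ Real.sqrt (L₁ v ^ 2 + L₂ v ^ 2) :=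
          Real.le_sqrt_of_sq_le (le_add_of_nonneg_left (sq_nonneg _))
        linarith
      · refine (Real.sqrt_le_iff.2 ⟨?_, ?_⟩ : _ ≤ L₁ v + L₂ v).trans ?_
        · exact add_nonneg (apply_nonneg _ _) (apply_nonneg _ _)
        · nlinarith [mul_nonneg (apply_nonneg L₁ v) (apply_nonneg L₂ v)]
        · linarith [hL₁' v, hL₂' v]
      · simp only [map_neg_eq_map]
      · refine le_trans (Real.sqrt_le_sqrt ?_) (sqrt_add_sq_add_le _ _ _ _)
        have h1 := map_add_le_add L₁ v w
        have h2 := map_add_le_add L₂ v w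
        exact add_le_add (pow_le_pow_left₀ (apply_nonneg _ _) h1 2)
          (pow_le_pow_left₀ (apply_nonneg _ _) h2 2)
      · change lam * L₁ (βt x - βt y) ≤ L₁ (βt (H x) - βt (H y))
        rw [hβH, hβH, ← Matrix.mulVec_sub]
        exact hA₁ _
      · change lam * L₂ (βt x - βt y) ≤ L₂ (βt (H.symm x) - βt (H.symm y))
        have h1 := hA₂ (βt (H.symm x) - βt (H.symm y))
        rwa [Matrix.mulVec_sub, ← hβH, ← hβH, H.apply_symm_apply, H.apply_symm_apply] at h1
    tfae_have 2 → 1 := by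
      rintro ⟨d₁, d₂, hd₁, hd₂, hd, lam, hlam, hdH₁, hdH₂⟩ x y hxy
      obtain ⟨R, hR⟩ := hj.exists_dist_lt hp hs hβt hd
      have h1 : ∀ k : ℕ, lam ^ k * d₁ x y ≤ d₁ ((H ^ (k : ℤ)) x) ((H ^ (k : ℤ)) y) := by
        intro k
        induction k with
        | zero => simp
        | succ k ih =>
          have e : ∀ z, (H ^ ((k + 1 : ℕ) : ℤ)) z = H ((H ^ (k : ℤ)) z) := by
            intro z
            rw [Nat.cast_succ, add_comm, zpow_one_add, Homeomorph.mul_apply]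
          rw [e, e, pow_succ', mul_assoc]
          exact (mul_le_mul_of_nonneg_left ih (by linarith)).trans (hdH₁ _ _)
      have h2 : ∀ k : ℕ, lam ^ k * d₂ x y ≤ d₂ ((H ^ (-k : ℤ)) x) ((H ^ (-k : ℤ)) y) := by
        intro k
        induction k with
        | zero => simp
        | succ k ih =>
          have e : ∀ z, (H ^ (-(k + 1 : ℕ) : ℤ)) z = H.symm ((H ^ (-k : ℤ)) z) := by
            intro z
            rw [Nat.cast_succ, neg_add_rev, zpow_add, zpow_neg_one, Homeomorph.mul_apply]
            rfl
          rw [e, e, pow_succ', mul_assoc]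
          exact (mul_le_mul_of_nonneg_left ih (by linarith)).trans (hdH₂ _ _)
      -- Each pseudo-metric is at most the combined metric, which is bounded along the orbits of
      -- points with equal `βt`; `d₁` would grow forward and `d₂` backward.
      have e1 : d₁ x y = 0 := eq_zero_of_pow_mul_le hlam (hd₁.nonneg x y) fun k =>
        ((h1 k).trans (Real.le_sqrt_of_sq_le (le_add_of_nonneg_right (sq_nonneg _)))).trans
          (hR _ _ (hsame hxy k)).le
      have e2 : d₂ x y = 0 := eq_zero_of_pow_mul_le hlam (hd₂.nonneg x y) fun k =>
        ((h2 k).trans (Real.le_sqrt_of_sq_le (le_add_of_nonneg_left (sq_nonneg _)))).trans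
          (hR _ _ (hsame hxy (-k))).le
      refine (hd.eq_zero_iff x y).1 ?_
      simp [e1, e2]
    tfae_have 1 → 4 := by
      rintro hi d hd hdp x y ⟨K, hK⟩
      obtain ⟨R, hR⟩ := hj.exists_norm_sub_le hp hs hβt hd hdp K
      refine hi (sub_eq_zero.1 (hhyp.eq_zero_of_bounded hb hdet (R := R) fun k => ?_))
      rw [Matrix.mulVec_sub, ← hiter, ← hiter]
      exact hR _ _ (hK k)
    tfae_have 4 → 3 := by
      intro hi
      obtain ⟨d, hd, hdp⟩ := hj.exists_proper_metric hp hs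
      exact ⟨d, hd, hdp, hi d hd hdp⟩
    tfae_have 3 → 1 := by
      rintro ⟨d, hd, hdp, hi⟩ x y hxy
      obtain ⟨R, hR⟩ := hj.exists_dist_lt hp hs hβt hd
      exact hi x y ⟨R, fun k => hR _ _ (hsame hxy k)⟩
    tfae_finish

end Main

/-! ### Metrizability of the manifold and the final assembly -/

theorem metrizableSpace_of_chartedSpace {n : ℕ} (M : Type u) [TopologicalSpace M]
    [ChartedSpace (EuclideanSpace ℝ (Fin n)) M] [T2Space M] [CompactSpace M] :
    TopologicalSpace.MetrizableSpace M := by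
  have := ChartedSpace.secondCountable_of_sigmaCompact (EuclideanSpace ℝ (Fin n)) M
  exact TopologicalSpace.metrizableSpace_of_t3_secondCountable M

end AbelianCover

end

theorem mainTheorem6 {n b : ℕ} (hb : 0 < b)
    {M : Type u} [TopologicalSpace M] [ChartedSpace (EuclideanSpace ℝ (Fin n)) M]
    [IsManifold (𝓡 n) ∞ M] [T2Space M] [CompactSpace M] [ConnectedSpace M]
    {N : Type v} [TopologicalSpace N] (p : C(N, M))
    (hp : AbelianCover.IsUniversalAbelianCover p)
    (Γ : Module.Basis (Fin b) ℤ (AbelianCover.H1 M))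
    (η : Fin b → AbelianCover.CovectorField n M) (hη : AbelianCover.IsDualFamily Γ η)
    (x₀ : N) :
    -- the expanding case
    (∀ (f : C(M, M)) (F : C(N, N)) (A : Matrix (Fin b) (Fin b) ℤ),
      (∀ x, p (F x) = f (p x)) →
      A = AbelianCover.homologyMatrix Γ f →
      AbelianCover.IsExpandingMatrix A →
      ∃ (βt : C(N, Fin b → ℝ)) (β : C(M, AbelianCover.Torus b)),
        (∀ x, Filter.Tendsto
          (fun k : ℕ => ((AbelianCover.toRealMatrix A)⁻¹ ^ k) *ᵥ
            AbelianCover.abelJacobi p η x₀ (F^[k] x)) Filter.atTop (𝓝 (βt x))) ∧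
        (∀ x i, β (p x) i = (βt x i : UnitAddCircle)) ∧
        (∀ y, β (f y) = AbelianCover.toralEndomorphism A (β y)) ∧
        List.TFAE [
          Function.Injective β,
          AbelianCover.IsCoverExpanding p F,
          ∃ d : N → N → ℝ, AbelianCover.IsEquivariantMetric p d ∧
            AbelianCover.IsProperMetric d ∧ AbelianCover.NoShadowing d F,
          ∀ d : N → N → ℝ, AbelianCover.IsEquivariantMetric p d →
            AbelianCover.IsProperMetric d → AbelianCover.NoShadowing d F]) ∧
    -- the hyperbolic case
    (∀ (h : M ≃ₜ M) (H : N ≃ₜ N) (A : Matrix (Fin b) (Fin b) ℤ),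
      (∀ x, p (H x) = h (p x)) →
      A = AbelianCover.homologyMatrix Γ (h : C(M, M)) →
      AbelianCover.IsHyperbolicMatrix A →
      ∃ (βt : C(N, Fin b → ℝ)) (β : C(M, AbelianCover.Torus b)),
        (∀ x y, (∃ K : ℝ, ∀ i : ℤ,
          ‖AbelianCover.abelJacobi p η x₀ ((H ^ i) x) -
            ((AbelianCover.toRealMatrix A) ^ i) *ᵥ y‖ ≤ K) ↔ y = βt x) ∧
        (∀ x i, β (p x) i = (βt x i : UnitAddCircle)) ∧
        (∀ y, β (h y) = AbelianCover.toralEndomorphism A (β y)) ∧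
        List.TFAE [
          Function.Injective β,
          AbelianCover.IsCoverHyperbolic p H,
          ∃ d : N → N → ℝ, AbelianCover.IsEquivariantMetric p d ∧
            AbelianCover.IsProperMetric d ∧ AbelianCover.NoTwoSidedShadowing d H,
          ∀ d : N → N → ℝ, AbelianCover.IsEquivariantMetric p d →
            AbelianCover.IsProperMetric d → AbelianCover.NoTwoSidedShadowing d H]) := by
  obtain ⟨j, hJ, hj, hlift⟩ := AbelianCover.exists_periodMap hp Γ hη x₀
  have hloc := hp.covering.isLocalHomeomorph
  have := AbelianCover.metrizableSpace_of_chartedSpace (n := n) M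
  -- With the integral replaced by the continuous period map, the smooth structure plays no further
  -- role.
  simp only [hJ]
  refine ⟨?_, ?_⟩
  · rintro f F A hF rfl hA
    exact hj.expanding hb hloc hp.surjective hF (hlift f F hF) hA
  · rintro h H A hH rfl hA
    exact hj.hyperbolic hb hloc hp.surjective hH (hlift h H hH)
      (AbelianCover.det_homologyMatrix_ne_zero Γ h) hA
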